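/- Let $d\in\{1,2,3,4\}$, $a>0$, $p=\frac4d$ and $\sigma=\frac4d+2$. Consider the damped nonlinear Schrödinger equation on $\mathbb R^d$ $$iu_t+\Delta u+|u|^{4/d}u+ia|u|^pu=0,\qquad u(0)=u_0. \tag{1}$$ For $0<T\le\infty$, an $H^1$ solution of (1) on $[0,T)$ is a function $u\in C([0,T);H^1(\mathbb R^d))$, and an $L^2$ solution of (1) on $[0,T)$ is a function $u\in C([0,T);L^2(\mathbb R^d))$ with $u\in L^\sigma([0,t];L^\sigma(\mathbb R^d))$ for every $t<T$, such that $u(0)=u_0$ and $$u(t)=u_0+i\int_0^t\bigl(\Delta u(s)+|u(s)|^{4/d}u(s)+ia|u(s)|^pu(s)\bigr)\,ds\qquad(0\le t<T)$$ holds in the sense of tempered distributions on $\mathbb R^d$. A solution on $[0,T^*)$ is maximal if no solution of the same kind on $[0,T')$ with $T'>T^*$ extends it. (i) Let $u$ be a maximal $H^1$ solution, or a maximal $L^2$ solution, of (1) on $[0,T^*)$. If $T^*<\infty$, then $\|u\|_{L^\sigma([0,T^*);L^\sigma(\mathbb R^d))}=\infty$. (ii) For every $u_0\in H^1(\mathbb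 R^d)$ there is an $H^1$ solution of (1) on $[0,\infty)$, and every $H^1$ solution of (1) on an interval $[0,T)$ is a restriction of it. The same holds for $L^2$ solutions, for every $u_0\in L^2(\mathbb R^d)$. In particular, every maximal solution is global. -/

import Mathlib

open MeasureTheory Set
open scoped ENNReal SchwartzMap Laplacian

noncomputable section

namespace DampedNLS

/-- The Euclidean space `ℝ^d`. -/
abbrev Space (d : ℕ) : Type := EuclideanSpace ℝ (Fin d)

/-- The Hilbert space `L²(ℝ^d; ℂ)`. -/
abbrev L2 (d : ℕ) : Type := Lp ℂ 2 (volume : Measure (Space d))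

/-- The tempered distribution on `ℝ^d` given by an `L²` function. -/
abbrev toDistr {d : ℕ} (f : L2 d) : 𝓢'(Space d, ℂ) := (f : 𝓢'(Space d, ℂ))

/-- The time interval `[0, T)`, where `T` may be `+∞`. -/
def timeInterval (T : EReal) : Set ℝ := {t : ℝ | 0 ≤ t ∧ (t : EReal) < T}

/-- The exponent `σ = 4/d + 2`. -/
def sigma (d : ℕ) : ℝ≥0∞ := ENNReal.ofReal (4 / (d : ℝ) + 2)

/-- The mixed norm `‖u‖_{L^σ(I; L^σ(ℝ^d))}` over a set `I` of times, with values in `[0, ∞]`. -/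
def sigmaNorm {d : ℕ} (u : ℝ → L2 d) (I : Set ℝ) : ℝ≥0∞ :=
  eLpNorm (fun t : ℝ => eLpNorm (u t) (sigma d) volume) (sigma d) (volume.restrict I)

/-- The nonlinear terms `|z|^{4/d} z + i a |z|^p z` of the equation. -/
def nonlinearity (d : ℕ) (a p : ℝ) (z : ℂ) : ℂ :=
  ((‖z‖ ^ (4 / (d : ℝ)) : ℝ) : ℂ) * z + Complex.I * (a : ℂ) * ((‖z‖ ^ p : ℝ) : ℂ) * z

/-- `i u_t + Δu + |u|^{4/d} u + i a |u|^p u = 0` on `[0, T)` with `u(0) = u₀`, as an identity between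
tempered distributions on `ℝ^d`, integrated in time:
`u(t) = u₀ + i ∫₀ᵗ (Δu(s) + |u(s)|^{4/d} u(s) + i a |u(s)|^p u(s)) ds`. -/
def SolvesEquation (d : ℕ) (a p : ℝ) (u₀ : L2 d) (u : ℝ → L2 d) (T : EReal) : Prop :=
  u 0 = u₀ ∧
  ∀ φ : 𝓢(Space d, ℂ), ∀ t ∈ timeInterval T,
    toDistr (u t) φ = toDistr u₀ φ +
      Complex.I * ∫ s in (0 : ℝ)..t,
        ((Δ (toDistr (u s))) φ + ∫ x : Space d, nonlinearity d a p (u s x) * φ x)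

/-- `u ∈ C(I; H¹(ℝ^d))`: the function `(1 - Δ/(4π²))^{1/2} u(t)`, whose `L²` norm is an `H¹` norm of
`u(t)`, belongs to `L²` for `t ∈ I` and depends continuously on `t ∈ I` in `L²`. -/
def ContinuousInH1 {d : ℕ} (u : ℝ → L2 d) (I : Set ℝ) : Prop :=
  ∃ w : ℝ → L2 d, ContinuousOn w I ∧
    ∀ t ∈ I, TemperedDistribution.besselPotential (Space d) ℂ 1 (toDistr (u t)) = toDistr (w t)

/-- `u₀ ∈ H¹(ℝ^d)`. -/
def MemH1 {d : ℕ} (u₀ : L2 d) : Prop := TemperedDistribution.MemSobolev 1 2 (toDistr u₀)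

/-- An `H¹` solution on `[0, T)`: `u ∈ C([0, T); H¹)` solves the equation with `u(0) = u₀`. -/
structure IsH1Solution (d : ℕ) (a p : ℝ) (u₀ : L2 d) (u : ℝ → L2 d) (T : EReal) : Prop where
  pos : 0 < T
  continuous : ContinuousInH1 u (timeInterval T)
  equation : SolvesEquation d a p u₀ u T

/-- An `L²` solution on `[0, T)`: `u ∈ C([0, T); L²) ∩ L^σ_loc([0, T); L^σ)` solves the equation with
`u(0) = u₀`. -/
structure IsL2Solution (d : ℕ) (a p : ℝ) (u₀ : L2 d) (u : ℝ → L2 d) (T : EReal) : Prop where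
  pos : 0 < T
  continuous : ContinuousOn u (timeInterval T)
  sigma_loc : ∀ t ∈ timeInterval T, sigmaNorm u (Icc 0 t) < ∞
  equation : SolvesEquation d a p u₀ u T

/-- For a notion `Sol` of solution on `[0, T)`: `u` is a solution on `[0, T)` and no solution on a
strictly longer interval extends it. -/
def IsMaximal {d : ℕ} (Sol : (ℝ → L2 d) → EReal → Prop) (u : ℝ → L2 d) (T : EReal) : Prop :=
  Sol u T ∧ ∀ (v : ℝ → L2 d) (T' : EReal), Sol v T' → EqOn v u (timeInterval T) → T' ≤ T

/-- For a notion `Sol` of solution on `[0, T)`: there is a solution on `[0, ∞)`, and every solution is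
a restriction of it. -/
def HasUniqueGlobalSolution {d : ℕ} (Sol : (ℝ → L2 d) → EReal → Prop) : Prop :=
  ∃ u : ℝ → L2 d, Sol u ⊤ ∧
    ∀ (v : ℝ → L2 d) (T : EReal), Sol v T → EqOn v u (timeInterval T)

end DampedNLS

end

noncomputable section

namespace DampedNLS

/-! Write q = 4/d, so that σ = q + 2, and q ≥ 1 because d ≤ 4. As p = q, the two nonlinear terms
merge and the equation reads u_t = iΔu + c|u|^q u with c = i(1 + ia), Re c = -a. Formally d/dt ‖u‖²
= -2a ‖u‖_σ^σ, so the damping bounds the σ-th power of the space-time norm on every interval by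
‖u₀‖²/(2a) (`IsMild.mass`, `IsMild.lintegral_le`). In this mass-critical problem that norm is what
governs continuation, so solutions are global (`exists_mild`). Part (i) then holds vacuously: no
maximal solution has a finite T*.

The linear theory starts from the L¹ → L^∞ decay of the free group (`norm_schwartzS_le`).
Interpolating with conservation of the L² norm (`marcinkiewicz`) gives decay between σ' and σ, and
`hardy_littlewood_sobolev` together with a TT* argument gives `strichartz`. The source |u|^q u is
only controlled in L^{σ'}, not in L², so Duhamel's formula is used tested against free waves
(`pairing`, `Duhamel`). A contraction argument gives local solutions (`exists_local`) and an
absorption argument gives stability and uniqueness (`exists_stability`, `IsMild.eqOn`). The length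
of the local interval depends on the σ-norm of the free evolution of the datum rather than on its
mass, which is why the bound on the σ-norm, and not conservation of mass alone, is needed to
continue.

Neither the mass law nor the passage between the distributional equation and Duhamel's formula
(`weakDefect_eq_zero`, `isMild_of_weakDefect`) is obtained by differentiating. Both follow from
`eq_of_increments_le`: a function whose increments are small relative to an additive integral is
constant.

For H¹ data the solution is compared with its translates. Stability bounds ‖u(t, · + h) - u(t)‖ by a
constant times the same quantity at time 0, uniformly in h, and difference quotients characterise
the Dirichlet integral (`dirichlet_le`, `IsMild.exists_bessel`). The embedding H¹ ⊆ L^σ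
(`exists_sobolev`) puts H¹ solutions into the L² uniqueness class. -/

/-! ### The Hardy–Littlewood–Sobolev inequality on the line -/

lemma lintegral_Ioo_rpow {p : ℝ} (hp : -1 < p) {M : ℝ} (hM : 0 ≤ M) :
    ∫⁻ x in Ioo 0 M, ENNReal.ofReal (x ^ p) = ENNReal.ofReal (M ^ (p + 1) / (p + 1)) := by
  have hint : IntegrableOn (fun x : ℝ => x ^ p) (Ioc 0 M) :=
    (intervalIntegrable_iff_integrableOn_Ioc_of_le hM).1 (intervalIntegral.intervalIntegrable_rpow' hp)
  rw [Measure.restrict_congr_set Ioo_ae_eq_Ioc,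
    ← ofReal_integral_eq_lintegral_ofReal hint ?_, ← intervalIntegral.integral_of_le hM,
    integral_rpow (Or.inl hp), Real.zero_rpow (by linarith), sub_zero]
  filter_upwards [ae_restrict_mem measurableSet_Ioc] with x hx
  exact Real.rpow_nonneg hx.1.le _

lemma lintegral_Ioo_rpow_toReal {p : ℝ} (hp : -1 < p) (M : ℝ≥0∞) :
    ∫⁻ x in {x : ℝ | 0 < x ∧ ENNReal.ofReal x < M}, ENNReal.ofReal (x ^ p)
      = M ^ (p + 1) / ENNReal.ofReal (p + 1) := by
  have hp1 : 0 < p + 1 := by linarith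
  rcases eq_or_ne M ∞ with rfl | hM
  · rw [ENNReal.top_rpow_of_pos hp1, ENNReal.top_div_of_ne_top ENNReal.ofReal_ne_top]
    refine ENNReal.eq_top_of_forall_nnreal_le fun r => ?_
    -- Solves `R ^ (p + 1) / (p + 1) = r`, so the integral over `(0, R)` already reaches the
    -- arbitrary bound `r`.
    set R : ℝ := ((p + 1) * r) ^ (p + 1)⁻¹ with hR
    have h0 : 0 ≤ (p + 1) * (r : ℝ) := by positivity
    have hR0 : 0 ≤ R := Real.rpow_nonneg h0 _
    calc (r : ℝ≥0∞) = ENNReal.ofReal (R ^ (p + 1) / (p + 1)) := by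
          rw [hR, Real.rpow_inv_rpow h0 hp1.ne', mul_div_cancel_left₀ _ hp1.ne']; simp
      _ = ∫⁻ x in Ioo 0 R, ENNReal.ofReal (x ^ p) := (lintegral_Ioo_rpow hp hR0).symm
      _ ≤ _ := lintegral_mono_set (show Ioo 0 R ⊆ {x : ℝ | 0 < x ∧ ENNReal.ofReal x < ∞} from
          fun x hx => ⟨hx.1, ENNReal.ofReal_lt_top⟩)
  · have : {x : ℝ | 0 < x ∧ ENNReal.ofReal x < M} = Ioo 0 M.toReal := by
      ext x
      simp only [mem_ofPred_eq, mem_Ioo, and_congr_right_iff]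
      intro hx
      rw [ENNReal.ofReal_lt_iff_lt_toReal hx.le hM]
    rw [this, lintegral_Ioo_rpow hp ENNReal.toReal_nonneg,
      ENNReal.ofReal_div_of_pos hp1, ← ENNReal.ofReal_rpow_of_nonneg ENNReal.toReal_nonneg hp1.le,
      ENNReal.ofReal_toReal hM]

/-- The layer cake formula for functions with values in `[0, ∞]`. -/
lemma lintegral_rpow_layercake {α : Type*} [MeasurableSpace α] (μ : Measure α) [SFinite μ]
    {g : α → ℝ≥0∞} (hg : Measurable g) {q : ℝ} (hq : 0 < q) :
    ∫⁻ a, g a ^ q ∂μ = ENNReal.ofReal q *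
      ∫⁻ x in Ioi (0 : ℝ), ENNReal.ofReal (x ^ (q - 1)) * μ {a | ENNReal.ofReal x < g a} := by
  have h1 : ∀ a, g a ^ q = ENNReal.ofReal q * ∫⁻ x in Ioi (0 : ℝ),
      {x : ℝ | ENNReal.ofReal x < g a}.indicator (fun x => ENNReal.ofReal (x ^ (q - 1))) x := by
    intro a
    have hm : MeasurableSet {x : ℝ | ENNReal.ofReal x < g a} :=
      measurableSet_lt ENNReal.measurable_ofReal measurable_const
    rw [lintegral_indicator hm, Measure.restrict_restrict hm]
    have : {x : ℝ | ENNReal.ofReal x < g a} ∩ Ioi 0 = {x : ℝ | 0 < x ∧ ENNReal.ofReal x < g a} := by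
      ext x; simp [and_comm]
    rw [this, lintegral_Ioo_rpow_toReal (by linarith), sub_add_cancel,
      ENNReal.mul_div_cancel (by simpa using hq) ENNReal.ofReal_ne_top]
  have hmeas : Measurable (fun p : α × ℝ => {x : ℝ | ENNReal.ofReal x < g p.1}.indicator
      (fun x => ENNReal.ofReal (x ^ (q - 1))) p.2) := by
    have hs : MeasurableSet {p : α × ℝ | ENNReal.ofReal p.2 < g p.1} :=
      measurableSet_lt (ENNReal.measurable_ofReal.comp measurable_snd) (hg.comp measurable_fst)
    have := (Measurable.indicator (f := fun p : α × ℝ => ENNReal.ofReal (p.2 ^ (q - 1)))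
      (by fun_prop) hs)
    exact this
  simp_rw [h1]
  rw [lintegral_const_mul _ hmeas.lintegral_prod_right', lintegral_lintegral_swap hmeas.aemeasurable]
  congr 1
  refine lintegral_congr fun x => ?_
  have hs : MeasurableSet {a | ENNReal.ofReal x < g a} := measurableSet_lt measurable_const hg
  rw [← lintegral_indicator_const hs]
  rfl

lemma enorm_kernel_near {l : ℝ} (hl : l < 1) {R : ℝ} (hR : 0 ≤ R) (t : ℝ) :
    ∫⁻ s, (Iio R).indicator (fun r => ENNReal.ofReal r ^ (-l)) |t - s|
      = 2 * ENNReal.ofReal (R ^ (1 - l) / (1 - l)) := by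
  have h1 : ∫⁻ s, (Iio R).indicator (fun r => ENNReal.ofReal r ^ (-l)) |t - s|
      = ∫⁻ s, (Iio R).indicator (fun r => ENNReal.ofReal r ^ (-l)) |s| := by
    rw [← lintegral_sub_left_eq_self (fun s => (Iio R).indicator (fun r => ENNReal.ofReal r ^ (-l)) |s|) t]
  have hpos : ∫⁻ s in Ioi (0 : ℝ), (Iio R).indicator (fun r => ENNReal.ofReal r ^ (-l)) s
      = ENNReal.ofReal (R ^ (1 - l) / (1 - l)) := by
    rw [lintegral_indicator measurableSet_Iio, Measure.restrict_restrict measurableSet_Iio,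
      inter_comm, Ioi_inter_Iio, show (1 : ℝ) - l = -l + 1 by ring,
      ← lintegral_Ioo_rpow (by linarith) hR]
    refine setLIntegral_congr_fun measurableSet_Ioo fun x hx => ?_
    exact ENNReal.ofReal_rpow_of_pos hx.1
  rw [h1, ← lintegral_add_compl _ (measurableSet_Ioi (a := (0 : ℝ))), compl_Ioi,
    Measure.restrict_congr_set (Iio_ae_eq_Iic (a := (0 : ℝ))).symm, two_mul]
  congr 1
  · rw [← hpos]
    refine setLIntegral_congr_fun measurableSet_Ioi fun x hx => ?_
    simp [abs_of_pos (show 0 < x from hx)]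
  · rw [← hpos, ← lintegral_indicator measurableSet_Iio, ← lintegral_indicator measurableSet_Ioi,
      ← lintegral_neg_eq_self]
    refine lintegral_congr fun x => ?_
    by_cases hx : 0 < x <;> simp [hx, indicator, abs_of_pos]

/-- The exponent -2 is what remains of |t - s|^{-2/q} after the q-th power is taken in Hölder's
inequality. -/
lemma enorm_kernel_far {R : ℝ} (hR : 0 < R) (t : ℝ) :
    ∫⁻ s, (Ici R).indicator (fun r => ENNReal.ofReal r ^ (-2 : ℝ)) |t - s|
      = 2 * ENNReal.ofReal (R⁻¹) := by
  have h1 : ∫⁻ s, (Ici R).indicator (fun r => ENNReal.ofReal r ^ (-2 : ℝ)) |t - s|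
      = ∫⁻ s, (Ici R).indicator (fun r => ENNReal.ofReal r ^ (-2 : ℝ)) |s| := by
    rw [← lintegral_sub_left_eq_self (fun s => (Ici R).indicator (fun r => ENNReal.ofReal r ^ (-2 : ℝ)) |s|) t]
  have hpos : ∫⁻ s in Ioi (0 : ℝ), (Ici R).indicator (fun r => ENNReal.ofReal r ^ (-2 : ℝ)) s
      = ENNReal.ofReal (R⁻¹) := by
    rw [lintegral_indicator measurableSet_Ici, Measure.restrict_restrict measurableSet_Ici,
      show Ici R ∩ Ioi 0 = Ici R from inter_eq_left.2 fun x hx => lt_of_lt_of_le hR hx,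
      Measure.restrict_congr_set Ioi_ae_eq_Ici.symm]
    have hi := integrableOn_Ioi_rpow_of_lt (show (-2 : ℝ) < -1 by norm_num) hR
    have := integral_Ioi_rpow_of_lt (show (-2 : ℝ) < -1 by norm_num) hR
    rw [show R⁻¹ = ∫ x in Ioi R, x ^ (-2 : ℝ) by
      rw [this]; norm_num [Real.rpow_neg_one],
      ofReal_integral_eq_lintegral_ofReal hi ?_]
    · refine setLIntegral_congr_fun measurableSet_Ioi fun x hx => ?_
      exact ENNReal.ofReal_rpow_of_pos (hR.trans hx)
    · filter_upwards [ae_restrict_mem measurableSet_Ioi] with x hx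
      exact Real.rpow_nonneg (hR.trans hx).le _
  rw [h1, ← lintegral_add_compl _ (measurableSet_Ioi (a := (0 : ℝ))), compl_Ioi,
    Measure.restrict_congr_set (Iio_ae_eq_Iic (a := (0 : ℝ))).symm, two_mul]
  congr 1
  · rw [← hpos]
    refine setLIntegral_congr_fun measurableSet_Ioi fun x hx => ?_
    simp [abs_of_pos (show 0 < x from hx)]
  · rw [← hpos, ← lintegral_indicator measurableSet_Iio, ← lintegral_indicator measurableSet_Ioi,
      ← lintegral_neg_eq_self]
    refine lintegral_congr fun x => ?_
    by_cases hx : 0 < x <;> simp [hx, indicator, abs_of_pos]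


/-- The truncated Riesz potential is at most `μ / 3` plus the contribution of the near part of the
kernel and the large values of `f`. -/
lemma riesz_potential_le_split {q : ℝ} (hq : 2 < q) {f : ℝ → ℝ≥0∞} (hf : Measurable f)
    (hf1 : ∫⁻ s, f s ^ (q / (q - 1)) ≤ 1) {m R γ : ℝ} (hm : 0 < m) (hR : R = 2 * (m⁻¹) ^ q)
    (hγ : 0 ≤ γ) (hγm : γ * (2 * (R ^ (1 - 2 / q) / (1 - 2 / q))) = m) (t : ℝ) :
    ∫⁻ s, ENNReal.ofReal |t - s| ^ (-(2 / q)) * f s ≤ 2 * ENNReal.ofReal m +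
      ∫⁻ s, (Iio R).indicator (fun r => ENNReal.ofReal r ^ (-(2 / q))) |t - s| *
        {s | ENNReal.ofReal γ < f s}.indicator f s := by
  have hq0 : 0 < q := by linarith
  have hl : 2 / q < 1 := by rw [div_lt_one hq0]; exact hq
  have hR0 : 0 < R := by rw [hR]; positivity
  have hsel : MeasurableSet {s | ENNReal.ofReal γ < f s} := measurableSet_lt measurable_const hf
  have hker : ∀ S : Set ℝ, MeasurableSet S → ∀ l : ℝ,
      Measurable fun s => S.indicator (fun r => ENNReal.ofReal r ^ l) |t - s| := by
    intro S hS l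
    exact (Measurable.indicator (f := fun r : ℝ => ENNReal.ofReal r ^ l) (by fun_prop) hS).comp
      (by fun_prop)
  have hsplit : ∀ s, ENNReal.ofReal |t - s| ^ (-(2 / q)) * f s ≤
      (Ici R).indicator (fun r => ENNReal.ofReal r ^ (-(2 / q))) |t - s| * f s +
      ((Iio R).indicator (fun r => ENNReal.ofReal r ^ (-(2 / q))) |t - s| * ENNReal.ofReal γ +
      (Iio R).indicator (fun r => ENNReal.ofReal r ^ (-(2 / q))) |t - s| *
        {s | ENNReal.ofReal γ < f s}.indicator f s) := by
    intro s
    by_cases h1 : |t - s| < R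
    · by_cases h2 : ENNReal.ofReal γ < f s
      · simp [indicator, h1, h2, not_le.2 h1]
      · simp only [indicator, mem_Ici, not_le.2 h1, mem_Iio, h1, mem_ofPred_eq, h2, if_true,
          if_false, zero_mul, mul_zero, add_zero, zero_add]
        gcongr
        exact not_lt.1 h2
    · simp [indicator, h1, not_lt.1 h1]
  refine (lintegral_mono hsplit).trans ?_
  have hA : Measurable fun s =>
      (Ici R).indicator (fun r => ENNReal.ofReal r ^ (-(2 / q))) |t - s| * f s :=
    (hker _ measurableSet_Ici _).mul hf
  have hB : Measurable fun s =>
      (Iio R).indicator (fun r => ENNReal.ofReal r ^ (-(2 / q))) |t - s| * ENNReal.ofReal γ :=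
    (hker _ measurableSet_Iio _).mul_const _
  rw [lintegral_add_left hA, lintegral_add_left hB, two_mul, add_assoc]
  gcongr
  -- Far part: by Hölder it is at most the L^q norm of the far kernel, and `R` was chosen so that
  -- the q-th power of this norm, 2/R, equals m^q.
  · have hconj : q.HolderConjugate (q / (q - 1)) := Real.HolderConjugate.conjExponent (by linarith)
    refine (ENNReal.lintegral_mul_le_Lp_mul_Lq volume hconj
      (hker _ measurableSet_Ici _).aemeasurable hf.aemeasurable).trans ?_
    have hpow : ∀ s, (Ici R).indicator (fun r => ENNReal.ofReal r ^ (-(2 / q))) |t - s| ^ q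
        = (Ici R).indicator (fun r => ENNReal.ofReal r ^ (-2 : ℝ)) |t - s| := by
      intro s
      by_cases h1 : R ≤ |t - s|
      · simp only [indicator, mem_Ici, h1, if_true]
        rw [← ENNReal.rpow_mul]; congr 1; field_simp
      · simp [indicator, h1, hq0]
    simp_rw [hpow]
    rw [enorm_kernel_far hR0]
    have h3 : (2 : ℝ≥0∞) * ENNReal.ofReal R⁻¹ = ENNReal.ofReal (m ^ q) := by
      rw [hR, ← ENNReal.ofReal_ofNat 2, ← ENNReal.ofReal_mul (by norm_num)]
      congr 1
      rw [Real.inv_rpow hm.le, mul_inv, inv_inv]; ring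
    calc _ ≤ ENNReal.ofReal (m ^ q) ^ (1 / q) * 1 := by
          rw [h3]; gcongr
          exact ENNReal.rpow_le_one hf1 (one_div_nonneg.2 (div_nonneg hq0.le (by linarith)))
      _ = ENNReal.ofReal m := by
          rw [mul_one, ENNReal.ofReal_rpow_of_nonneg (by positivity) (by positivity),
            ← Real.rpow_mul hm.le, mul_one_div_cancel hq0.ne', Real.rpow_one]
  -- Near part, small values: the mass of the near kernel times `γ` is exactly `m`.
  · rw [lintegral_mul_const _ (hker _ measurableSet_Iio _), enorm_kernel_near hl hR0.le,
      ← ENNReal.ofReal_ofNat 2, ← ENNReal.ofReal_mul (by norm_num),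
      ← ENNReal.ofReal_mul' hγ, mul_comm, hγm]

/-- A weak-type argument whose cut-offs depend on the level x. With R = 2(x/3)^{-q} and γ =
x^{q-1}/(3c₁), the far part and the small values of f contribute at most x/3 each, so above level x
the near part acting on large values is at least x/3. Chebyshev and the kernel mass c₁x^{2-q} bound
x^{q-1}|{I > x}| by 3c₁ times the integral of f over {f > x^{q-1}/(3c₁)}. Integrating in x first
gives, for each s, an interval of length (3c₁f(s))^{1/(q-1)}, hence a multiple of f^{q/(q-1)}. -/
lemma riesz_potential_normalized {q : ℝ} (hq : 2 < q) : ∃ C : ℝ≥0∞, C ≠ ∞ ∧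
    ∀ f : ℝ → ℝ≥0∞, Measurable f → ∫⁻ s, f s ^ (q / (q - 1)) ≤ 1 →
      ∫⁻ t, (∫⁻ s, ENNReal.ofReal |t - s| ^ (-(2 / q)) * f s) ^ q ≤ C := by
  have hq0 : 0 < q := by linarith
  have hl : 2 / q < 1 := by rw [div_lt_one hq0]; exact hq
  have hl' : 0 < 1 - 2 / q := by linarith
  set c₁ : ℝ := 2 * ((2 * 3 ^ q) ^ (1 - 2 / q) / (1 - 2 / q)) with hc₁
  have hc₁0 : 0 < c₁ := by positivity
  refine ⟨ENNReal.ofReal q * (ENNReal.ofReal (3 * c₁) * ENNReal.ofReal (3 * c₁) ^ (q - 1)⁻¹),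
    ENNReal.mul_ne_top ENNReal.ofReal_ne_top (ENNReal.mul_ne_top ENNReal.ofReal_ne_top
      (ENNReal.rpow_ne_top_of_nonneg (by rw [inv_nonneg]; linarith) ENNReal.ofReal_ne_top)), ?_⟩
  intro f hf hf1
  have hI : Measurable fun t => ∫⁻ s, ENNReal.ofReal |t - s| ^ (-(2 / q)) * f s :=
    Measurable.lintegral_prod_right' (f := fun p : ℝ × ℝ =>
      ENNReal.ofReal |p.1 - p.2| ^ (-(2 / q)) * f p.2) (by fun_prop)
  rw [lintegral_rpow_layercake volume hI hq0]
  gcongr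
  have hlevel : ∀ x ∈ Ioi (0 : ℝ), ENNReal.ofReal (x ^ (q - 1)) *
      volume {t | ENNReal.ofReal x < ∫⁻ s, ENNReal.ofReal |t - s| ^ (-(2 / q)) * f s} ≤
      ENNReal.ofReal (3 * c₁) *
        ∫⁻ s, {s | ENNReal.ofReal (x ^ (q - 1) / (3 * c₁)) < f s}.indicator f s := by
    intro x hx
    have hx : 0 < x := hx
    set R : ℝ := 2 * ((x / 3)⁻¹) ^ q with hR
    have hR0 : 0 < R := by positivity
    have hnear : 2 * (R ^ (1 - 2 / q) / (1 - 2 / q)) = c₁ * x ^ (2 - q) := by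
      have : R = (2 * 3 ^ q) * x ^ (-q) := by
        rw [hR, inv_div, Real.div_rpow (by norm_num) hx.le, Real.rpow_neg hx.le]; ring
      rw [this, Real.mul_rpow (by positivity) (by positivity), ← Real.rpow_mul hx.le,
        show -q * (1 - 2 / q) = 2 - q by field_simp; ring, hc₁]
      ring
    have hγm : x ^ (q - 1) / (3 * c₁) * (2 * (R ^ (1 - 2 / q) / (1 - 2 / q))) = x / 3 := by
      rw [hnear, show x ^ (q - 1) / (3 * c₁) * (c₁ * x ^ (2 - q))
        = (x ^ (q - 1) * x ^ (2 - q)) / 3 by field_simp, ← Real.rpow_add hx]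
      norm_num
    set S : Set ℝ := {s | ENNReal.ofReal (x ^ (q - 1) / (3 * c₁)) < f s} with hS
    have hSm : MeasurableSet S := measurableSet_lt measurable_const hf
    set g : ℝ → ℝ≥0∞ := fun t => ∫⁻ s,
      (Iio R).indicator (fun r => ENNReal.ofReal r ^ (-(2 / q))) |t - s| * S.indicator f s with hg
    have hkm : Measurable fun p : ℝ × ℝ =>
        (Iio R).indicator (fun r => ENNReal.ofReal r ^ (-(2 / q))) |p.1 - p.2| * S.indicator f p.2 :=
      ((Measurable.indicator (f := fun r : ℝ => ENNReal.ofReal r ^ (-(2 / q))) (by fun_prop)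
        measurableSet_Iio).comp (by fun_prop : Measurable fun p : ℝ × ℝ => |p.1 - p.2|)).mul
        ((hf.indicator hSm).comp measurable_snd)
    have hsub : {t | ENNReal.ofReal x < ∫⁻ s, ENNReal.ofReal |t - s| ^ (-(2 / q)) * f s} ⊆
        {t | ENNReal.ofReal (x / 3) ≤ g t} := by
      intro t ht
      by_contra hcon
      have hcon : g t < ENNReal.ofReal (x / 3) := not_le.1 hcon
      have ht : ENNReal.ofReal x < ∫⁻ s, ENNReal.ofReal |t - s| ^ (-(2 / q)) * f s := ht
      refine absurd ht (not_lt.2 ?_)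
      refine (riesz_potential_le_split hq hf hf1 (by positivity : 0 < x / 3) hR
        (by positivity) hγm t).trans ?_
      calc _ ≤ 2 * ENNReal.ofReal (x / 3) + ENNReal.ofReal (x / 3) := by gcongr
        _ = ENNReal.ofReal x := by
          rw [← ENNReal.ofReal_ofNat 2, ← ENNReal.ofReal_mul (by norm_num),
            ← ENNReal.ofReal_add (by positivity) (by positivity)]
          congr 1; ring
    have hgint : ∫⁻ t, g t = ENNReal.ofReal (c₁ * x ^ (2 - q)) * ∫⁻ s, S.indicator f s := by
      rw [hg, lintegral_lintegral_swap hkm.aemeasurable, ← lintegral_const_mul _ (hf.indicator hSm)]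
      refine lintegral_congr fun s => ?_
      have hk1 : Measurable fun t : ℝ =>
          (Iio R).indicator (fun r => ENNReal.ofReal r ^ (-(2 / q))) |t - s| :=
        (Measurable.indicator (f := fun r : ℝ => ENNReal.ofReal r ^ (-(2 / q))) (by fun_prop)
          measurableSet_Iio).comp (by fun_prop)
      rw [lintegral_mul_const _ hk1]
      simp_rw [abs_sub_comm _ s]
      rw [enorm_kernel_near hl hR0.le, ← hnear, ENNReal.ofReal_mul (by norm_num),
        ENNReal.ofReal_ofNat]
    calc _ ≤ ENNReal.ofReal (x ^ (q - 1)) * ((∫⁻ t, g t) / ENNReal.ofReal (x / 3)) := by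
          gcongr
          refine (measure_mono hsub).trans (meas_ge_le_lintegral_div
            hkm.lintegral_prod_right'.aemeasurable (by simpa using hx) ENNReal.ofReal_ne_top)
      _ = ENNReal.ofReal (3 * c₁) * ∫⁻ s, S.indicator f s := by
          rw [hgint, div_eq_mul_inv, ← ENNReal.ofReal_inv_of_pos (by positivity), ← mul_assoc,
            ← mul_assoc, ← ENNReal.ofReal_mul (by positivity), mul_right_comm,
            ← ENNReal.ofReal_mul (by positivity)]
          congr 2
          rw [show x ^ (q - 1) * (c₁ * x ^ (2 - q)) * (x / 3)⁻¹
            = 3 * c₁ * ((x ^ (q - 1) * x ^ (2 - q)) / x) by field_simp, ← Real.rpow_add hx]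
          norm_num
          field_simp
  refine (setLIntegral_mono' measurableSet_Ioi hlevel).trans ?_
  have hm2 : Measurable fun p : ℝ × ℝ =>
      {s | ENNReal.ofReal (p.1 ^ (q - 1) / (3 * c₁)) < f s}.indicator f p.2 := by
    have hs : MeasurableSet {p : ℝ × ℝ | ENNReal.ofReal (p.1 ^ (q - 1) / (3 * c₁)) < f p.2} :=
      measurableSet_lt (by fun_prop) (by fun_prop)
    exact Measurable.indicator (f := fun p : ℝ × ℝ => f p.2) (by fun_prop) hs
  rw [lintegral_const_mul _ hm2.lintegral_prod_right']
  gcongr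
  rw [lintegral_lintegral_swap hm2.aemeasurable]
  have hq1 : 0 < q - 1 := by linarith
  calc _ = ∫⁻ s, ENNReal.ofReal (3 * c₁) ^ (q - 1)⁻¹ * f s ^ (q / (q - 1)) := by
        refine lintegral_congr fun s => ?_
        have hset : ∀ x ∈ Ioi (0 : ℝ),
            {s | ENNReal.ofReal (x ^ (q - 1) / (3 * c₁)) < f s}.indicator f s =
            {x : ℝ | ENNReal.ofReal x < (ENNReal.ofReal (3 * c₁) * f s) ^ (q - 1)⁻¹}.indicator
              (fun _ => f s) x := by
          intro x hx
          have hx : 0 < x := hx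
          have : ENNReal.ofReal (x ^ (q - 1) / (3 * c₁)) < f s ↔
              ENNReal.ofReal x < (ENNReal.ofReal (3 * c₁) * f s) ^ (q - 1)⁻¹ := by
            rw [ENNReal.ofReal_div_of_pos (by positivity), ENNReal.div_lt_iff
              (Or.inl (by simpa using hc₁0)) (Or.inl ENNReal.ofReal_ne_top),
              ← ENNReal.ofReal_rpow_of_pos hx, ENNReal.lt_rpow_inv_iff hq1, mul_comm (f s)]
          simp only [indicator, mem_ofPred_eq, this]
        rw [setLIntegral_congr_fun measurableSet_Ioi hset]
        have hm3 : MeasurableSet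
            {x : ℝ | ENNReal.ofReal x < (ENNReal.ofReal (3 * c₁) * f s) ^ (q - 1)⁻¹} :=
          measurableSet_lt ENNReal.measurable_ofReal measurable_const
        rw [lintegral_indicator hm3, Measure.restrict_restrict hm3, setLIntegral_const]
        have h5 := lintegral_Ioo_rpow_toReal (p := 0) (by norm_num)
          ((ENNReal.ofReal (3 * c₁) * f s) ^ (q - 1)⁻¹)
        simp only [Real.rpow_zero, ENNReal.ofReal_one, lintegral_one, Measure.restrict_apply_univ,
          zero_add, ENNReal.rpow_one, div_one] at h5
        have h6 : {x : ℝ | ENNReal.ofReal x < (ENNReal.ofReal (3 * c₁) * f s) ^ (q - 1)⁻¹} ∩ Ioi 0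
          = {x : ℝ | 0 < x ∧ ENNReal.ofReal x < (ENNReal.ofReal (3 * c₁) * f s) ^ (q - 1)⁻¹} := by
          ext x; simp [and_comm]
        rw [h6, h5, ENNReal.mul_rpow_of_nonneg _ _ (by positivity), mul_left_comm]
        congr 1
        rw [show q / (q - 1) = 1 + (q - 1)⁻¹ by field_simp; ring,
          ENNReal.rpow_add_of_nonneg _ _ (by norm_num) (by positivity), ENNReal.rpow_one]
    _ ≤ _ := by
        rw [lintegral_const_mul _ (by fun_prop)]
        exact mul_le_of_le_one_right' hf1

/-- The Hardy–Littlewood–Sobolev inequality on the line, for dual exponents. -/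
theorem hardy_littlewood_sobolev {q : ℝ} (hq : 2 < q) : ∃ C : ℝ≥0∞, C ≠ ∞ ∧
    ∀ f : ℝ → ℝ≥0∞, Measurable f →
      ∫⁻ t, (∫⁻ s, ENNReal.ofReal |t - s| ^ (-(2 / q)) * f s) ^ q
        ≤ C * (∫⁻ s, f s ^ (q / (q - 1))) ^ (q - 1) := by
  obtain ⟨C, hC, h⟩ := riesz_potential_normalized hq
  have hq0 : 0 < q := by linarith
  have hq1 : 0 < q - 1 := by linarith
  -- The summand 1 keeps the constant nonzero, so that the right side is `∞` when `A = ∞`.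
  refine ⟨C + 1, by simp [hC], fun f hf => ?_⟩
  set A := ∫⁻ s, f s ^ (q / (q - 1)) with hA
  rcases eq_or_ne A 0 with h0 | h0
  · have hz : f =ᵐ[volume] 0 := by
      rw [hA, lintegral_eq_zero_iff (by fun_prop)] at h0
      filter_upwards [h0] with s hs
      simpa [ENNReal.rpow_eq_zero_iff, div_pos hq0 hq1, (div_pos hq0 hq1).not_gt] using hs
    have : ∀ t, ∫⁻ s, ENNReal.ofReal |t - s| ^ (-(2 / q)) * f s = 0 := by
      intro t
      rw [lintegral_congr_ae (g := fun _ => 0) (by filter_upwards [hz] with s hs; simp [hs])]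
      simp
    simp [this, hq0]
  rcases eq_or_ne A ∞ with h1 | h1
  · rw [h1, ENNReal.top_rpow_of_pos hq1, ENNReal.mul_top (by simp)]; exact le_top
  -- The factor for which `k * f` is normalized: the integral of its power q/(q-1) is 1.
  set k : ℝ≥0∞ := A ^ (-((q - 1) / q)) with hk
  have hA0 : A ^ ((q - 1) / q) ≠ 0 := by
    simp [ENNReal.rpow_eq_zero_iff, h0, h1]
  have hkA : A ^ ((q - 1) / q) * k = 1 := by
    rw [hk, ← ENNReal.rpow_add _ _ h0 h1]; simp
  have key := h (fun s => k * f s) (hf.const_mul k) (by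
    simp_rw [ENNReal.mul_rpow_of_nonneg _ _ (div_pos hq0 hq1).le]
    rw [lintegral_const_mul _ (by fun_prop), ← hA, hk, ← ENNReal.rpow_mul,
      show -((q - 1) / q) * (q / (q - 1)) = -1 by field_simp, ENNReal.rpow_neg_one,
      ENNReal.inv_mul_cancel h0 h1])
  have hrep : ∀ t, ∫⁻ s, ENNReal.ofReal |t - s| ^ (-(2 / q)) * f s =
      A ^ ((q - 1) / q) * ∫⁻ s, ENNReal.ofReal |t - s| ^ (-(2 / q)) * (k * f s) := by
    intro t
    rw [← lintegral_const_mul _ (by fun_prop)]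
    refine lintegral_congr fun s => ?_
    calc _ = (A ^ ((q - 1) / q) * k) * (ENNReal.ofReal |t - s| ^ (-(2 / q)) * f s) := by
          rw [hkA, one_mul]
      _ = _ := by ring
  have hI : Measurable fun t => ∫⁻ s, ENNReal.ofReal |t - s| ^ (-(2 / q)) * (k * f s) :=
    Measurable.lintegral_prod_right' (f := fun p : ℝ × ℝ =>
      ENNReal.ofReal |p.1 - p.2| ^ (-(2 / q)) * (k * f p.2)) (by fun_prop)
  simp_rw [hrep, ENNReal.mul_rpow_of_nonneg _ _ hq0.le]
  rw [lintegral_const_mul _ (by fun_prop), ← ENNReal.rpow_mul, div_mul_cancel₀ _ hq0.ne', mul_comm]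
  gcongr
  exact key.trans le_self_add

/-! ### Marcinkiewicz interpolation -/

variable {d : ℕ}

open Filter Topology FourierTransform

lemma L2.lintegral_enorm_sq (f : L2 d) : ∫⁻ x, ‖f x‖ₑ ^ (2 : ℝ) = ENNReal.ofReal (‖f‖ ^ 2) := by
  rw [Lp.norm_def, ← ENNReal.toReal_pow, ENNReal.ofReal_toReal (by
    simpa using (Lp.eLpNorm_ne_top f)),
    eLpNorm_eq_lintegral_rpow_enorm_toReal (by norm_num) (by norm_num), ← ENNReal.rpow_natCast,
    ← ENNReal.rpow_mul]
  norm_num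

/-- Cut f at height γ = (2AB/m)^{r-1}. Where |f| ≥ γ one has |f| ≤ (m/(2AB))|f|^{r/(r-1)}, so the
large part has L¹ norm at most m/(2B) and its image stays below m/2 almost everywhere. Only the
small part can push |Tf| above m, and its image is handled by Chebyshev at height m/2 and the L²
bound, whence the factor 4m^{-2}. -/
lemma measure_lt_enorm_le_of_bounds {r : ℝ} (hr : 2 < r) (T : L2 d →L[ℂ] L2 d) {B : ℝ}
    (hB : 0 < B) (hT : ∀ f, ‖T f‖ ≤ ‖f‖)
    (hTB : ∀ f : L2 d, ∀ᵐ x, ‖T f x‖ₑ ≤ ENNReal.ofReal B * ∫⁻ y, ‖f y‖ₑ) (f : L2 d)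
    {A : ℝ} (hA : 0 < A) (hfA : ∫⁻ x, ‖f x‖ₑ ^ (r / (r - 1)) ≤ ENNReal.ofReal A)
    {m : ℝ} (hm : 0 < m) :
    volume {x | ENNReal.ofReal m < ‖T f x‖ₑ} ≤ ENNReal.ofReal (4 * m ^ (-2 : ℝ)) *
      ∫⁻ x, {x | ‖f x‖ < (2 * A * B / m) ^ (r - 1)}.indicator (fun x => ‖f x‖ₑ ^ (2 : ℝ)) x := by
  have hr1 : 0 < r - 1 := by linarith
  set γ : ℝ := (2 * A * B / m) ^ (r - 1) with hγ
  have hγ0 : 0 < γ := by positivity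
  have hfm : Measurable (fun x => f x) := (Lp.stronglyMeasurable f).measurable
  have hS : MeasurableSet {x | γ ≤ ‖f x‖} := measurableSet_le measurable_const hfm.norm
  set S : Set (Space d) := {x | γ ≤ ‖f x‖} with hSdef
  have hgt : MemLp (S.indicator (fun x => f x)) 2 := (Lp.memLp f).indicator hS
  set g : L2 d := hgt.toLp _ with hg
  have hg' : g =ᵐ[volume] S.indicator (fun x => f x) := hgt.coeFn_toLp
  have hbig : ∀ᵐ x, ‖T g x‖ₑ ≤ ENNReal.ofReal (m / 2) := by
    filter_upwards [hTB g] with x hx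
    refine hx.trans ?_
    have h1 : ∫⁻ y, ‖g y‖ₑ ≤ ∫⁻ y, ENNReal.ofReal (m / (2 * A * B)) * ‖f y‖ₑ ^ (r / (r - 1)) := by
      refine lintegral_mono_ae ?_
      filter_upwards [hg'] with y hy
      rw [hy]
      by_cases hyS : y ∈ S
      · have hyγ : γ ≤ ‖f y‖ := hyS
        have hy0 : 0 < ‖f y‖ := hγ0.trans_le hyγ
        rw [indicator_of_mem hyS, ← ofReal_norm, ENNReal.ofReal_rpow_of_pos hy0,
          ← ENNReal.ofReal_mul (by positivity)]
        refine ENNReal.ofReal_le_ofReal ?_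
        have h2 : ‖f y‖ ^ (-(r - 1)⁻¹) ≤ m / (2 * A * B) := by
          calc ‖f y‖ ^ (-(r - 1)⁻¹) ≤ γ ^ (-(r - 1)⁻¹) :=
                Real.rpow_le_rpow_of_nonpos hγ0 hyγ (by simp [hr1.le])
            _ = m / (2 * A * B) := by
                rw [hγ, ← Real.rpow_mul (by positivity), mul_neg, mul_inv_cancel₀ hr1.ne',
                  Real.rpow_neg_one, inv_div]
        calc ‖f y‖ = ‖f y‖ ^ (-(r - 1)⁻¹) * ‖f y‖ ^ (r / (r - 1)) := by
              rw [← Real.rpow_add hy0, show -(r - 1)⁻¹ + r / (r - 1) = 1 by field_simp; ring,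
                Real.rpow_one]
          _ ≤ _ := by gcongr
      · simp [indicator_of_notMem hyS]
    rw [lintegral_const_mul _ (by fun_prop)] at h1
    calc _ ≤ ENNReal.ofReal B * (ENNReal.ofReal (m / (2 * A * B)) * ENNReal.ofReal A) := by
          gcongr; exact h1.trans (by gcongr)
      _ = ENNReal.ofReal (m / 2) := by
          rw [← ENNReal.ofReal_mul (by positivity), ← ENNReal.ofReal_mul (by positivity)]
          congr 1; field_simp
  have hsub : {x | ENNReal.ofReal m < ‖T f x‖ₑ} ≤ᵐ[volume]
      {x | ENNReal.ofReal (m / 2) ≤ ‖T (f - g) x‖ₑ} := by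
    have hsum : T f = T g + T (f - g) := by rw [← map_add]; simp
    filter_upwards [hbig, Lp.coeFn_add (T g) (T (f - g))] with x hx hx2 hx3
    have hx3 : ENNReal.ofReal m < ‖T f x‖ₑ := hx3
    show ENNReal.ofReal (m / 2) ≤ ‖T (f - g) x‖ₑ
    by_contra hcon
    rw [hsum, hx2] at hx3
    refine absurd hx3 (not_lt.2 ?_)
    calc _ ≤ ‖T g x‖ₑ + ‖T (f - g) x‖ₑ := enorm_add_le _ _
      _ ≤ ENNReal.ofReal (m / 2) + ENNReal.ofReal (m / 2) := add_le_add hx (not_le.1 hcon).le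
      _ = ENNReal.ofReal m := by
        rw [← ENNReal.ofReal_add (by positivity) (by positivity), add_halves]
  have hTm : Measurable (fun x => T (f - g) x) := (Lp.stronglyMeasurable _).measurable
  calc _ ≤ volume {x | ENNReal.ofReal (m / 2) ^ (2 : ℝ) ≤ ‖T (f - g) x‖ₑ ^ (2 : ℝ)} := by
        refine (measure_mono_ae hsub).trans (measure_mono fun x hx => ?_)
        exact ENNReal.rpow_le_rpow hx (by norm_num)
    _ ≤ (∫⁻ x, ‖T (f - g) x‖ₑ ^ (2 : ℝ)) / ENNReal.ofReal (m / 2) ^ (2 : ℝ) :=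
        meas_ge_le_lintegral_div (by fun_prop) (by simp [hm])
          (ENNReal.rpow_ne_top_of_nonneg (by norm_num) ENNReal.ofReal_ne_top)
    _ ≤ (∫⁻ x, ‖(f - g) x‖ₑ ^ (2 : ℝ)) / ENNReal.ofReal (m / 2) ^ (2 : ℝ) := by
        rw [L2.lintegral_enorm_sq, L2.lintegral_enorm_sq]
        gcongr
        exact hT _
    _ = _ := by
        rw [div_eq_mul_inv, mul_comm, ENNReal.ofReal_rpow_of_pos (by positivity),
          ← ENNReal.ofReal_inv_of_pos (by positivity)]
        congr 1
        · congr 1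
          rw [Real.rpow_neg hm.le, Real.div_rpow hm.le (by norm_num)]; norm_num; field_simp
        · refine lintegral_congr_ae ?_
          filter_upwards [Lp.coeFn_sub f g, hg'] with x hx hx2
          rw [hx, Pi.sub_apply, hx2]
          by_cases hxS : γ ≤ ‖f x‖
          · simp [indicator, hSdef, hxS, not_lt.2 hxS]
          · simp [indicator, hSdef, hxS, not_le.1 hxS]

/-- Marcinkiewicz interpolation between `L² → L²` and `L¹ → L^∞`, at dual exponents. -/
theorem marcinkiewicz {r : ℝ} (hr : 2 < r) : ∃ C : ℝ≥0∞, C ≠ ∞ ∧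
    ∀ (T : L2 d →L[ℂ] L2 d) (B : ℝ), 0 < B → (∀ f, ‖T f‖ ≤ ‖f‖) →
      (∀ f : L2 d, ∀ᵐ x, ‖T f x‖ₑ ≤ ENNReal.ofReal B * ∫⁻ y, ‖f y‖ₑ) → ∀ f : L2 d,
      ∫⁻ x, ‖T f x‖ₑ ^ r ≤
        C * ENNReal.ofReal B ^ (r - 2) * (∫⁻ x, ‖f x‖ₑ ^ (r / (r - 1))) ^ (r - 1) := by
  have hr0 : 0 < r := by linarith
  have hr1 : 0 < r - 1 := by linarith
  have hr2 : 0 < r - 2 := by linarith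
  refine ⟨ENNReal.ofReal r * (4 * ENNReal.ofReal (2 ^ (r - 2) / (r - 2))) + 1, by finiteness, ?_⟩
  intro T B hB hT hTB f
  have hfm : Measurable (fun x => f x) := (Lp.stronglyMeasurable f).measurable
  have hTm : Measurable (fun x => T f x) := (Lp.stronglyMeasurable _).measurable
  set A' := ∫⁻ x, ‖f x‖ₑ ^ (r / (r - 1)) with hA'
  rcases eq_or_ne A' 0 with h0 | h0
  · have hz : f = 0 := by
      rw [hA', lintegral_eq_zero_iff (by fun_prop)] at h0
      refine Lp.eq_zero_iff_ae_eq_zero.2 ?_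
      filter_upwards [h0] with x hx
      simpa [ENNReal.rpow_eq_zero_iff, div_pos hr0 hr1, (div_pos hr0 hr1).not_gt] using hx
    have : ∫⁻ x, ‖T f x‖ₑ ^ r = 0 := by
      rw [lintegral_congr_ae (g := fun _ => 0)]
      · simp
      · rw [hz, map_zero]
        filter_upwards [Lp.coeFn_zero ℂ 2 (volume : Measure (Space d))] with x hx
        simp [hr0]
    rw [this]; exact zero_le
  rcases eq_or_ne A' ∞ with h1 | h1
  · have : ENNReal.ofReal B ^ (r - 2) ≠ 0 := by
      simp [ENNReal.rpow_eq_zero_iff, hB]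
    rw [h1, ENNReal.top_rpow_of_pos hr1, ENNReal.mul_top (by simp [this])]; exact le_top
  set A := A'.toReal with hAdef
  have hA : 0 < A := ENNReal.toReal_pos h0 h1
  have hA'A : A' = ENNReal.ofReal A := (ENNReal.ofReal_toReal h1).symm
  set K : ℝ := 2 * A * B with hK
  have hK0 : 0 < K := by positivity
  rw [lintegral_rpow_layercake volume (by fun_prop : Measurable fun x => ‖T f x‖ₑ) hr0]
  have hlevel : ∀ m ∈ Ioi (0 : ℝ), ENNReal.ofReal (m ^ (r - 1)) *
      volume {x | ENNReal.ofReal m < ‖T f x‖ₑ} ≤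
      4 * ∫⁻ x, ENNReal.ofReal (m ^ (r - 3)) *
        {x | ‖f x‖ < (K / m) ^ (r - 1)}.indicator (fun x => ‖f x‖ₑ ^ (2 : ℝ)) x := by
    intro m hm
    have hm : 0 < m := hm
    have hms : MeasurableSet {x | ‖f x‖ < (K / m) ^ (r - 1)} :=
      measurableSet_lt hfm.norm measurable_const
    rw [lintegral_const_mul _ ((by fun_prop : Measurable fun x => ‖f x‖ₑ ^ (2 : ℝ)).indicator hms)]
    refine (mul_le_mul' le_rfl
      (measure_lt_enorm_le_of_bounds hr T hB hT hTB f hA hA'A.le hm)).trans (le_of_eq ?_)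
    rw [← mul_assoc, ← mul_assoc, ← ENNReal.ofReal_mul (by positivity)]
    congr 1
    rw [← ENNReal.ofReal_ofNat 4, ← ENNReal.ofReal_mul (by norm_num)]
    congr 1
    rw [mul_left_comm, ← Real.rpow_add hm]; ring_nf
  have hm2 : Measurable fun p : ℝ × Space d => ENNReal.ofReal (p.1 ^ (r - 3)) *
      {x | ‖f x‖ < (K / p.1) ^ (r - 1)}.indicator (fun x => ‖f x‖ₑ ^ (2 : ℝ)) p.2 := by
    have hs : MeasurableSet {p : ℝ × Space d | ‖f p.2‖ < (K / p.1) ^ (r - 1)} :=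
      measurableSet_lt (by fun_prop) (by fun_prop)
    exact (by fun_prop : Measurable fun p : ℝ × Space d => ENNReal.ofReal (p.1 ^ (r - 3))).mul
      (Measurable.indicator (f := fun p : ℝ × Space d => ‖f p.2‖ₑ ^ (2 : ℝ)) (by fun_prop) hs)
  have hpt : ∀ x, ∫⁻ m in Ioi (0 : ℝ), ENNReal.ofReal (m ^ (r - 3)) *
      {x | ‖f x‖ < (K / m) ^ (r - 1)}.indicator (fun x => ‖f x‖ₑ ^ (2 : ℝ)) x ≤
      ENNReal.ofReal (K ^ (r - 2) / (r - 2)) * ‖f x‖ₑ ^ (r / (r - 1)) := by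
    intro x
    rcases eq_or_ne (f x) 0 with hx | hx
    · simp [indicator, hx]
    have hx0 : 0 < ‖f x‖ := norm_pos_iff.2 hx
    -- The level `m` at which `x` leaves the small part. Integrating m^{r-3} up to `M` converges at
    -- 0 because r > 2, and turns |f|² into |f|^{r/(r-1)}.
    set M : ℝ := K * ‖f x‖ ^ (-(r - 1)⁻¹) with hM
    have hM0 : 0 < M := by positivity
    calc _ ≤ ∫⁻ m in Ioi (0 : ℝ), (Iio M).indicator
          (fun m => ENNReal.ofReal (m ^ (r - 3)) * ‖f x‖ₑ ^ (2 : ℝ)) m := by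
          refine setLIntegral_mono' measurableSet_Ioi fun m hm => ?_
          have hm : 0 < m := hm
          by_cases hc : ‖f x‖ < (K / m) ^ (r - 1)
          · have hmM : m < M := by
              have h2 : ‖f x‖ ^ (r - 1)⁻¹ < K / m := by
                have := Real.rpow_lt_rpow hx0.le hc (inv_pos.2 hr1)
                rwa [← Real.rpow_mul (by positivity), mul_inv_cancel₀ hr1.ne', Real.rpow_one] at this
              rw [lt_div_iff₀ hm] at h2
              rw [hM, Real.rpow_neg hx0.le, ← div_eq_mul_inv, lt_div_iff₀ (by positivity)]
              linarith
            simp [indicator, hc, hmM]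
          · simp [indicator, hc]
      _ = (∫⁻ m in Ioo 0 M, ENNReal.ofReal (m ^ (r - 3))) * ‖f x‖ₑ ^ (2 : ℝ) := by
          rw [lintegral_indicator measurableSet_Iio, Measure.restrict_restrict measurableSet_Iio,
            inter_comm, Ioi_inter_Iio, lintegral_mul_const _ (by fun_prop)]
      _ = _ := by
          rw [lintegral_Ioo_rpow (by linarith) hM0.le, ← ofReal_norm,
            ENNReal.ofReal_rpow_of_pos hx0, ENNReal.ofReal_rpow_of_pos hx0,
            ← ENNReal.ofReal_mul (by rw [show r - 3 + 1 = r - 2 by ring]; positivity),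
            ← ENNReal.ofReal_mul (by positivity)]
          congr 1
          rw [show r - 3 + 1 = r - 2 by ring, hM, Real.mul_rpow hK0.le (by positivity),
            ← Real.rpow_mul hx0.le,
            show r / (r - 1) = -(r - 1)⁻¹ * (r - 2) + 2 by field_simp; ring, Real.rpow_add hx0]
          ring
  calc _ ≤ ENNReal.ofReal r * ∫⁻ m in Ioi (0 : ℝ), 4 * ∫⁻ x, ENNReal.ofReal (m ^ (r - 3)) *
        {x | ‖f x‖ < (K / m) ^ (r - 1)}.indicator (fun x => ‖f x‖ₑ ^ (2 : ℝ)) x := by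
        gcongr ENNReal.ofReal r * ?_
        exact setLIntegral_mono' measurableSet_Ioi hlevel
    _ = ENNReal.ofReal r * (4 * ∫⁻ x, ∫⁻ m in Ioi (0 : ℝ), ENNReal.ofReal (m ^ (r - 3)) *
        {x | ‖f x‖ < (K / m) ^ (r - 1)}.indicator (fun x => ‖f x‖ₑ ^ (2 : ℝ)) x) := by
        rw [lintegral_const_mul _ hm2.lintegral_prod_right', lintegral_lintegral_swap hm2.aemeasurable]
    _ ≤ ENNReal.ofReal r * (4 * ∫⁻ x, ENNReal.ofReal (K ^ (r - 2) / (r - 2)) *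
          ‖f x‖ₑ ^ (r / (r - 1))) := by
        gcongr with x
        exact hpt x
    _ = (ENNReal.ofReal r * (4 * ENNReal.ofReal (2 ^ (r - 2) / (r - 2)))) *
          ENNReal.ofReal B ^ (r - 2) * A' ^ (r - 1) := by
        rw [lintegral_const_mul _ (by fun_prop), ← hA', hK, Real.mul_rpow (by positivity) hB.le,
          Real.mul_rpow (by positivity) hA.le, hA'A, ENNReal.ofReal_rpow_of_pos hB,
          ENNReal.ofReal_rpow_of_pos hA, show (2 : ℝ) ^ (r - 2) * A ^ (r - 2) * B ^ (r - 2) / (r - 2)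
            = 2 ^ (r - 2) / (r - 2) * B ^ (r - 2) * A ^ (r - 2) by ring,
          ENNReal.ofReal_mul (by positivity), ENNReal.ofReal_mul (by positivity),
          show r - 1 = (r - 2) + 1 by ring, Real.rpow_add hA, Real.rpow_one,
          ENNReal.ofReal_mul (by positivity)]
        ring_nf
    _ ≤ _ := by gcongr; exact le_self_add

/-! ### The free Schrödinger group -/

/-- The Fourier symbol `exp(-4π² i t |ξ|²)` of the free Schrödinger group. -/
def phase (t : ℝ) (ξ : Space d) : ℂ := Complex.exp ((-(4 * Real.pi ^ 2 * t * ‖ξ‖ ^ 2) : ℝ) * Complex.I)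

lemma norm_phase (t : ℝ) (ξ : Space d) : ‖phase t ξ‖ = 1 := Complex.norm_exp_ofReal_mul_I _

lemma enorm_phase (t : ℝ) (ξ : Space d) : ‖phase t ξ‖ₑ = 1 := by
  rw [← ofReal_norm, norm_phase, ENNReal.ofReal_one]

lemma phase_add (s t : ℝ) (ξ : Space d) : phase (s + t) ξ = phase s ξ * phase t ξ := by
  rw [phase, phase, phase, ← Complex.exp_add]; push_cast; ring_nf

@[simp] lemma phase_zero (ξ : Space d) : phase 0 ξ = 1 := by simp [phase]

lemma conj_phase (t : ℝ) (ξ : Space d) : (starRingEnd ℂ) (phase t ξ) = phase (-t) ξ := by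
  rw [phase, phase, ← Complex.exp_conj, map_mul, Complex.conj_ofReal, Complex.conj_I]
  congr 1; push_cast; ring

lemma continuous_phase : Continuous fun p : ℝ × Space d => phase p.1 p.2 := by
  unfold phase; fun_prop

lemma continuous_phase_right (t : ℝ) : Continuous (phase t : Space d → ℂ) :=
  continuous_phase.comp (by fun_prop : Continuous fun ξ : Space d => (t, ξ))

lemma memLp_phase_mul (t : ℝ) (f : L2 d) : MemLp (fun ξ => phase t ξ * f ξ) 2 := by
  refine (Lp.memLp f).congr_norm
    ((continuous_phase_right t).aestronglyMeasurable.mul (Lp.aestronglyMeasurable f)) ?_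
  exact Eventually.of_forall fun x => by simp [norm_phase]

/-- Multiplication by the symbol of the free Schrödinger group. -/
def phaseMul (t : ℝ) : L2 d →L[ℂ] L2 d :=
  LinearMap.mkContinuous
    { toFun := fun f => (memLp_phase_mul t f).toLp
      map_add' := fun f g => by
        refine Lp.ext ?_
        filter_upwards [(memLp_phase_mul t (f + g)).coeFn_toLp, (memLp_phase_mul t f).coeFn_toLp,
          (memLp_phase_mul t g).coeFn_toLp, Lp.coeFn_add f g,
          Lp.coeFn_add (memLp_phase_mul t f).toLp (memLp_phase_mul t g).toLp] with x h1 h2 h3 h4 h5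
        rw [h1, h5, Pi.add_apply, h2, h3, h4, Pi.add_apply, mul_add]
      map_smul' := fun c f => by
        refine Lp.ext ?_
        filter_upwards [(memLp_phase_mul t (c • f)).coeFn_toLp, (memLp_phase_mul t f).coeFn_toLp,
          Lp.coeFn_smul c f, Lp.coeFn_smul c (memLp_phase_mul t f).toLp] with x h1 h2 h3 h4
        rw [RingHom.id_apply, h1, h4, Pi.smul_apply, h2, h3, Pi.smul_apply, smul_eq_mul, smul_eq_mul,
          mul_left_comm] } 1
    (fun f => by
      rw [one_mul]
      refine Lp.norm_le_norm_of_ae_le ?_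
      filter_upwards [(memLp_phase_mul t f).coeFn_toLp] with x h1
      simp only [LinearMap.coe_mk, AddHom.coe_mk]
      rw [h1, norm_mul, norm_phase, one_mul])

lemma phaseMul_coe (t : ℝ) (f : L2 d) : phaseMul t f =ᵐ[volume] fun ξ => phase t ξ * f ξ :=
  (memLp_phase_mul t f).coeFn_toLp

lemma phaseMul_add (s t : ℝ) (f : L2 d) : phaseMul (s + t) f = phaseMul s (phaseMul t f) := by
  refine Lp.ext ?_
  filter_upwards [phaseMul_coe (s + t) f, phaseMul_coe s (phaseMul t f), phaseMul_coe t f]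
    with x h1 h2 h3
  rw [h1, h2, h3, phase_add, mul_assoc]

lemma phaseMul_zero (f : L2 d) : phaseMul 0 f = f := by
  refine Lp.ext ?_
  filter_upwards [phaseMul_coe 0 f] with x h1
  rw [h1, phase_zero, one_mul]

lemma inner_phaseMul (t : ℝ) (f g : L2 d) :
    inner ℂ f (phaseMul t g) = inner ℂ (phaseMul (-t) f) g := by
  rw [L2.inner_def, L2.inner_def]
  refine integral_congr_ae ?_
  filter_upwards [phaseMul_coe t g, phaseMul_coe (-t) f] with x h1 h2
  rw [h1, h2, RCLike.inner_apply, RCLike.inner_apply, map_mul, conj_phase, neg_neg]; ring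

lemma continuous_phaseMul (f : L2 d) : Continuous fun t : ℝ => phaseMul t f := by
  rw [continuous_iff_continuousAt]
  intro t₀
  refine tendsto_iff_norm_sub_tendsto_zero.2 ?_
  have hfm : Measurable (fun x => f x) := (Lp.stronglyMeasurable f).measurable
  have h2 : Tendsto (fun t => ∫⁻ x, ‖(phase t x - phase t₀ x) * f x‖ₑ ^ (2 : ℝ)) (𝓝 t₀) (𝓝 0) := by
    have : (0 : ℝ≥0∞) = ∫⁻ x : Space d, 0 := by simp
    rw [this]
    refine tendsto_lintegral_filter_of_dominated_convergence
      (fun x => (2 * ‖f x‖ₑ) ^ (2 : ℝ)) (Eventually.of_forall fun t => ?_)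
      (Eventually.of_forall fun t => Eventually.of_forall fun x => ?_) ?_
      (Eventually.of_forall fun x => ?_)
    · have := (continuous_phase_right (d := d) t).measurable
      have := (continuous_phase_right (d := d) t₀).measurable
      fun_prop
    · simp only [enorm_mul]
      gcongr
      refine (enorm_sub_le).trans ?_
      rw [enorm_phase, enorm_phase]; norm_num
    · simp_rw [ENNReal.mul_rpow_of_nonneg _ _ (by norm_num : (0 : ℝ) ≤ 2)]
      rw [lintegral_const_mul _ (by fun_prop), L2.lintegral_enorm_sq]
      finiteness
    · have h : Continuous fun t => ‖(phase t x - phase t₀ x) * f x‖ₑ ^ (2 : ℝ) := by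
        have : Continuous fun t => phase t x :=
          continuous_phase.comp (by fun_prop : Continuous fun t : ℝ => (t, x))
        exact (ENNReal.continuous_rpow_const).comp (by fun_prop)
      simpa using h.tendsto t₀
  have h3 : ∀ t, ∫⁻ x, ‖(phase t x - phase t₀ x) * f x‖ₑ ^ (2 : ℝ)
      = ENNReal.ofReal (‖phaseMul t f - phaseMul t₀ f‖ ^ 2) := by
    intro t
    rw [← L2.lintegral_enorm_sq]
    refine lintegral_congr_ae ?_
    filter_upwards [phaseMul_coe t f, phaseMul_coe t₀ f,
      Lp.coeFn_sub (phaseMul t f) (phaseMul t₀ f)] with x h4 h5 h6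
    rw [h6, Pi.sub_apply, h4, h5, sub_mul]
  simp_rw [h3] at h2
  have h4 := (ENNReal.tendsto_toReal ENNReal.zero_ne_top).comp h2
  have h5 := h4.sqrt
  simpa [Function.comp_def, ENNReal.toReal_ofReal, Real.sqrt_sq] using h5

/-- The free Schrödinger group `e^{itΔ}` on `L²`. -/
def S (t : ℝ) : L2 d →L[ℂ] L2 d :=
  ((Lp.fourierTransformₗᵢ (Space d) ℂ).symm.toContinuousLinearEquiv : L2 d →L[ℂ] L2 d) ∘L
    phaseMul t ∘L ((Lp.fourierTransformₗᵢ (Space d) ℂ).toContinuousLinearEquiv : L2 d →L[ℂ] L2 d)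

lemma S_apply (t : ℝ) (f : L2 d) : S t f = 𝓕⁻ (phaseMul t (𝓕 f)) := rfl

lemma fourier_S (t : ℝ) (f : L2 d) : 𝓕 (S t f) = phaseMul t (𝓕 f) := by
  rw [S_apply, fourier_fourierInv_eq]

lemma S_add (s t : ℝ) (f : L2 d) : S (s + t) f = S s (S t f) := by
  rw [S_apply, S_apply s, fourier_S, phaseMul_add]

@[simp] lemma S_zero (f : L2 d) : S 0 f = f := by
  rw [S_apply, phaseMul_zero, fourierInv_fourier_eq]

@[simp] lemma S_neg_S (t : ℝ) (f : L2 d) : S (-t) (S t f) = f := by rw [← S_add]; simp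

@[simp] lemma S_S_neg (t : ℝ) (f : L2 d) : S t (S (-t) f) = f := by rw [← S_add]; simp

lemma inner_S (t : ℝ) (f g : L2 d) : inner ℂ f (S t g) = inner ℂ (S (-t) f) g := by
  rw [← Lp.inner_fourier_eq, fourier_S, inner_phaseMul, ← fourier_S, Lp.inner_fourier_eq]

lemma inner_S_S (t : ℝ) (f g : L2 d) : inner ℂ (S t f) (S t g) = inner ℂ f g := by
  rw [inner_S, S_neg_S]

@[simp] lemma norm_S (t : ℝ) (f : L2 d) : ‖S t f‖ = ‖f‖ := by
  rw [@norm_eq_sqrt_re_inner ℂ, inner_S_S, ← @norm_eq_sqrt_re_inner ℂ]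

lemma continuous_S (f : L2 d) : Continuous fun t : ℝ => S t f :=
  (Lp.fourierTransformₗᵢ (Space d) ℂ).symm.continuous.comp (continuous_phaseMul _)

/-- Strong continuity becomes joint continuity because every S(t) is an isometry. -/
lemma continuous_S_uncurry : Continuous fun p : ℝ × L2 d => S p.1 p.2 := by
  rw [continuous_iff_continuousAt]
  rintro ⟨t₀, f₀⟩
  refine tendsto_iff_norm_sub_tendsto_zero.2 ?_
  have h1 : Tendsto (fun p : ℝ × L2 d => ‖p.2 - f₀‖ + ‖S p.1 f₀ - S t₀ f₀‖) (𝓝 (t₀, f₀)) (𝓝 0) := by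
    have hc : Continuous fun p : ℝ × L2 d => ‖p.2 - f₀‖ + ‖S p.1 f₀ - S t₀ f₀‖ := by
      have := (continuous_S f₀).comp (continuous_fst (X := ℝ) (Y := L2 d))
      have h' : Continuous fun p : ℝ × L2 d => S p.1 f₀ := this
      fun_prop
    simpa using hc.tendsto (t₀, f₀)
  refine squeeze_zero (fun _ => norm_nonneg _) (fun p => ?_) h1
  calc ‖S p.1 p.2 - S t₀ f₀‖ = ‖S p.1 (p.2 - f₀) + (S p.1 f₀ - S t₀ f₀)‖ := by
        rw [map_sub]; congr 1; abel
    _ ≤ _ := by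
        refine (norm_add_le _ _).trans ?_
        rw [norm_S]

lemma continuousOn_S {s : Set ℝ} {g : ℝ → ℝ} {u : ℝ → L2 d} (hg : ContinuousOn g s)
    (hu : ContinuousOn u s) : ContinuousOn (fun t => S (g t) (u t)) s :=
  Continuous.comp_continuousOn (g := fun p : ℝ × L2 d => S p.1 p.2) (f := fun t => (g t, u t))
    continuous_S_uncurry (hg.prodMk hu)

/-! ### The group on Schwartz functions -/

lemma hasTemperateGrowth_cexp_I : (fun x : ℝ => Complex.exp (x * Complex.I)).HasTemperateGrowth := by
  have hc : ContDiff ℝ (⊤ : ℕ∞) fun x : ℝ => Complex.exp (x * Complex.I) := by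
    have : ContDiff ℝ (⊤ : ℕ∞) fun x : ℝ => (x : ℂ) := Complex.ofRealCLM.contDiff
    fun_prop
  have hit : ∀ n : ℕ, iteratedDeriv n (fun x : ℝ => Complex.exp (x * Complex.I)) =
      fun x : ℝ => Complex.I ^ n * Complex.exp (x * Complex.I) := by
    intro n
    induction n with
    | zero => simp
    | succ n ih =>
      rw [iteratedDeriv_succ, ih]
      ext x
      have h1 : HasDerivAt (fun x : ℝ => Complex.exp (x * Complex.I))
          (Complex.exp (x * Complex.I) * (1 * Complex.I)) x :=
        ((Complex.ofRealCLM.hasDerivAt (x := x)).mul_const Complex.I).cexp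
      rw [(h1.const_mul (Complex.I ^ n)).deriv]; ring
  refine ⟨hc, fun n => ⟨0, 1, fun x => ?_⟩⟩
  rw [norm_iteratedFDeriv_eq_norm_iteratedDeriv, hit]
  simp [Complex.norm_exp_ofReal_mul_I]

lemma hasTemperateGrowth_phase (t : ℝ) : (phase t : Space d → ℂ).HasTemperateGrowth := by
  have h : (fun ξ : Space d => -(4 * Real.pi ^ 2 * t * ‖ξ‖ ^ 2)).HasTemperateGrowth := by fun_prop
  exact hasTemperateGrowth_cexp_I.comp h

/-- The free Schrödinger group on Schwartz functions. -/
def schwartzS (t : ℝ) (φ : 𝓢(Space d, ℂ)) : 𝓢(Space d, ℂ) :=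
  SchwartzMap.fourierMultiplierCLM ℂ (phase t) φ

lemma S_toLp (t : ℝ) (φ : 𝓢(Space d, ℂ)) : S t (φ.toLp 2) = (schwartzS t φ).toLp 2 := by
  rw [S_apply, SchwartzMap.toLp_fourier_eq, schwartzS, SchwartzMap.fourierMultiplierCLM_apply,
    ← SchwartzMap.toLp_fourierInv_eq]
  congr 1
  refine Lp.ext ?_
  filter_upwards [phaseMul_coe t ((𝓕 φ).toLp 2), (𝓕 φ).coeFn_toLp 2,
    (SchwartzMap.smulLeftCLM ℂ (phase t) (𝓕 φ)).coeFn_toLp 2] with x h1 h2 h3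
  rw [h1, h2, h3, SchwartzMap.smulLeftCLM_apply_apply (hasTemperateGrowth_phase t), smul_eq_mul]

lemma schwartzS_apply (t : ℝ) (φ : 𝓢(Space d, ℂ)) (x : Space d) :
    schwartzS t φ x = ∫ ξ, Complex.exp (2 * Real.pi * Complex.I * (inner ℝ x ξ : ℝ)) *
      (phase t ξ * 𝓕 φ ξ) := by
  rw [schwartzS, SchwartzMap.fourierMultiplierCLM_apply, SchwartzMap.fourierInv_coe,
    Real.fourierInv_eq']
  refine integral_congr_ae (Eventually.of_forall fun ξ => ?_)
  simp only
  rw [SchwartzMap.smulLeftCLM_apply_apply (hasTemperateGrowth_phase t), smul_eq_mul, smul_eq_mul,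
    real_inner_comm]
  congr 2; push_cast; ring

/-! ### The dispersive estimate -/

/-- The decay constant `(4π|t|)^{-d/2}` of the free Schrödinger group. -/
def decay (d : ℕ) (t : ℝ) : ℝ := (4 * Real.pi * |t|) ^ (-(d / 2 : ℝ))

lemma decay_pos {t : ℝ} (ht : t ≠ 0) : 0 < decay d t := by
  have := abs_pos.2 ht
  unfold decay; positivity

@[simp] lemma decay_neg (t : ℝ) : decay d (-t) = decay d t := by simp [decay]

/-- The symbol of the group is not integrable, so it is damped by exp(-ε|ξ|²). The Fourier transform
is then moved from φ onto a Gaussian of complex width b = ε + 4π²it, where it is explicit: the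
prefactor is at most (4π|t|)^{-d/2} since |b| ≥ |Im b| = 4π²|t|, and the exponential has modulus at
most 1 since Re(1/b) ≥ 0. The bound does not depend on ε. -/
lemma norm_gaussian_mul_fourier_le {t : ℝ} (ht : t ≠ 0) (φ : 𝓢(Space d, ℂ)) (x : Space d)
    {ε : ℝ} (hε : 0 < ε) :
    ‖∫ ξ, Complex.exp (-(ε + 4 * Real.pi ^ 2 * t * Complex.I) * ‖ξ‖ ^ 2 +
      2 * Real.pi * Complex.I * (inner ℝ x ξ : ℝ)) * 𝓕 φ ξ‖ ≤ decay d t * ∫ y, ‖φ y‖ := by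
  set b : ℂ := ε + 4 * Real.pi ^ 2 * t * Complex.I with hb
  have hb1 : b = ((ε : ℝ) : ℂ) + ((4 * Real.pi ^ 2 * t : ℝ) : ℂ) * Complex.I := by
    rw [hb]; push_cast; ring
  have hbre : b.re = ε := by rw [hb1, Complex.add_re, Complex.ofReal_re, Complex.re_ofReal_mul]; simp
  have hbim : b.im = 4 * Real.pi ^ 2 * t := by
    rw [hb1, Complex.add_im, Complex.ofReal_im, Complex.im_ofReal_mul]; simp
  have hb0 : 0 < b.re := by rw [hbre]; exact hε
  have hbne : b ≠ 0 := fun h => by rw [h] at hb0; simp at hb0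
  set g : Space d → ℂ := fun v => Complex.exp (-b * ‖v‖ ^ 2 + 2 * Real.pi * Complex.I * (inner ℝ x v : ℝ))
    with hg
  have hgint : Integrable g := GaussianFourier.integrable_cexp_neg_mul_sq_norm_add hb0 _ x
  have hswap : ∫ ξ, g ξ * 𝓕 φ ξ = ∫ y, 𝓕 g y * φ y := by
    have h := VectorFourier.integral_fourierIntegral_smul_eq_flip (μ := (volume : Measure (Space d)))
      (ν := (volume : Measure (Space d))) (L := innerₗ (Space d)) Real.continuous_fourierChar
      continuous_inner hgint (φ.integrable (μ := volume))
    rw [show (innerₗ (Space d)).flip = innerₗ (Space d) from flip_innerₗ (Space d)] at h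
    simp only [smul_eq_mul] at h
    exact h.symm
  rw [hswap]
  have hpt : ∀ y, ‖𝓕 g y * φ y‖ ≤ decay d t * ‖φ y‖ := by
    intro y
    rw [norm_mul]
    gcongr
    rw [hg, fourier_gaussian_innerProductSpace' hb0 x y, norm_mul, Complex.norm_exp]
    have h1 : ‖((Real.pi : ℂ) / b) ^ ((Module.finrank ℝ (Space d) : ℂ) / 2)‖ ≤ decay d t := by
      rw [finrank_euclideanSpace_fin, show ((d : ℂ) / 2) = ((d / 2 : ℝ) : ℂ) by push_cast; ring,
        Complex.norm_cpow_real, norm_div, Complex.norm_real, Real.norm_of_nonneg Real.pi_pos.le, decay]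
      have ht' := abs_pos.2 ht
      rw [← inv_inv (4 * Real.pi * |t|), Real.inv_rpow (by positivity), Real.rpow_neg (by positivity), inv_inv]
      gcongr
      rw [div_le_iff₀ (norm_pos_iff.2 hbne)]
      have h2 : 4 * Real.pi ^ 2 * |t| ≤ ‖b‖ := by
        refine le_trans (le_of_eq ?_) (Complex.abs_im_le_norm b)
        rw [hbim, abs_mul, abs_of_pos (by positivity : 0 < 4 * Real.pi ^ 2)]
      rw [inv_mul_eq_div, le_div_iff₀ (by positivity)]
      nlinarith
    have h2 : Real.exp (-(Real.pi : ℂ) ^ 2 * ‖x - y‖ ^ 2 / b).re ≤ 1 := by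
      rw [Real.exp_le_one_iff, show -(Real.pi : ℂ) ^ 2 * ‖x - y‖ ^ 2 / b =
        ((-(Real.pi ^ 2 * ‖x - y‖ ^ 2) : ℝ) : ℂ) * b⁻¹ by push_cast; ring, Complex.re_ofReal_mul,
        Complex.inv_re]
      have : 0 ≤ b.re / Complex.normSq b := div_nonneg hb0.le (Complex.normSq_nonneg _)
      have h3 : 0 ≤ Real.pi ^ 2 * ‖x - y‖ ^ 2 := by positivity
      nlinarith
    calc _ ≤ decay d t * 1 := by
          refine mul_le_mul h1 h2 (Real.exp_pos _).le (decay_pos ht).le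
      _ = _ := mul_one _
  calc _ ≤ ∫ y, ‖𝓕 g y * φ y‖ := norm_integral_le_integral_norm _
    _ ≤ ∫ y, decay d t * ‖φ y‖ :=
        integral_mono_of_nonneg (Eventually.of_forall fun _ => norm_nonneg _)
          ((φ.integrable (μ := volume)).norm.const_mul _) (Eventually.of_forall hpt)
    _ = _ := integral_const_mul _ _

/-- The dispersive estimate on Schwartz functions. -/
lemma norm_schwartzS_le {t : ℝ} (ht : t ≠ 0) (φ : 𝓢(Space d, ℂ)) (x : Space d) :
    ‖schwartzS t φ x‖ ≤ decay d t * ∫ y, ‖φ y‖ := by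
  -- The damping 1/(n+1) is removed by dominated convergence, with majorant |𝓕φ|.
  have hlim : Tendsto (fun n : ℕ => ∫ ξ, Complex.exp (-((1 / ((n : ℝ) + 1) : ℝ) +
      4 * Real.pi ^ 2 * t * Complex.I) * ‖ξ‖ ^ 2 +
      2 * Real.pi * Complex.I * (inner ℝ x ξ : ℝ)) * 𝓕 φ ξ) atTop (𝓝 (schwartzS t φ x)) := by
    rw [schwartzS_apply]
    refine tendsto_integral_of_dominated_convergence (fun ξ => ‖𝓕 φ ξ‖) (fun n => ?_)
      ((𝓕 φ).integrable (μ := volume)).norm (fun n => Eventually.of_forall fun ξ => ?_)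
      (Eventually.of_forall fun ξ => ?_)
    · refine Continuous.aestronglyMeasurable ?_
      have := (𝓕 φ).continuous
      fun_prop
    · rw [norm_mul, Complex.norm_exp]
      refine mul_le_of_le_one_left (norm_nonneg _) (Real.exp_le_one_iff.2 ?_)
      have : (-((1 / ((n : ℝ) + 1) : ℝ) + 4 * Real.pi ^ 2 * t * Complex.I) * ‖ξ‖ ^ 2 +
        2 * Real.pi * Complex.I * (inner ℝ x ξ : ℝ) : ℂ) = ((-(1 / ((n : ℝ) + 1) * ‖ξ‖ ^ 2) : ℝ) : ℂ) +
        ((-(4 * Real.pi ^ 2 * t * ‖ξ‖ ^ 2) + 2 * Real.pi * inner ℝ x ξ : ℝ) : ℂ) * Complex.I := by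
        push_cast; ring
      rw [this]
      simp only [Complex.add_re, Complex.ofReal_re, Complex.re_ofReal_mul, Complex.I_re, mul_zero,
        add_zero, Left.neg_nonpos_iff]
      positivity
    · have h1 : Tendsto (fun n : ℕ => (((1 / ((n : ℝ) + 1) : ℝ)) : ℂ)) atTop (𝓝 0) := by
        have := (Complex.continuous_ofReal.tendsto 0).comp
          (tendsto_one_div_add_atTop_nhds_zero_nat (𝕜 := ℝ))
        rwa [Complex.ofReal_zero] at this
      have h2 : Continuous fun z : ℂ => Complex.exp (-(z + 4 * Real.pi ^ 2 * t * Complex.I) * ‖ξ‖ ^ 2 +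
        2 * Real.pi * Complex.I * (inner ℝ x ξ : ℝ)) * 𝓕 φ ξ := by fun_prop
      have h3 := (h2.tendsto 0).comp h1
      have h4 : Complex.exp (-(0 + 4 * Real.pi ^ 2 * t * Complex.I) * ‖ξ‖ ^ 2 +
          2 * Real.pi * Complex.I * (inner ℝ x ξ : ℝ)) * 𝓕 φ ξ =
          Complex.exp (2 * Real.pi * Complex.I * (inner ℝ x ξ : ℝ)) * (phase t ξ * 𝓕 φ ξ) := by
        rw [← mul_assoc]
        unfold phase
        rw [← Complex.exp_add]
        congr 2; push_cast; ring
      rw [h4] at h3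
      exact h3
  refine le_of_tendsto hlim.norm (Eventually.of_forall fun n => ?_)
  exact norm_gaussian_mul_fourier_le ht φ x (by positivity)

/-! ### Bounds from L¹ to L^∞ by duality with Schwartz functions -/

/-- A square integrable function that is bounded by `A` as a functional on `L¹ ∩ 𝓢` is bounded by
`A` almost everywhere. -/
lemma ae_norm_le_of_schwartz (w : L2 d) {A : ℝ}
    (h : ∀ φ : 𝓢(Space d, ℂ), ‖inner ℂ (φ.toLp 2) w‖ ≤ A * ∫ y, ‖φ y‖) : ∀ᵐ x, ‖w x‖ ≤ A := by
  -- Almost everywhere `w` is the limit of its mollifications. Each of these is the inner product of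
  -- `w` with a bump of L¹ norm 1, so it is bounded by `A`. The radii keep the fixed ratio 2, as the
  -- differentiation theorem requires.
  set φ : ℕ → ContDiffBump (0 : Space d) := fun n =>
    ⟨1 / ((n : ℝ) + 1), 2 * (1 / ((n : ℝ) + 1)), by positivity, by
      have : (0 : ℝ) < 1 / ((n : ℝ) + 1) := by positivity
      linarith⟩ with hφ
  have h1 := ContDiffBump.ae_convolution_tendsto_right_of_locallyIntegrable (μ := volume) (φ := φ)
    (l := atTop) (K := 2) (g := fun x => w x)
    (by
      have := (tendsto_one_div_add_atTop_nhds_zero_nat (𝕜 := ℝ)).const_mul 2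
      rwa [mul_zero] at this)
    (Eventually.of_forall fun n => le_rfl) ((Lp.memLp w).locallyIntegrable (by norm_num))
  filter_upwards [h1] with x hx
  refine le_of_tendsto hx.norm (Eventually.of_forall fun n => ?_)
  set η : Space d → ℂ := fun y => (((φ n).normed volume (x - y) : ℝ) : ℂ) with hη
  have hηc : HasCompactSupport η := by
    have h2 : HasCompactSupport fun y => (φ n).normed volume (x - y) :=
      (φ n).hasCompactSupport_normed.comp_homeomorph (Homeomorph.subLeft x)
    exact h2.comp_left (g := fun r : ℝ => (r : ℂ)) (by simp)
  have hηs : ContDiff ℝ (⊤ : ℕ∞) η := by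
    have h2 : ContDiff ℝ (⊤ : ℕ∞) ((φ n).normed volume) := (φ n).contDiff_normed
    exact Complex.ofRealCLM.contDiff.comp (h2.comp (by fun_prop : ContDiff ℝ (⊤ : ℕ∞) fun y : Space d => x - y))
  have h3 := h (hηc.toSchwartzMap hηs)
  have hnorm : ∫ y, ‖(hηc.toSchwartzMap hηs) y‖ = 1 := by
    have : ∀ y, ‖(hηc.toSchwartzMap hηs) y‖ = (φ n).normed volume (x - y) := by
      intro y
      show ‖η y‖ = _
      rw [hη, Complex.norm_real, Real.norm_of_nonneg ((φ n).nonneg_normed _)]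
    simp_rw [this]
    rw [integral_sub_left_eq_self (fun y => (φ n).normed volume y) volume x, (φ n).integral_normed]
  have hin : inner ℂ ((hηc.toSchwartzMap hηs).toLp 2) w =
      convolution ((φ n).normed volume) (fun x => w x) (ContinuousLinearMap.lsmul ℝ ℝ) volume x := by
    rw [L2.inner_def, convolution_eq_swap]
    refine integral_congr_ae ?_
    filter_upwards [(hηc.toSchwartzMap hηs).coeFn_toLp 2] with y hy
    rw [hy, RCLike.inner_apply]
    show w y * (starRingEnd ℂ) (η y) = _
    rw [hη, Complex.conj_ofReal, ContinuousLinearMap.lsmul_apply, Complex.real_smul, mul_comm]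
  rw [hin, hnorm, mul_one] at h3
  exact h3

/-- An operator whose adjoint is bounded from `L¹ ∩ 𝓢` to `L^∞` is bounded from `L¹ ∩ L²` to
`L^∞`. -/
lemma ae_enorm_le_of_adjoint_schwartz {B : ℝ} (hB : 0 < B) (T : L2 d →L[ℂ] L2 d)
    (T' : 𝓢(Space d, ℂ) → 𝓢(Space d, ℂ))
    (hTT : ∀ (φ : 𝓢(Space d, ℂ)) (f : L2 d), inner ℂ (φ.toLp 2) (T f) = inner ℂ ((T' φ).toLp 2) f)
    (hT' : ∀ φ x, ‖T' φ x‖ ≤ B * ∫ y, ‖φ y‖) (f : L2 d) :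
    ∀ᵐ x, ‖T f x‖ₑ ≤ ENNReal.ofReal B * ∫⁻ y, ‖f y‖ₑ := by
  rcases eq_or_ne (∫⁻ y, ‖f y‖ₑ) ∞ with h1 | h1
  · rw [h1, ENNReal.mul_top (by simpa using hB)]
    exact Eventually.of_forall fun _ => le_top
  have hfi : Integrable (fun y => f y) :=
    ⟨Lp.aestronglyMeasurable f, by rw [HasFiniteIntegral]; exact h1.lt_top⟩
  have h2 : ENNReal.ofReal B * ∫⁻ y, ‖f y‖ₑ = ENNReal.ofReal (B * ∫ y, ‖f y‖) := by
    rw [ENNReal.ofReal_mul hB.le, ofReal_integral_norm_eq_lintegral_enorm hfi]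
  have h3 : ∀ φ : 𝓢(Space d, ℂ), ‖inner ℂ (φ.toLp 2) (T f)‖ ≤ (B * ∫ y, ‖f y‖) * ∫ y, ‖φ y‖ := by
    intro φ
    rw [hTT, L2.inner_def]
    set c : ℝ := B * ∫ y, ‖φ y‖ with hc
    have h4 : ∀ᵐ y, ‖inner ℂ (((T' φ).toLp 2 : L2 d) y) (f y)‖ ≤ c * ‖f y‖ := by
      filter_upwards [(T' φ).coeFn_toLp 2] with y hy
      refine (norm_inner_le_norm _ _).trans ?_
      rw [hy]
      exact mul_le_mul_of_nonneg_right (hT' φ y) (norm_nonneg _)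
    refine (norm_integral_le_of_norm_le (hfi.norm.const_mul c) h4).trans (le_of_eq ?_)
    rw [integral_const_mul, hc]; ring
  have h5 := ae_norm_le_of_schwartz (T f) h3
  filter_upwards [h5] with x hx
  rw [h2, ← ofReal_norm]
  exact ENNReal.ofReal_le_ofReal hx

/-- The dispersive estimate, from `L¹ ∩ L²` to `L^∞`. -/
lemma ae_enorm_S_le {t : ℝ} (ht : t ≠ 0) (f : L2 d) :
    ∀ᵐ x, ‖S t f x‖ₑ ≤ ENNReal.ofReal (decay d t) * ∫⁻ y, ‖f y‖ₑ :=
  ae_enorm_le_of_adjoint_schwartz (decay_pos ht) (S t) (schwartzS (-t))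
    (fun φ f => by rw [inner_S, S_toLp])
    (fun φ x => by simpa using norm_schwartzS_le (neg_ne_zero.2 ht) φ x) f

/-- The inverse Fourier transform on `L²` as a continuous linear map. -/
def fourierL2 : L2 d →L[ℂ] L2 d :=
  ((Lp.fourierTransformₗᵢ (Space d) ℂ).symm.toContinuousLinearEquiv : L2 d →L[ℂ] L2 d)

lemma ae_enorm_fourierL2_le (f : L2 d) :
    ∀ᵐ x, ‖fourierL2 f x‖ₑ ≤ ENNReal.ofReal 1 * ∫⁻ y, ‖f y‖ₑ := by
  refine ae_enorm_le_of_adjoint_schwartz one_pos fourierL2 (fun φ => 𝓕 φ) (fun φ f => ?_)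
    (fun φ x => ?_) f
  · rw [← SchwartzMap.toLp_fourier_eq]
    show inner ℂ _ (𝓕⁻ f) = _
    rw [← Lp.inner_fourier_eq, fourier_fourierInv_eq]
  · rw [one_mul]
    refine (SchwartzMap.norm_fourier_apply_le_toLp_one φ x).trans (le_of_eq ?_)
    rw [SchwartzMap.norm_toLp_one]

/-! ### Truncated powers -/

/-- The truncated power `min(|z|, k)^q z`. -/
def truncPow (q k : ℝ) (z : ℂ) : ℂ := ((min ‖z‖ k ^ q : ℝ) : ℂ) * z

@[simp] lemma truncPow_zero (q k : ℝ) : truncPow q k 0 = 0 := by simp [truncPow]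

/-- Bernoulli's inequality at b/a, for which q ≥ 1 is needed; the factor b ≤ a compensates the
a^{q-1} it produces. -/
lemma rpow_sub_rpow_le {q : ℝ} (hq : 1 ≤ q) {a b : ℝ} (hb : 0 ≤ b) (hab : b ≤ a) :
    (a ^ q - b ^ q) * b ≤ q * a ^ q * (a - b) := by
  rcases hb.eq_or_lt with rfl | hb0
  · simp only [mul_zero]
    have := Real.rpow_nonneg hab q
    have h2 : 0 ≤ a - 0 := by linarith
    positivity
  have ha : 0 < a := hb0.trans_le hab
  have h1 := one_add_mul_self_le_rpow_one_add (s := b / a - 1) (by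
    have : 0 < b / a := by positivity
    linarith) hq
  rw [add_sub_cancel, Real.div_rpow hb ha.le, le_div_iff₀ (by positivity)] at h1
  have h2 : a ^ q - b ^ q ≤ q * a ^ q * ((a - b) / a) := by
    have : (1 + q * (b / a - 1)) * a ^ q = a ^ q - q * a ^ q * ((a - b) / a) := by
      field_simp; ring
    linarith
  have h3 : 0 ≤ (a - b) / a := div_nonneg (by linarith) ha.le
  have h4 : q * a ^ q * ((a - b) / a) * b ≤ q * a ^ q * (a - b) := by
    have h5 : (a - b) / a * b ≤ a - b := by
      rw [div_mul_eq_mul_div, div_le_iff₀ ha]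
      nlinarith
    have h6 : 0 ≤ q * a ^ q := by positivity
    calc _ = q * a ^ q * ((a - b) / a * b) := by ring
      _ ≤ _ := by gcongr
  exact (mul_le_mul_of_nonneg_right h2 hb).trans h4

/-- With |w| ≤ |z| and truncated moduli b ≤ a, split the difference as a^q(z - w) + (a^q - b^q)w. If
|w| ≥ k the second term vanishes; otherwise b = |w| and `rpow_sub_rpow_le` applies. -/
lemma norm_truncPow_sub_le_max {q : ℝ} (hq : 1 ≤ q) {k : ℝ} (hk : 0 ≤ k) (z w : ℂ) :
    ‖truncPow q k z - truncPow q k w‖ ≤ (q + 1) * max (min ‖z‖ k) (min ‖w‖ k) ^ q * ‖z - w‖ := by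
  wlog h : ‖w‖ ≤ ‖z‖ generalizing z w
  · rw [norm_sub_rev, max_comm, norm_sub_rev z w]
    exact this w z (le_of_not_ge h)
  set a := min ‖z‖ k with ha
  set b := min ‖w‖ k with hb
  have hba : b ≤ a := min_le_min_right k h
  have hb0 : 0 ≤ b := le_min (norm_nonneg _) hk
  have ha0 : 0 ≤ a := hb0.trans hba
  have hab : b ^ q ≤ a ^ q := Real.rpow_le_rpow hb0 hba (by linarith)
  rw [max_eq_left hba]
  have h1 : truncPow q k z - truncPow q k w = ((a ^ q : ℝ) : ℂ) * (z - w) + ((a ^ q - b ^ q : ℝ) : ℂ) * w := by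
    simp only [truncPow, ← ha, ← hb]; push_cast; ring
  rw [h1]
  have haq : 0 ≤ a ^ q := Real.rpow_nonneg ha0 q
  have h2 : (a ^ q - b ^ q) * ‖w‖ ≤ q * a ^ q * ‖z - w‖ := by
    rcases le_total ‖w‖ k with hw | hw
    · have hbw : b = ‖w‖ := min_eq_left hw
      rw [← hbw]
      refine (rpow_sub_rpow_le hq hb0 hba).trans ?_
      have : a - b ≤ ‖z - w‖ := by
        have := norm_sub_norm_le z w
        have : a ≤ ‖z‖ := min_le_left _ _
        linarith
      gcongr
    · have hbk : b = k := min_eq_right hw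
      have hak : a = k := min_eq_right (hw.trans h)
      rw [hbk, hak, sub_self, zero_mul]; positivity
  calc _ ≤ ‖((a ^ q : ℝ) : ℂ) * (z - w)‖ + ‖((a ^ q - b ^ q : ℝ) : ℂ) * w‖ := norm_add_le _ _
    _ = a ^ q * ‖z - w‖ + (a ^ q - b ^ q) * ‖w‖ := by
        rw [norm_mul, norm_mul, Complex.norm_real, Complex.norm_real, Real.norm_of_nonneg haq,
          Real.norm_of_nonneg (by linarith)]
    _ ≤ _ := by linarith

lemma norm_truncPow_sub_le {q : ℝ} (hq : 1 ≤ q) {k : ℝ} (hk : 0 ≤ k) (z w : ℂ) :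
    ‖truncPow q k z - truncPow q k w‖ ≤ (q + 1) * (‖z‖ ^ q + ‖w‖ ^ q) * ‖z - w‖ := by
  refine (norm_truncPow_sub_le_max hq hk z w).trans ?_
  gcongr
  have h1 : 0 ≤ ‖z‖ ^ q := by positivity
  have h2 : 0 ≤ ‖w‖ ^ q := by positivity
  rcases max_cases (min ‖z‖ k) (min ‖w‖ k) with ⟨h, -⟩ | ⟨h, -⟩ <;> rw [h]
  · have : min ‖z‖ k ^ q ≤ ‖z‖ ^ q :=
      Real.rpow_le_rpow (le_min (norm_nonneg _) hk) (min_le_left _ _) (by linarith)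
    linarith
  · have : min ‖w‖ k ^ q ≤ ‖w‖ ^ q :=
      Real.rpow_le_rpow (le_min (norm_nonneg _) hk) (min_le_left _ _) (by linarith)
    linarith

lemma lipschitzWith_truncPow {q : ℝ} (hq : 1 ≤ q) (k : ℕ) :
    LipschitzWith (Real.toNNReal ((q + 1) * (k : ℝ) ^ q)) (truncPow q k) := by
  refine LipschitzWith.of_dist_le_mul fun z w => ?_
  rw [dist_eq_norm, dist_eq_norm, Real.coe_toNNReal _ (by positivity)]
  refine (norm_truncPow_sub_le_max hq (Nat.cast_nonneg k) z w).trans ?_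
  gcongr
  exact max_le (min_le_right _ _) (min_le_right _ _)

lemma truncPow_of_le (q : ℝ) {k : ℝ} {z : ℂ} (h : ‖z‖ ≤ k) :
    truncPow q k z = ((‖z‖ ^ q : ℝ) : ℂ) * z := by rw [truncPow, min_eq_left h]

lemma tendsto_truncPow (q : ℝ) (z : ℂ) :
    Tendsto (fun k : ℕ => truncPow q k z) atTop (𝓝 (((‖z‖ ^ q : ℝ) : ℂ) * z)) := by
  obtain ⟨n, hn⟩ := exists_nat_ge ‖z‖
  refine tendsto_const_nhds.congr' ?_
  filter_upwards [eventually_ge_atTop n] with k hk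
  rw [truncPow_of_le]
  exact hn.trans (by exact_mod_cast hk)

lemma norm_truncPow_le {q k : ℝ} (hq : 0 ≤ q) (hk : 0 ≤ k) (z : ℂ) :
    ‖truncPow q k z‖ ≤ ‖z‖ ^ q * ‖z‖ := by
  rw [truncPow, norm_mul, Complex.norm_real, Real.norm_of_nonneg
    (Real.rpow_nonneg (le_min (norm_nonneg _) hk) _)]
  gcongr
  exact min_le_left _ _

/-- The exponent (q+2)/(q+1) is dual to q+2, and the right side is the pairing of the truncated
power with z itself. This lets one quantity, `truncInt`, control both sides in the duality
arguments. The spare factor is a ratio min(|z|, k)/|z| ≤ 1 to a positive power. -/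
lemma norm_truncPow_rpow_le {q k : ℝ} (hq : 1 ≤ q) (hk : 0 ≤ k) (z : ℂ) :
    ‖truncPow q k z‖ ^ ((q + 2) / (q + 1)) ≤ min ‖z‖ k ^ q * ‖z‖ ^ 2 := by
  set a := min ‖z‖ k with ha
  have ha0 : 0 ≤ a := le_min (norm_nonneg _) hk
  rcases ha0.eq_or_lt with h0 | h0
  · rw [truncPow, ← ha, ← h0, Real.zero_rpow (by linarith)]
    simp only [Complex.ofReal_zero, zero_mul, norm_zero]
    rw [Real.zero_rpow (by positivity)]
  have hz : 0 < ‖z‖ := h0.trans_le (min_le_left _ _)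
  rw [truncPow, ← ha, norm_mul, Complex.norm_real, Real.norm_of_nonneg (by positivity),
    Real.mul_rpow (by positivity) (by positivity), ← Real.rpow_mul h0.le]
  have h1 : ‖z‖ ^ ((q + 2) / (q + 1)) = ‖z‖ ^ 2 * ‖z‖ ^ (-(q / (q + 1))) := by
    rw [← Real.rpow_natCast, ← Real.rpow_add hz]; congr 1; push_cast; field_simp; ring
  have h2 : a ^ (q * ((q + 2) / (q + 1))) = a ^ q * a ^ (q / (q + 1)) := by
    rw [← Real.rpow_add h0]; congr 1; field_simp; ring
  have h3 : a ^ (q / (q + 1)) * ‖z‖ ^ (-(q / (q + 1))) ≤ 1 := by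
    rw [Real.rpow_neg hz.le, ← div_eq_mul_inv, div_le_one (by positivity)]
    exact Real.rpow_le_rpow h0.le (min_le_left _ _) (by positivity)
  rw [h1, h2]
  calc _ = (a ^ q * ‖z‖ ^ 2) * (a ^ (q / (q + 1)) * ‖z‖ ^ (-(q / (q + 1)))) := by ring
    _ ≤ _ := mul_le_of_le_one_right (by positivity) h3

/-- The map `f ↦ min(|f|, k)^q f` on `L²`. -/
def truncL2 {q : ℝ} (hq : 1 ≤ q) (k : ℕ) (f : L2 d) : L2 d :=
  (lipschitzWith_truncPow hq k).compLp (truncPow_zero q k) f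

lemma truncL2_coe {q : ℝ} (hq : 1 ≤ q) (k : ℕ) (f : L2 d) :
    truncL2 hq k f =ᵐ[volume] fun x => truncPow q k (f x) :=
  (lipschitzWith_truncPow hq k).coeFn_compLp (truncPow_zero q k) f

lemma continuous_truncL2 {q : ℝ} (hq : 1 ≤ q) (k : ℕ) : Continuous (truncL2 (d := d) hq k) :=
  (lipschitzWith_truncPow hq k).continuous_compLp (truncPow_zero q k)

/-! ### Truncated integrals and duality between the exponents (q+2)/(q+1) and q+2 -/

/-- The quantity `∫ min(|f|, k)^q |f|²`. -/
def truncInt (q : ℝ) (k : ℕ) (f : L2 d) : ℝ≥0∞ :=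
  ∫⁻ x, ENNReal.ofReal (min ‖f x‖ k ^ q * ‖f x‖ ^ 2)

lemma inner_truncPow (q k : ℝ) (z : ℂ) :
    inner ℂ (truncPow q k z) z = ((min ‖z‖ k ^ q * ‖z‖ ^ 2 : ℝ) : ℂ) := by
  rw [RCLike.inner_apply, truncPow, map_mul, Complex.conj_ofReal, mul_left_comm, Complex.mul_conj,
    Complex.normSq_eq_norm_sq]
  push_cast; ring

lemma inner_truncL2 {q : ℝ} (hq : 1 ≤ q) (k : ℕ) (f : L2 d) :
    inner ℂ (truncL2 hq k f) f = ((∫ x, min ‖f x‖ k ^ q * ‖f x‖ ^ 2 : ℝ) : ℂ) := by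
  rw [L2.inner_def, ← integral_complex_ofReal]
  refine integral_congr_ae ?_
  filter_upwards [truncL2_coe hq k f] with x hx
  rw [hx, inner_truncPow]

lemma integrable_trunc {q : ℝ} (hq : 1 ≤ q) (k : ℕ) (f : L2 d) :
    Integrable fun x => min ‖f x‖ (k : ℝ) ^ q * ‖f x‖ ^ 2 := by
  have h := L2.integrable_inner (𝕜 := ℂ) (truncL2 hq k f) f
  have h2 : Integrable fun x => (((min ‖f x‖ (k : ℝ) ^ q * ‖f x‖ ^ 2 : ℝ)) : ℂ) := by
    refine h.congr ?_
    filter_upwards [truncL2_coe hq k f] with x hx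
    rw [hx, inner_truncPow]
  exact h2.re.congr (Eventually.of_forall fun x => Complex.ofReal_re _)

lemma truncInt_eq {q : ℝ} (hq : 1 ≤ q) (k : ℕ) (f : L2 d) :
    truncInt q k f = ENNReal.ofReal (inner ℂ (truncL2 hq k f) f).re := by
  rw [inner_truncL2, Complex.ofReal_re, ofReal_integral_eq_lintegral_ofReal (integrable_trunc hq k f)]
  · rfl
  · exact Eventually.of_forall fun x =>
      mul_nonneg (Real.rpow_nonneg (le_min (norm_nonneg _) (Nat.cast_nonneg k)) _) (sq_nonneg _)

lemma truncInt_ne_top {q : ℝ} (hq : 1 ≤ q) (k : ℕ) (f : L2 d) : truncInt q k f ≠ ∞ := by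
  rw [truncInt_eq hq]; exact ENNReal.ofReal_ne_top

lemma enorm_inner_truncL2 {q : ℝ} (hq : 1 ≤ q) (k : ℕ) (f : L2 d) :
    ‖inner ℂ (truncL2 hq k f) f‖ₑ = truncInt q k f := by
  rw [truncInt_eq hq, inner_truncL2, ← ofReal_norm, Complex.norm_real, Real.norm_of_nonneg,
    Complex.ofReal_re]
  exact integral_nonneg fun x =>
      mul_nonneg (Real.rpow_nonneg (le_min (norm_nonneg _) (Nat.cast_nonneg k)) _) (sq_nonneg _)

lemma L2.measurable (f : L2 d) : Measurable (fun x => f x) := (Lp.stronglyMeasurable f).measurable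

/-- Monotone convergence. It presents the σ-norm as a supremum of functionals continuous on L², from
which measurability in time and lower semicontinuity follow. -/
lemma iSup_truncInt {q : ℝ} (hq : 1 ≤ q) (f : L2 d) :
    ⨆ k : ℕ, truncInt q k f = ∫⁻ x, ‖f x‖ₑ ^ (q + 2) := by
  have hf := L2.measurable f
  unfold truncInt
  rw [← lintegral_iSup (fun k => by fun_prop)]
  · refine lintegral_congr fun x => ?_
    have h2 : ENNReal.ofReal (‖f x‖ ^ q * ‖f x‖ ^ 2) = ‖f x‖ₑ ^ (q + 2) := by
      rw [← ofReal_norm, ENNReal.ofReal_rpow_of_nonneg (norm_nonneg _) (by linarith),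
        Real.rpow_add_of_nonneg (norm_nonneg _) (by linarith) (by norm_num)]
      norm_num
    refine le_antisymm (iSup_le fun k => ?_) ?_
    · rw [← h2]
      gcongr
      exact min_le_left _ _
    · obtain ⟨n, hn⟩ := exists_nat_ge ‖f x‖
      refine le_iSup_of_le n ?_
      rw [min_eq_left hn, h2]
  · intro k l hkl x
    have : (k : ℝ) ≤ l := by exact_mod_cast hkl
    simp only
    gcongr

lemma lintegral_truncL2_le {q : ℝ} (hq : 1 ≤ q) (k : ℕ) (f : L2 d) :
    ∫⁻ x, ‖truncL2 hq k f x‖ₑ ^ ((q + 2) / (q + 1)) ≤ truncInt q k f := by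
  refine lintegral_mono_ae ?_
  filter_upwards [truncL2_coe hq k f] with x hx
  rw [hx, ← ofReal_norm, ENNReal.ofReal_rpow_of_nonneg (norm_nonneg _) (by positivity)]
  exact ENNReal.ofReal_le_ofReal (norm_truncPow_rpow_le hq (Nat.cast_nonneg k) _)

lemma eLpNorm'_truncL2_le {q : ℝ} (hq : 1 ≤ q) (k : ℕ) (f : L2 d) :
    eLpNorm' (truncL2 hq k f) ((q + 2) / (q + 1)) volume ≤ truncInt q k f ^ ((q + 1) / (q + 2)) := by
  rw [eLpNorm'_eq_lintegral_enorm, one_div_div]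
  exact ENNReal.rpow_le_rpow (lintegral_truncL2_le hq k f) (by positivity)

lemma holderConjugate_sigma {q : ℝ} (hq : 1 ≤ q) : ((q + 2) / (q + 1)).HolderConjugate (q + 2) := by
  have := (Real.HolderConjugate.conjExponent (p := q + 2) (by linarith)).symm
  rwa [Real.conjExponent, show q + 2 - 1 = q + 1 by ring] at this

lemma enorm_integral_inner_le {q : ℝ} (hq : 1 ≤ q) {f g : Space d → ℂ}
    (hf : AEMeasurable f) (hg : AEMeasurable g) :
    ∫⁻ x, ‖inner ℂ (f x) (g x)‖ₑ ≤
      eLpNorm' f (q + 2) volume * eLpNorm' g ((q + 2) / (q + 1)) volume := by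
  calc _ ≤ ∫⁻ x, ((fun x => ‖f x‖ₑ) * fun x => ‖g x‖ₑ) x := by
        refine lintegral_mono fun x => ?_
        simp only [RCLike.inner_apply, enorm_mul, Pi.mul_apply]
        rw [mul_comm, RCLike.enorm_conj]
    _ ≤ _ := by
        refine (ENNReal.lintegral_mul_le_Lp_mul_Lq volume (holderConjugate_sigma hq).symm
          hf.enorm hg.enorm).trans (le_of_eq ?_)
        simp only [eLpNorm'_eq_lintegral_enorm]

lemma enorm_inner_le {q : ℝ} (hq : 1 ≤ q) (f g : L2 d) :
    ‖inner ℂ f g‖ₑ ≤ eLpNorm' f (q + 2) volume * eLpNorm' g ((q + 2) / (q + 1)) volume := by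
  rw [L2.inner_def]
  exact (enorm_integral_le_lintegral_enorm _).trans
    (enorm_integral_inner_le hq (L2.measurable f).aemeasurable (L2.measurable g).aemeasurable)

lemma enorm_inner_comm (f g : L2 d) : ‖inner ℂ f g‖ₑ = ‖inner ℂ g f‖ₑ := by
  rw [← ofReal_norm, ← ofReal_norm, norm_inner_symm]

/-- The converse of Hölder's inequality. -/
lemma eLpNorm'_le_of_forall_inner {q : ℝ} (hq : 1 ≤ q) (w : L2 d) (I : ℝ≥0∞)
    (h : ∀ ψ : L2 d, ‖inner ℂ ψ w‖ₑ ≤ I * eLpNorm' ψ ((q + 2) / (q + 1)) volume) :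
    eLpNorm' w (q + 2) volume ≤ I := by
  rw [eLpNorm'_eq_lintegral_enorm, ← iSup_truncInt hq, one_div,
    ENNReal.rpow_inv_le_iff (by linarith)]
  refine iSup_le fun k => ?_
  set X := truncInt q k w with hX
  have hXt : X ≠ ∞ := truncInt_ne_top hq k w
  -- Test against the truncated power of `w` itself. Truncation makes `X` finite, so the power of
  -- `X` can be divided out.
  have h1 : X ≤ I * X ^ ((q + 1) / (q + 2)) := by
    rw [hX, ← enorm_inner_truncL2 hq]
    refine (h _).trans ?_
    gcongr
    rw [enorm_inner_truncL2 hq]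
    exact eLpNorm'_truncL2_le hq k w
  rcases eq_or_ne X 0 with h0 | h0
  · rw [h0]; exact zero_le
  have h2 : X ^ (1 / (q + 2)) ≤ I := by
    have hY0 : X ^ ((q + 1) / (q + 2)) ≠ 0 := by simp [ENNReal.rpow_eq_zero_iff, h0, hXt]
    have hYt : X ^ ((q + 1) / (q + 2)) ≠ ∞ := ENNReal.rpow_ne_top_of_nonneg (by positivity) hXt
    rw [← ENNReal.mul_le_mul_iff_left hY0 hYt, ← ENNReal.rpow_add _ _ h0 hXt,
      show 1 / (q + 2) + (q + 1) / (q + 2) = 1 by field_simp; ring, ENNReal.rpow_one]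
    exact h1
  rw [one_div, ENNReal.rpow_inv_le_iff (by linarith)] at h2
  exact h2

lemma measurable_truncInt {q : ℝ} (hq : 1 ≤ q) (k : ℕ) {u : ℝ → L2 d} (hu : Continuous u) :
    Measurable fun t => truncInt q k (u t) := by
  simp_rw [truncInt_eq hq]
  have h1 : Continuous fun t => inner ℂ (truncL2 hq k (u t)) (u t) :=
    ((continuous_truncL2 hq k).comp hu).inner hu
  exact (ENNReal.continuous_ofReal.comp (Complex.continuous_re.comp h1)).measurable

lemma measurable_eLpNorm' {q : ℝ} (hq : 1 ≤ q) {u : ℝ → L2 d} (hu : Continuous u) :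
    Measurable fun t => eLpNorm' (u t) (q + 2) volume := by
  simp_rw [eLpNorm'_eq_lintegral_enorm, ← iSup_truncInt hq]
  exact (Measurable.iSup fun k => measurable_truncInt hq k hu).pow_const _

lemma eLpNorm'_rpow {q : ℝ} (hq : 1 ≤ q) (f : Space d → ℂ) :
    eLpNorm' f (q + 2) volume ^ (q + 2) = ∫⁻ x, ‖f x‖ₑ ^ (q + 2) := by
  rw [eLpNorm'_eq_lintegral_enorm, ← ENNReal.rpow_mul, one_div, inv_mul_cancel₀ (by linarith),
    ENNReal.rpow_one]

/-! ### Strichartz estimates -/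

/-- The dispersive estimate between dual exponents. -/
lemma exists_eLpNorm'_S_le (hd : 1 ≤ d) : ∃ C : ℝ≥0∞, C ≠ ∞ ∧ ∀ (t : ℝ), t ≠ 0 → ∀ f : L2 d,
    eLpNorm' (S t f) (4 / d + 2) volume ≤ C * ENNReal.ofReal |t| ^ (-(2 / (4 / d + 2 : ℝ))) *
      eLpNorm' f ((4 / d + 2) / (4 / d + 1)) volume := by
  have hd0 : (0 : ℝ) < d := by exact_mod_cast hd
  set q : ℝ := 4 / d with hq
  have hq0 : 0 < q := by positivity
  obtain ⟨C, hC, h⟩ := marcinkiewicz (d := d) (r := q + 2) (by linarith)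
  refine ⟨C ^ (q + 2)⁻¹ * ENNReal.ofReal (4 * Real.pi) ^ (-(2 / (q + 2))),
    ENNReal.mul_ne_top (ENNReal.rpow_ne_top_of_nonneg (by positivity) hC)
      (ENNReal.rpow_ne_top_of_ne_zero (by simp [Real.pi_pos]) ENNReal.ofReal_ne_top), ?_⟩
  intro t ht f
  have h1 := h (S t) (decay d t) (decay_pos ht) (fun f => (norm_S t f).le) (ae_enorm_S_le ht) f
  rw [show q + 2 - 1 = q + 1 by ring, show q + 2 - 2 = q by ring] at h1
  have ht' := abs_pos.2 ht
  rw [eLpNorm'_eq_lintegral_enorm, eLpNorm'_eq_lintegral_enorm, one_div_div, one_div]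
  calc _ ≤ (C * ENNReal.ofReal (decay d t) ^ q *
        (∫⁻ x, ‖f x‖ₑ ^ ((q + 2) / (q + 1))) ^ (q + 1)) ^ (q + 2)⁻¹ := by gcongr
    _ = _ := by
        rw [ENNReal.mul_rpow_of_nonneg _ _ (by positivity), ENNReal.mul_rpow_of_nonneg _ _ (by positivity),
          ← ENNReal.rpow_mul, ← ENNReal.rpow_mul, ← div_eq_mul_inv (q + 1)]
        congr 1
        rw [mul_assoc]
        congr 1
        -- With q = 4/d the interpolated decay (d/2)·q/(q+2) equals 2/(q+2), exactly the
        -- Hardy–Littlewood–Sobolev exponent for q+2.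
        rw [decay, ← ENNReal.ofReal_rpow_of_pos (by positivity), ENNReal.ofReal_mul (by positivity),
          ← ENNReal.rpow_mul, show -((d : ℝ) / 2) * (q * (q + 2)⁻¹) = -(2 / (q + 2)) by
            rw [hq]; field_simp; ring,
          ENNReal.mul_rpow_of_ne_top ENNReal.ofReal_ne_top ENNReal.ofReal_ne_top]

/-- The dispersive estimate between the dual exponents `(q+2)/(q+1)` and `q+2`, with the decay rate
`|t|^{-2/(q+2)}`. -/
def Dispersive (d : ℕ) (q : ℝ) : Prop :=
  ∃ C : ℝ≥0∞, C ≠ ∞ ∧ ∀ (t : ℝ), t ≠ 0 → ∀ f : L2 d,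
    eLpNorm' (S t f) (q + 2) volume ≤ C * ENNReal.ofReal |t| ^ (-(2 / (q + 2))) *
      eLpNorm' f ((q + 2) / (q + 1)) volume

lemma dispersive (hd : 1 ≤ d) : Dispersive d (4 / d) := exists_eLpNorm'_S_le hd

lemma hls_sigma {q : ℝ} (hq : 1 ≤ q) : ∃ C : ℝ≥0∞, C ≠ ∞ ∧ ∀ f : ℝ → ℝ≥0∞, Measurable f →
    (∫⁻ t, (∫⁻ s, ENNReal.ofReal |t - s| ^ (-(2 / (q + 2))) * f s) ^ (q + 2)) ^ (1 / (q + 2))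
      ≤ C * (∫⁻ s, f s ^ ((q + 2) / (q + 1))) ^ ((q + 1) / (q + 2)) := by
  obtain ⟨C, hC, h⟩ := hardy_littlewood_sobolev (q := q + 2) (by linarith)
  refine ⟨C ^ (1 / (q + 2)), ENNReal.rpow_ne_top_of_nonneg (by positivity) hC, fun f hf => ?_⟩
  have h1 := h f hf
  rw [show q + 2 - 1 = q + 1 by ring] at h1
  refine (ENNReal.rpow_le_rpow h1 (by positivity : 0 ≤ 1 / (q + 2))).trans (le_of_eq ?_)
  rw [ENNReal.mul_rpow_of_nonneg _ _ (by positivity), ← ENNReal.rpow_mul, mul_one_div]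

lemma hls_bilinear {q : ℝ} (hq : 1 ≤ q) : ∃ C : ℝ≥0∞, C ≠ ∞ ∧ ∀ f g : ℝ → ℝ≥0∞, Measurable f →
    Measurable g → ∫⁻ t, g t * ∫⁻ s, ENNReal.ofReal |t - s| ^ (-(2 / (q + 2))) * f s ≤
      C * (∫⁻ s, f s ^ ((q + 2) / (q + 1))) ^ ((q + 1) / (q + 2)) *
        (∫⁻ s, g s ^ ((q + 2) / (q + 1))) ^ ((q + 1) / (q + 2)) := by
  obtain ⟨C, hC, h⟩ := hls_sigma hq
  refine ⟨C, hC, fun f g hf hg => ?_⟩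
  have hI : Measurable fun t => ∫⁻ s, ENNReal.ofReal |t - s| ^ (-(2 / (q + 2))) * f s :=
    Measurable.lintegral_prod_right' (f := fun p : ℝ × ℝ =>
      ENNReal.ofReal |p.1 - p.2| ^ (-(2 / (q + 2))) * f p.2) (by fun_prop)
  refine (ENNReal.lintegral_mul_le_Lp_mul_Lq volume (holderConjugate_sigma hq) hg.aemeasurable
    hI.aemeasurable).trans ?_
  rw [one_div_div, mul_comm]
  gcongr
  exact h f hf

lemma inner_truncL2_toReal {q : ℝ} (hq : 1 ≤ q) (k : ℕ) (f : L2 d) :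
    inner ℂ f (truncL2 hq k f) = (((truncInt q k f).toReal : ℝ) : ℂ) := by
  rw [← inner_conj_symm, inner_truncL2, Complex.conj_ofReal, truncInt_eq hq, inner_truncL2,
    Complex.ofReal_re, ENNReal.toReal_ofReal]
  exact integral_nonneg fun x =>
      mul_nonneg (Real.rpow_nonneg (le_min (norm_nonneg _) (Nat.cast_nonneg k)) _) (sq_nonneg _)

lemma continuous_S_comp {g : ℝ → ℝ} {u : ℝ → L2 d} (hg : Continuous g) (hu : Continuous u) :
    Continuous fun t => S (g t) (u t) :=
  Continuous.comp (g := fun p : ℝ × L2 d => S p.1 p.2) (f := fun t => (g t, u t))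
    continuous_S_uncurry (hg.prodMk hu)

lemma truncInt_mono {q : ℝ} (hq : 1 ≤ q) (f : L2 d) : Monotone fun k : ℕ => truncInt q k f := by
  intro k l hkl
  refine lintegral_mono fun x => ?_
  have : (k : ℝ) ≤ l := by exact_mod_cast hkl
  gcongr

/-- The homogeneous Strichartz estimate. -/
theorem strichartz {q : ℝ} (hq : 1 ≤ q) (hD : Dispersive d q) : ∃ C : ℝ≥0∞, C ≠ ∞ ∧ ∀ ψ : L2 d,
    (∫⁻ t, eLpNorm' (S t ψ) (q + 2) volume ^ (q + 2)) ^ (1 / (q + 2)) ≤ C * ‖ψ‖ₑ := by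
  obtain ⟨D, hDt, hD⟩ := hD
  obtain ⟨H, hH, hls⟩ := hls_bilinear hq
  refine ⟨(D * H) ^ (1 / 2 : ℝ), ENNReal.rpow_ne_top_of_nonneg (by norm_num)
    (ENNReal.mul_ne_top hDt hH), fun ψ => ?_⟩
  have hcS : Continuous fun t => S t ψ := continuous_S ψ
  -- TT* argument. Truncating in size and time makes `Y` finite and Φ = ∫ S(-t)g(t) dt an integral
  -- in L². Then Y = ⟨ψ, Φ⟩ ≤ ‖ψ‖‖Φ‖, while ‖Φ‖² expands into the double integral of ⟨g(t),
  -- S(t-s)g(s)⟩, which the dispersive bound and the bilinear form of Hardy–Littlewood–Sobolev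
  -- estimate by a power of `Y`. Dividing by that power bounds `Y` independently of `k` and `n`.
  have key : ∀ k n : ℕ, ∫⁻ t in Icc (-(n : ℝ)) n, truncInt q k (S t ψ) ≤
      ((D * H) ^ (1 / 2 : ℝ) * ‖ψ‖ₑ) ^ (q + 2) := by
    intro k n
    set I := Icc (-(n : ℝ)) n with hI
    have hIm : MeasurableSet I := measurableSet_Icc
    set g : ℝ → L2 d := fun t => truncL2 hq k (S t ψ) with hg
    have hgc : Continuous g := (continuous_truncL2 hq k).comp hcS
    have hSg : Continuous fun t => S (-t) (g t) :=
      continuous_S_comp continuous_neg hgc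
    have hint : IntegrableOn (fun t => S (-t) (g t)) I := hSg.integrableOn_Icc
    set Φ : L2 d := ∫ t in I, S (-t) (g t) with hΦ
    have hXm : Measurable fun t => truncInt q k (S t ψ) := measurable_truncInt hq k hcS
    set Y := ∫⁻ t in I, truncInt q k (S t ψ) with hY
    have hXi : ∀ t, inner ℂ ψ (S (-t) (g t)) = (((truncInt q k (S t ψ)).toReal : ℝ) : ℂ) := by
      intro t
      rw [inner_S, neg_neg, inner_truncL2_toReal]
    have hXint : IntegrableOn (fun t => (truncInt q k (S t ψ)).toReal) I := by
      have h1 : Continuous fun t => inner ℂ ψ (S (-t) (g t)) := continuous_const.inner hSg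
      have h2 : Continuous fun t => (truncInt q k (S t ψ)).toReal := by
        have := Complex.continuous_re.comp h1
        refine this.congr fun t => ?_
        rw [Function.comp_apply, hXi, Complex.ofReal_re]
      exact h2.integrableOn_Icc
    have hYeq : Y = ‖inner ℂ ψ Φ‖ₑ := by
      have h1 : inner ℂ ψ Φ = ((∫ t in I, (truncInt q k (S t ψ)).toReal : ℝ) : ℂ) := by
        rw [hΦ, ← integral_inner hint, ← integral_complex_ofReal]
        simp_rw [hXi]
      rw [h1, ← ofReal_norm, Complex.norm_real, Real.norm_of_nonneg
        (integral_nonneg fun _ => ENNReal.toReal_nonneg),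
        ofReal_integral_eq_lintegral_ofReal hXint
          (Eventually.of_forall fun _ => ENNReal.toReal_nonneg), hY]
      refine lintegral_congr fun t => ?_
      rw [ENNReal.ofReal_toReal (truncInt_ne_top hq k _)]
    have hYt : Y ≠ ∞ := by rw [hYeq]; exact enorm_ne_top
    set γ : ℝ → ℝ≥0∞ := I.indicator fun t => truncInt q k (S t ψ) ^ ((q + 1) / (q + 2)) with hγ
    have hγm : Measurable γ := (hXm.pow_const _).indicator hIm
    have hγY : ∫⁻ t, γ t ^ ((q + 2) / (q + 1)) = Y := by
      rw [hY, ← lintegral_indicator hIm]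
      refine lintegral_congr fun t => ?_
      by_cases ht : t ∈ I
      · simp only [hγ, indicator_of_mem ht]
        rw [← ENNReal.rpow_mul, show (q + 1) / (q + 2) * ((q + 2) / (q + 1)) = 1 by field_simp,
          ENNReal.rpow_one]
      · simp only [hγ, indicator_of_notMem ht]
        rw [ENNReal.zero_rpow_of_pos (by positivity)]
    have hΦΦ : ‖Φ‖ₑ ^ 2 ≤ D * H * (Y ^ ((q + 1) / (q + 2)) * Y ^ ((q + 1) / (q + 2))) := by
      have h0 : ‖Φ‖ₑ ^ 2 = ‖inner ℂ Φ Φ‖ₑ := by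
        rw [inner_self_eq_norm_sq_to_K, enorm_pow]
        simp [← ofReal_norm]
      have h1 : ∀ t ∈ I, ‖inner ℂ Φ (S (-t) (g t))‖ₑ ≤
          γ t * ∫⁻ s, D * (ENNReal.ofReal |t - s| ^ (-(2 / (q + 2))) * γ s) := by
        intro t ht
        rw [enorm_inner_comm, hΦ, ← integral_inner hint,
          ← lintegral_const_mul _ (by fun_prop)]
        refine (enorm_integral_le_lintegral_enorm _).trans ?_
        rw [← lintegral_indicator hIm]
        refine lintegral_mono_ae ?_
        -- The dispersive estimate excludes the diagonal s = t, a null set.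
        filter_upwards [compl_mem_ae_iff.2 (measure_singleton t)] with s hs
        have hs : s ≠ t := hs
        by_cases hsI : s ∈ I
        · rw [indicator_of_mem hsI, enorm_inner_comm, inner_S, neg_neg, ← S_add]
          refine (enorm_inner_le hq _ _).trans ?_
          have h2 := hD (t + -s) (by rwa [← sub_eq_add_neg, sub_ne_zero, ne_comm]) (g s)
          refine (mul_le_mul' h2 le_rfl).trans ?_
          rw [← sub_eq_add_neg]
          have h3 : ∀ r ∈ I, eLpNorm' (g r) ((q + 2) / (q + 1)) volume ≤ γ r := fun r hr => by
            simp only [hγ, indicator_of_mem hr]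
            exact eLpNorm'_truncL2_le hq k _
          calc _ ≤ D * ENNReal.ofReal |t - s| ^ (-(2 / (q + 2))) * γ s * γ t := by
                gcongr
                · exact h3 s hsI
                · exact h3 t ht
            _ = _ := by ring
        · rw [indicator_of_notMem hsI]; exact zero_le
      have h2 : inner ℂ Φ Φ = ∫ t in I, inner ℂ Φ (S (-t) (g t)) := (integral_inner hint Φ).symm
      have hm : Measurable fun t => ∫⁻ s, ENNReal.ofReal |t - s| ^ (-(2 / (q + 2))) * γ s :=
        Measurable.lintegral_prod_right' (f := fun p : ℝ × ℝ =>
          ENNReal.ofReal |p.1 - p.2| ^ (-(2 / (q + 2))) * γ p.2) (by fun_prop)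
      rw [h0, h2]
      calc _ ≤ ∫⁻ t in I, γ t * ∫⁻ s, D * (ENNReal.ofReal |t - s| ^ (-(2 / (q + 2))) * γ s) :=
            (enorm_integral_le_lintegral_enorm _).trans (setLIntegral_mono' hIm h1)
        _ ≤ ∫⁻ t, γ t * ∫⁻ s, D * (ENNReal.ofReal |t - s| ^ (-(2 / (q + 2))) * γ s) :=
            setLIntegral_le_lintegral _ _
        _ = D * ∫⁻ t, γ t * ∫⁻ s, ENNReal.ofReal |t - s| ^ (-(2 / (q + 2))) * γ s := by
            rw [← lintegral_const_mul _ (by fun_prop)]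
            refine lintegral_congr fun t => ?_
            rw [lintegral_const_mul _ (by fun_prop)]; ring
        _ ≤ D * (H * Y ^ ((q + 1) / (q + 2)) * Y ^ ((q + 1) / (q + 2))) := by
            gcongr
            have := hls γ γ hγm hγm
            rwa [hγY] at this
        _ = _ := by ring
    have hCS : Y ≤ ‖ψ‖ₑ * ‖Φ‖ₑ := by
      rw [hYeq, ← ofReal_norm, ← ofReal_norm, ← ofReal_norm, ← ENNReal.ofReal_mul (norm_nonneg _)]
      exact ENNReal.ofReal_le_ofReal (norm_inner_le_norm _ _)
    rcases eq_or_ne Y 0 with h0 | h0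
    · rw [h0]; exact zero_le
    set Z := Y ^ ((q + 1) / (q + 2)) with hZ
    have hZ0 : Z ≠ 0 := by simp [hZ, ENNReal.rpow_eq_zero_iff, h0, hYt]
    have hZt : Z ≠ ∞ := ENNReal.rpow_ne_top_of_nonneg (by positivity) hYt
    have hYZ : Y = Y ^ (1 / (q + 2)) * Z := by
      rw [hZ, ← ENNReal.rpow_add _ _ h0 hYt, show 1 / (q + 2) + (q + 1) / (q + 2) = 1 by
        field_simp; ring, ENNReal.rpow_one]
    have h1 : (Y ^ (1 / (q + 2))) ^ 2 ≤ D * H * ‖ψ‖ₑ ^ 2 := by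
      rw [← ENNReal.mul_le_mul_iff_left (mul_ne_zero hZ0 hZ0) (ENNReal.mul_ne_top hZt hZt)]
      calc _ = Y ^ 2 := by conv_rhs => rw [hYZ]
                           ring
        _ ≤ (‖ψ‖ₑ * ‖Φ‖ₑ) ^ 2 := by gcongr
        _ = ‖ψ‖ₑ ^ 2 * ‖Φ‖ₑ ^ 2 := by ring
        _ ≤ ‖ψ‖ₑ ^ 2 * (D * H * (Z * Z)) := by gcongr
        _ = _ := by ring
    have h2 : Y ^ (1 / (q + 2)) ≤ (D * H) ^ (1 / 2 : ℝ) * ‖ψ‖ₑ := by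
      have h3 := ENNReal.rpow_le_rpow h1 (by norm_num : (0 : ℝ) ≤ 1 / 2)
      have hsq : ∀ x : ℝ≥0∞, (x ^ 2) ^ (1 / 2 : ℝ) = x := fun x => by
        rw [← ENNReal.rpow_natCast, ← ENNReal.rpow_mul]; norm_num
      rwa [ENNReal.mul_rpow_of_nonneg _ _ (by norm_num), hsq, hsq] at h3
    rwa [one_div, ENNReal.rpow_inv_le_iff (by linarith)] at h2
  rw [one_div, ENNReal.rpow_inv_le_iff (by linarith)]
  -- Both truncations are removed at once along a single diagonal index.
  have hsup : ∀ t, ⨆ n : ℕ, (Icc (-(n : ℝ)) n).indicator (fun t => truncInt q n (S t ψ)) t =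
      eLpNorm' (S t ψ) (q + 2) volume ^ (q + 2) := by
    intro t
    rw [eLpNorm'_rpow hq, ← iSup_truncInt hq]
    refine le_antisymm (iSup_mono fun n => indicator_le_self' (fun _ _ => zero_le) t) ?_
    refine iSup_le fun k => ?_
    obtain ⟨n, hn⟩ := exists_nat_ge |t|
    refine le_iSup_of_le (max k n) ?_
    have hn2 : |t| ≤ ((max k n : ℕ) : ℝ) := hn.trans (by exact_mod_cast le_max_right _ _)
    rw [indicator_of_mem (show t ∈ Icc (-((max k n : ℕ) : ℝ)) (max k n : ℕ) from abs_le.1 hn2)]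
    exact truncInt_mono hq _ (le_max_left _ _)
  simp_rw [← hsup]
  rw [lintegral_iSup (fun n => (measurable_truncInt hq n hcS).indicator measurableSet_Icc)]
  · refine iSup_le fun n => ?_
    rw [lintegral_indicator measurableSet_Icc]
    exact key n n
  · intro m n hmn t
    have hmn' : (m : ℝ) ≤ n := by exact_mod_cast hmn
    by_cases ht : t ∈ Icc (-(m : ℝ)) m
    · have ht' : t ∈ Icc (-(n : ℝ)) n := ⟨by linarith [ht.1], by linarith [ht.2]⟩
      simp only [indicator_of_mem ht, indicator_of_mem ht']
      exact truncInt_mono hq _ hmn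
    · simp only [indicator_of_notMem ht]; exact zero_le

/-! ### The nonlinearity -/

/-- Hölder with (q+1)/(q+2) = q/(q+2) + 1/(q+2). The measure is left general because the inequality
is used once in space and once in time. -/
lemma lintegral_rpow_mul_le {α : Type*} [MeasurableSpace α] {μ : Measure α} {q : ℝ} (hq : 1 ≤ q)
    {F G : α → ℝ≥0∞} (hF : AEMeasurable F μ) (hG : AEMeasurable G μ) :
    (∫⁻ x, (F x ^ q * G x) ^ ((q + 2) / (q + 1)) ∂μ) ^ ((q + 1) / (q + 2)) ≤
      ((∫⁻ x, F x ^ (q + 2) ∂μ) ^ (1 / (q + 2))) ^ q * (∫⁻ x, G x ^ (q + 2) ∂μ) ^ (1 / (q + 2)) := by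
  have h := ENNReal.lintegral_Lp_mul_le_Lq_mul_Lr (p := (q + 2) / (q + 1)) (q := (q + 2) / q)
    (r := q + 2) (by positivity) (by gcongr; linarith) (by field_simp) μ (hF.pow_const q) hG
  simp only [Pi.mul_apply, one_div_div] at h
  refine h.trans (le_of_eq ?_)
  congr 1
  rw [← ENNReal.rpow_mul, one_div_mul_eq_div]
  congr 2
  ext x
  rw [← ENNReal.rpow_mul]
  congr 1; field_simp

/-- The power `|z|^q z`. -/
def powN (q : ℝ) (z : ℂ) : ℂ := ((‖z‖ ^ q : ℝ) : ℂ) * z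

lemma enorm_powN {q : ℝ} (hq : 0 ≤ q) (z : ℂ) : ‖powN q z‖ₑ = ‖z‖ₑ ^ q * ‖z‖ₑ := by
  rw [powN, enorm_mul, ← ofReal_norm, ← ofReal_norm, Complex.norm_real,
    Real.norm_of_nonneg (by positivity), ENNReal.ofReal_rpow_of_nonneg (norm_nonneg _) hq]

lemma measurable_powN (q : ℝ) : Measurable (powN q) := by unfold powN; fun_prop

lemma enorm_powN_sub_le {q : ℝ} (hq : 1 ≤ q) (z w : ℂ) :
    ‖powN q z - powN q w‖ₑ ≤ ENNReal.ofReal (q + 1) * (‖z‖ₑ ^ q * ‖z - w‖ₑ + ‖w‖ₑ ^ q * ‖z - w‖ₑ) := by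
  have h : ‖powN q z - powN q w‖ ≤ (q + 1) * (‖z‖ ^ q + ‖w‖ ^ q) * ‖z - w‖ := by
    refine le_of_tendsto ((tendsto_truncPow q z).sub (tendsto_truncPow q w)).norm
      (Eventually.of_forall fun k => norm_truncPow_sub_le hq (Nat.cast_nonneg k) z w)
  simp_rw [← ofReal_norm]
  rw [ENNReal.ofReal_rpow_of_nonneg (norm_nonneg _) (by linarith),
    ENNReal.ofReal_rpow_of_nonneg (norm_nonneg _) (by linarith), ← add_mul,
    ← ENNReal.ofReal_add (by positivity) (by positivity), ← mul_assoc,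
    ← ENNReal.ofReal_mul (by positivity), ← ENNReal.ofReal_mul (by positivity)]
  exact ENNReal.ofReal_le_ofReal h

/-- The `L^{q+2}` norm on `ℝ^d`. -/
abbrev nrm (q : ℝ) (f : Space d → ℂ) : ℝ≥0∞ := eLpNorm' f (q + 2) volume

lemma nrm_eq {q : ℝ} (f : Space d → ℂ) : nrm q f = (∫⁻ x, ‖f x‖ₑ ^ (q + 2)) ^ (1 / (q + 2)) :=
  eLpNorm'_eq_lintegral_enorm _ _ _

lemma nrm_add_le {q : ℝ} (hq : 1 ≤ q) (f g : L2 d) : nrm q (f + g : L2 d) ≤ nrm q f + nrm q g := by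
  rw [nrm, eLpNorm'_congr_ae (Lp.coeFn_add f g)]
  exact eLpNorm'_add_le (Lp.aestronglyMeasurable f) (Lp.aestronglyMeasurable g) (by linarith)

lemma nrm_neg {q : ℝ} (f : L2 d) : nrm q (-f : L2 d) = nrm q f := by
  rw [nrm, eLpNorm'_congr_ae (Lp.coeFn_neg f)]
  exact eLpNorm'_congr_enorm_ae (Eventually.of_forall fun x => by simp)

lemma nrm_zero {q : ℝ} (hq : 1 ≤ q) : nrm q (0 : L2 d) = 0 := by
  rw [nrm, eLpNorm'_congr_ae (Lp.coeFn_zero ℂ 2 volume)]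
  exact eLpNorm'_zero (by linarith)

lemma nrm_sub_le {q : ℝ} (hq : 1 ≤ q) (f g : L2 d) : nrm q (f - g : L2 d) ≤ nrm q f + nrm q g := by
  rw [sub_eq_add_neg, ← nrm_neg g]; exact nrm_add_le hq _ _

lemma nrm_sub_comm {q : ℝ} (f g : L2 d) : nrm q (f - g : L2 d) = nrm q (g - f : L2 d) := by
  rw [← nrm_neg, neg_sub]

/-- The pairing `∫ conj(ψ) |f|^q f`. -/
def pairing (q : ℝ) (ψ f : L2 d) : ℂ := ∫ x, inner ℂ (ψ x) (powN q (f x))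

lemma lintegral_enorm_pairing_le {q : ℝ} (hq : 1 ≤ q) (ψ f : L2 d) :
    ∫⁻ x, ‖inner ℂ (ψ x) (powN q (f x))‖ₑ ≤ nrm q ψ * nrm q f ^ (q + 1) := by
  refine (enorm_integral_inner_le hq (L2.measurable ψ).aemeasurable
    ((measurable_powN q).comp (L2.measurable f)).aemeasurable).trans (le_of_eq ?_)
  congr 1
  rw [nrm_eq, eLpNorm'_eq_lintegral_enorm, one_div_div, ← ENNReal.rpow_mul, one_div_mul_eq_div]
  congr 2
  ext x
  simp only [Function.comp_apply]
  rw [enorm_powN (by linarith), show ‖f x‖ₑ ^ q * ‖f x‖ₑ = ‖f x‖ₑ ^ (q + 1) by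
    rw [ENNReal.rpow_add_of_nonneg _ _ (by linarith) zero_le_one, ENNReal.rpow_one],
    ← ENNReal.rpow_mul]
  congr 1; field_simp

lemma enorm_pairing_le {q : ℝ} (hq : 1 ≤ q) (ψ f : L2 d) :
    ‖pairing q ψ f‖ₑ ≤ nrm q ψ * nrm q f ^ (q + 1) :=
  (enorm_integral_le_lintegral_enorm _).trans (lintegral_enorm_pairing_le hq ψ f)

lemma integrable_pairing {q : ℝ} (hq : 1 ≤ q) {ψ f : L2 d} (hψ : nrm q ψ ≠ ∞) (hf : nrm q f ≠ ∞) :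
    Integrable fun x => inner ℂ (ψ x) (powN q (f x)) := by
  refine ⟨?_, ?_⟩
  · have := L2.measurable ψ
    have := (measurable_powN q).comp (L2.measurable f)
    have h : Measurable fun x => powN q (f x) * (starRingEnd ℂ) (ψ x) :=
      this.mul (Complex.continuous_conj.measurable.comp ‹_›)
    exact h.aestronglyMeasurable
  · refine (lintegral_enorm_pairing_le hq ψ f).trans_lt ?_
    exact ENNReal.mul_lt_top hψ.lt_top (ENNReal.rpow_lt_top_of_nonneg (by linarith) hf)

lemma enorm_pairing_sub_le {q : ℝ} (hq : 1 ≤ q) {ψ f g : L2 d} (hψ : nrm q ψ ≠ ∞)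
    (hf : nrm q f ≠ ∞) (hg : nrm q g ≠ ∞) :
    ‖pairing q ψ f - pairing q ψ g‖ₑ ≤ nrm q ψ *
      (ENNReal.ofReal (q + 1) * (nrm q f ^ q * nrm q (f - g : L2 d) + nrm q g ^ q * nrm q (f - g : L2 d))) := by
  have hfm := L2.measurable f
  have hgm := L2.measurable g
  have h1 : pairing q ψ f - pairing q ψ g =
      ∫ x, inner ℂ (ψ x) (powN q (f x) - powN q (g x)) := by
    rw [pairing, pairing, ← integral_sub (integrable_pairing hq hψ hf) (integrable_pairing hq hψ hg)]
    simp_rw [inner_sub_right]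
  rw [h1]
  refine (enorm_integral_le_lintegral_enorm _).trans ?_
  refine (enorm_integral_inner_le hq (L2.measurable ψ).aemeasurable
    (((measurable_powN q).comp hfm).sub ((measurable_powN q).comp hgm)).aemeasurable).trans ?_
  gcongr
  have hrw : ∀ h : L2 d, nrm q h = (∫⁻ x, ‖h x‖ₑ ^ (q + 2)) ^ (1 / (q + 2)) := fun h => nrm_eq h
  have hsub : nrm q (f - g : L2 d) = (∫⁻ x, ‖f x - g x‖ₑ ^ (q + 2)) ^ (1 / (q + 2)) := by
    rw [nrm, eLpNorm'_congr_ae (Lp.coeFn_sub f g), eLpNorm'_eq_lintegral_enorm]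
    rfl
  have hσ : 1 ≤ (q + 2) / (q + 1) := by rw [one_le_div (by linarith)]; linarith
  have hσ0 : 0 < (q + 2) / (q + 1) := by positivity
  set F : Space d → ℝ≥0∞ := fun x => ‖f x‖ₑ ^ q * ‖f x - g x‖ₑ with hF
  set G : Space d → ℝ≥0∞ := fun x => ‖g x‖ₑ ^ q * ‖f x - g x‖ₑ with hG
  rw [eLpNorm'_eq_lintegral_enorm, one_div_div]
  calc _ ≤ (∫⁻ x, (ENNReal.ofReal (q + 1) * (F + G) x) ^ ((q + 2) / (q + 1))) ^ ((q + 1) / (q + 2)) := by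
        gcongr with x
        exact enorm_powN_sub_le hq _ _
    _ = ENNReal.ofReal (q + 1) * (∫⁻ x, (F + G) x ^ ((q + 2) / (q + 1))) ^ (1 / ((q + 2) / (q + 1))) := by
        simp_rw [ENNReal.mul_rpow_of_nonneg _ _ hσ0.le]
        rw [lintegral_const_mul' _ _ (ENNReal.rpow_ne_top_of_nonneg hσ0.le ENNReal.ofReal_ne_top),
          ENNReal.mul_rpow_of_nonneg _ _ (by positivity), ← ENNReal.rpow_mul, one_div_div,
          show (q + 2) / (q + 1) * ((q + 1) / (q + 2)) = 1 by field_simp, ENNReal.rpow_one]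
    _ ≤ ENNReal.ofReal (q + 1) * ((∫⁻ x, F x ^ ((q + 2) / (q + 1))) ^ (1 / ((q + 2) / (q + 1))) +
          (∫⁻ x, G x ^ ((q + 2) / (q + 1))) ^ (1 / ((q + 2) / (q + 1)))) := by
        gcongr
        exact ENNReal.lintegral_Lp_add_le (by fun_prop) (by fun_prop) hσ
    _ ≤ _ := by
        rw [one_div_div, hsub, hrw f, hrw g]
        gcongr
        · exact lintegral_rpow_mul_le hq (by fun_prop) (by fun_prop)
        · exact lintegral_rpow_mul_le hq (by fun_prop) (by fun_prop)

/-- The pairing is not continuous on L²; as a pointwise limit of continuous truncated pairings it is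
at least measurable along curves. -/
lemma tendsto_inner_truncL2 {q : ℝ} (hq : 1 ≤ q) {ψ f : L2 d} (hψ : nrm q ψ ≠ ∞)
    (hf : nrm q f ≠ ∞) :
    Tendsto (fun k : ℕ => inner ℂ ψ (truncL2 hq k f)) atTop (𝓝 (pairing q ψ f)) := by
  have h1 : ∀ k : ℕ, inner ℂ ψ (truncL2 hq k f) = ∫ x, inner ℂ (ψ x) (truncPow q k (f x)) := by
    intro k
    rw [L2.inner_def]
    refine integral_congr_ae ?_
    filter_upwards [truncL2_coe hq k f] with x hx
    rw [hx]
  simp_rw [h1]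
  have hψm := L2.measurable ψ
  have hfm := L2.measurable f
  refine tendsto_integral_of_dominated_convergence (fun x => ‖inner ℂ (ψ x) (powN q (f x))‖)
    (fun k => ?_) (integrable_pairing hq hψ hf).norm (fun k => Eventually.of_forall fun x => ?_)
    (Eventually.of_forall fun x => ?_)
  · have h : Measurable fun x => truncPow q k (f x) * (starRingEnd ℂ) (ψ x) :=
      ((by unfold truncPow; fun_prop : Measurable (truncPow q (k : ℝ))).comp hfm).mul
        (Complex.continuous_conj.measurable.comp hψm)
    exact h.aestronglyMeasurable
  · simp only [RCLike.inner_apply, norm_mul]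
    gcongr
    refine (norm_truncPow_le (by linarith) (Nat.cast_nonneg k) _).trans (le_of_eq ?_)
    rw [powN, norm_mul, Complex.norm_real, Real.norm_of_nonneg (by positivity)]
  · exact tendsto_const_nhds.inner (tendsto_truncPow q (f x))

lemma aestronglyMeasurable_pairing {q : ℝ} (hq : 1 ≤ q) {φ u : ℝ → L2 d} (hφ : Continuous φ)
    (hu : Continuous u) {μ : Measure ℝ} (hφf : ∀ᵐ r ∂μ, nrm q (φ r) ≠ ∞)
    (huf : ∀ᵐ r ∂μ, nrm q (u r) ≠ ∞) :
    AEStronglyMeasurable (fun r => pairing q (φ r) (u r)) μ := by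
  refine aestronglyMeasurable_of_tendsto_ae atTop
    (f := fun (k : ℕ) r => inner ℂ (φ r) (truncL2 hq k (u r))) (fun k => ?_) ?_
  · exact (hφ.inner ((continuous_truncL2 hq k).comp hu)).aestronglyMeasurable
  · filter_upwards [hφf, huf] with r h1 h2
    exact tendsto_inner_truncL2 hq h1 h2

/-- The norm in `L^{q+2}(I; L^{q+2})`. -/
def stNorm (q : ℝ) (u : ℝ → L2 d) (I : Set ℝ) : ℝ≥0∞ :=
  (∫⁻ r in I, nrm q (u r) ^ (q + 2)) ^ (1 / (q + 2))

lemma stNorm_mono {q : ℝ} (hq : 1 ≤ q) (u : ℝ → L2 d) {I J : Set ℝ} (h : I ⊆ J) :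
    stNorm q u I ≤ stNorm q u J := by
  unfold stNorm; gcongr

lemma stNorm_congr {q : ℝ} {u v : ℝ → L2 d} {I : Set ℝ} (hI : MeasurableSet I) (h : EqOn u v I) :
    stNorm q u I = stNorm q v I := by
  unfold stNorm
  congr 1
  exact setLIntegral_congr_fun hI fun x hx => by rw [h hx]

lemma lintegral_ne_top_of_stNorm {q : ℝ} (hq : 1 ≤ q) {u : ℝ → L2 d} {I : Set ℝ}
    (h : stNorm q u I ≠ ∞) : ∫⁻ r in I, nrm q (u r) ^ (q + 2) ≠ ∞ := fun h' => by
  rw [stNorm, h', ENNReal.top_rpow_of_pos (by positivity)] at h; exact h rfl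

lemma ae_nrm_ne_top {q : ℝ} (hq : 1 ≤ q) {u : ℝ → L2 d} (hu : Continuous u) {I : Set ℝ}
    (h : stNorm q u I ≠ ∞) : ∀ᵐ r ∂(volume.restrict I), nrm q (u r) ≠ ∞ := by
  have := ae_lt_top ((measurable_eLpNorm' hq hu).pow_const (q + 2)) (lintegral_ne_top_of_stNorm hq h)
  filter_upwards [this] with r hr h'
  rw [show eLpNorm' (u r) (q + 2) volume = ∞ from h', ENNReal.top_rpow_of_pos (by linarith)] at hr
  exact lt_irrefl _ hr

lemma stNorm_add_le {q : ℝ} (hq : 1 ≤ q) {u v : ℝ → L2 d} (hu : Continuous u) (hv : Continuous v)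
    (I : Set ℝ) : stNorm q (fun r => u r + v r) I ≤ stNorm q u I + stNorm q v I := by
  unfold stNorm
  calc _ ≤ (∫⁻ r in I, ((fun r => nrm q (u r)) + fun r => nrm q (v r)) r ^ (q + 2)) ^ (1 / (q + 2)) := by
        gcongr with r
        exact nrm_add_le hq _ _
    _ ≤ _ := ENNReal.lintegral_Lp_add_le (measurable_eLpNorm' hq hu).aemeasurable
        (measurable_eLpNorm' hq hv).aemeasurable (by linarith)

lemma stNorm_sub_comm {q : ℝ} (u v : ℝ → L2 d) (I : Set ℝ) :
    stNorm q (fun r => u r - v r) I = stNorm q (fun r => v r - u r) I := by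
  unfold stNorm; simp_rw [nrm_sub_comm]

lemma stNorm_zero {q : ℝ} (hq : 1 ≤ q) (I : Set ℝ) : stNorm q (fun _ => (0 : L2 d)) I = 0 := by
  unfold stNorm
  simp_rw [nrm_zero hq]
  rw [ENNReal.zero_rpow_of_pos (by linarith), lintegral_zero, ENNReal.zero_rpow_of_pos (by positivity)]

lemma lintegral_holder {q : ℝ} (hq : 1 ≤ q) {F G : ℝ → ℝ≥0∞} (hF : Measurable F)
    (hG : Measurable G) (I : Set ℝ) :
    ∫⁻ r in I, F r * G r ≤ (∫⁻ r in I, F r ^ (q + 2)) ^ (1 / (q + 2)) *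
      (∫⁻ r in I, G r ^ ((q + 2) / (q + 1))) ^ ((q + 1) / (q + 2)) := by
  have := ENNReal.lintegral_mul_le_Lp_mul_Lq (volume.restrict I) (holderConjugate_sigma hq).symm
    hF.aemeasurable hG.aemeasurable
  rwa [one_div_div] at this

lemma measurable_nrm {q : ℝ} (hq : 1 ≤ q) {u : ℝ → L2 d} (hu : Continuous u) :
    Measurable fun r => nrm q (u r) := measurable_eLpNorm' hq hu

lemma lintegral_nrm_rpow {q : ℝ} (hq : 1 ≤ q) (u : ℝ → L2 d) (I : Set ℝ) :
    (∫⁻ r in I, (nrm q (u r) ^ (q + 1)) ^ ((q + 2) / (q + 1))) ^ ((q + 1) / (q + 2))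
      = stNorm q u I ^ (q + 1) := by
  rw [stNorm, ← ENNReal.rpow_mul, one_div_mul_eq_div]
  congr 2
  ext r
  rw [← ENNReal.rpow_mul]; congr 1; field_simp

lemma integrableOn_pairing {q : ℝ} (hq : 1 ≤ q) {φ u : ℝ → L2 d} (hφ : Continuous φ)
    (hu : Continuous u) {I : Set ℝ} (hφf : stNorm q φ I ≠ ∞) (huf : stNorm q u I ≠ ∞) :
    IntegrableOn (fun r => pairing q (φ r) (u r)) I := by
  refine ⟨aestronglyMeasurable_pairing hq hφ hu (ae_nrm_ne_top hq hφ hφf)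
    (ae_nrm_ne_top hq hu huf), ?_⟩
  calc _ ≤ ∫⁻ r in I, nrm q (φ r) * nrm q (u r) ^ (q + 1) :=
        lintegral_mono fun r => enorm_pairing_le hq _ _
    _ ≤ stNorm q φ I * stNorm q u I ^ (q + 1) := by
        rw [← lintegral_nrm_rpow hq]
        exact lintegral_holder hq (measurable_nrm hq hφ) ((measurable_nrm hq hu).pow_const _) I
    _ < ∞ := ENNReal.mul_lt_top hφf.lt_top (ENNReal.rpow_lt_top_of_nonneg (by linarith) huf)

/-! ### Inhomogeneous estimates -/

/-- The dual Strichartz estimate: test against w itself, apply Hölder in time and `strichartz`, and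
divide by ‖w‖. Here `m` plays the role of the L^{σ'} size of the source, which enters only through
pairings. -/
lemma exists_enorm_le_of_dual {q : ℝ} (hq : 1 ≤ q) (hD : Dispersive d q) :
    ∃ C : ℝ≥0∞, C ≠ ∞ ∧ ∀ (I : Set ℝ) (m : ℝ → ℝ≥0∞), Measurable m → ∀ w : L2 d,
      (∀ ψ : L2 d, ‖inner ℂ ψ w‖ₑ ≤ ∫⁻ r in I, nrm q (S r ψ) * m r) →
      ‖w‖ₑ ≤ C * (∫⁻ r in I, m r ^ ((q + 2) / (q + 1))) ^ ((q + 1) / (q + 2)) := by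
  obtain ⟨C, hC, hS⟩ := strichartz hq hD
  refine ⟨C, hC, fun I m hm w hw => ?_⟩
  set M := (∫⁻ r in I, m r ^ ((q + 2) / (q + 1))) ^ ((q + 1) / (q + 2))
  have h1 : ‖w‖ₑ * ‖w‖ₑ ≤ ‖w‖ₑ * (C * M) := by
    calc ‖w‖ₑ * ‖w‖ₑ = ‖inner ℂ w w‖ₑ := by
          rw [inner_self_eq_norm_sq_to_K, enorm_pow, sq]; simp [← ofReal_norm]
      _ ≤ ∫⁻ r in I, nrm q (S r w) * m r := hw w
      _ ≤ (∫⁻ r in I, nrm q (S r w) ^ (q + 2)) ^ (1 / (q + 2)) * M :=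
          lintegral_holder hq (measurable_nrm hq (continuous_S w)) hm I
      _ ≤ (∫⁻ r, nrm q (S r w) ^ (q + 2)) ^ (1 / (q + 2)) * M := by
          gcongr; exact Measure.restrict_le_self
      _ ≤ (C * ‖w‖ₑ) * M := by gcongr; exact hS w
      _ = _ := by ring
  rcases eq_or_ne ‖w‖ₑ 0 with h0 | h0
  · rw [h0]; exact zero_le
  · exact (ENNReal.mul_le_mul_iff_right h0 enorm_ne_top).1 h1

/-- The retarded estimate follows from dispersion directly, so cutting the time integral at t costs
nothing. Testing with S(-t)ψ and using the converse of Hölder bounds the σ-norm of w(t) by the Riesz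
potential of m, and Hardy–Littlewood–Sobolev integrates this in t. -/
lemma exists_stNorm_le_of_dual {q : ℝ} (hq : 1 ≤ q) (hD : Dispersive d q) :
    ∃ C : ℝ≥0∞, C ≠ ∞ ∧ ∀ (a b : ℝ) (m : ℝ → ℝ≥0∞), Measurable m → ∀ w : ℝ → L2 d,
      (∀ t ∈ Icc a b, ∀ ψ : L2 d,
        ‖inner ℂ ψ (S (-t) (w t))‖ₑ ≤ ∫⁻ r in Icc a t, nrm q (S r ψ) * m r) →
      stNorm q w (Icc a b) ≤
        C * (∫⁻ r in Icc a b, m r ^ ((q + 2) / (q + 1))) ^ ((q + 1) / (q + 2)) := by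
  obtain ⟨D, hDt, hDb⟩ := hD
  obtain ⟨H, hHt, hls⟩ := hls_sigma hq
  refine ⟨D * H, ENNReal.mul_ne_top hDt hHt, fun a b m hm w hw => ?_⟩
  set f := (Icc a b).indicator m with hf
  have hfm : Measurable f := hm.indicator measurableSet_Icc
  have hpt : ∀ t ∈ Icc a b, nrm q (w t) ≤
      D * ∫⁻ s, ENNReal.ofReal |t - s| ^ (-(2 / (q + 2))) * f s := by
    intro t ht
    refine eLpNorm'_le_of_forall_inner hq _ _ fun ψ => ?_
    have h1 := hw t ht (S (-t) ψ)
    rw [inner_S_S] at h1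
    refine h1.trans ?_
    rw [← lintegral_indicator measurableSet_Icc]
    calc _ ≤ ∫⁻ s, D * (ENNReal.ofReal |t - s| ^ (-(2 / (q + 2))) * f s) *
          eLpNorm' ψ ((q + 2) / (q + 1)) volume := by
          refine lintegral_mono_ae ?_
          filter_upwards [compl_mem_ae_iff.2 (measure_singleton t)] with s hs
          have hs : s ≠ t := hs
          by_cases hsI : s ∈ Icc a t
          · rw [indicator_of_mem hsI, hf, indicator_of_mem (show s ∈ Icc a b from ⟨hsI.1, hsI.2.trans ht.2⟩), ← S_add]
            have h2 := hDb (s + -t) (by rwa [← sub_eq_add_neg, sub_ne_zero]) ψ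
            rw [← sub_eq_add_neg, abs_sub_comm] at h2
            rw [← sub_eq_add_neg]
            calc _ ≤ D * ENNReal.ofReal |t - s| ^ (-(2 / (q + 2))) *
                  eLpNorm' ψ ((q + 2) / (q + 1)) volume * m s := by gcongr
              _ = _ := by ring
          · rw [indicator_of_notMem hsI]; exact zero_le
      _ = _ := by
          rw [lintegral_mul_const _ (by fun_prop), lintegral_const_mul _ (by fun_prop)]
  have hfM : ∫⁻ s, f s ^ ((q + 2) / (q + 1)) = ∫⁻ r in Icc a b, m r ^ ((q + 2) / (q + 1)) := by
    rw [← lintegral_indicator measurableSet_Icc]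
    refine lintegral_congr fun t => ?_
    by_cases ht : t ∈ Icc a b
    · simp only [hf, indicator_of_mem ht]
    · simp only [hf, indicator_of_notMem ht]
      rw [ENNReal.zero_rpow_of_pos (by positivity)]
  have h := hls f hfm
  rw [hfM] at h
  have hK : Measurable fun t => ∫⁻ s, ENNReal.ofReal |t - s| ^ (-(2 / (q + 2))) * f s :=
    Measurable.lintegral_prod_right' (f := fun p : ℝ × ℝ =>
      ENNReal.ofReal |p.1 - p.2| ^ (-(2 / (q + 2))) * f p.2) (by fun_prop)
  calc stNorm q w (Icc a b) ≤ (∫⁻ t in Icc a b,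
        (D * ∫⁻ s, ENNReal.ofReal |t - s| ^ (-(2 / (q + 2))) * f s) ^ (q + 2)) ^ (1 / (q + 2)) := by
        unfold stNorm
        refine ENNReal.rpow_le_rpow ?_ (by positivity)
        refine setLIntegral_mono' measurableSet_Icc fun t ht => ?_
        exact ENNReal.rpow_le_rpow (hpt t ht) (by linarith)
    _ ≤ (∫⁻ t, (D * ∫⁻ s, ENNReal.ofReal |t - s| ^ (-(2 / (q + 2))) * f s) ^ (q + 2)) ^ (1 / (q + 2)) := by
        gcongr; exact Measure.restrict_le_self
    _ = D * (∫⁻ t, (∫⁻ s, ENNReal.ofReal |t - s| ^ (-(2 / (q + 2))) * f s) ^ (q + 2)) ^ (1 / (q + 2)) := by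
        simp_rw [ENNReal.mul_rpow_of_nonneg _ _ (by linarith : 0 ≤ q + 2)]
        rw [lintegral_const_mul _ (hK.pow_const _), ENNReal.mul_rpow_of_nonneg _ _ (by positivity),
          ← ENNReal.rpow_mul, mul_one_div_cancel (by linarith), ENNReal.rpow_one]
    _ ≤ D * (H * (∫⁻ r in Icc a b, m r ^ ((q + 2) / (q + 1))) ^ ((q + 1) / (q + 2))) := by
        gcongr
    _ = _ := (mul_assoc _ _ _).symm

/-! ### Duhamel's formula -/

/-- `v` is the solution of the linear Schrödinger equation on `[a, b]` with source term `c |u|^q u`,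
in integral form. -/
def Duhamel (q : ℝ) (c : ℂ) (v u : ℝ → L2 d) (a b : ℝ) : Prop :=
  ∀ s t, a ≤ s → s ≤ t → t ≤ b → ∀ ψ : L2 d,
    inner ℂ ψ (S (-t) (v t) - S (-s) (v s)) = c * ∫ r in s..t, pairing q (S r ψ) (u r)

lemma pairing_zero {q : ℝ} (ψ : L2 d) : pairing q ψ 0 = 0 := by
  unfold pairing
  rw [← integral_zero (Space d) ℂ]
  refine integral_congr_ae ?_
  filter_upwards [Lp.coeFn_zero ℂ 2 (volume : Measure (Space d))] with x hx
  rw [hx]; simp [powN]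

lemma Duhamel.zero (q : ℝ) (c : ℂ) (a b : ℝ) :
    Duhamel (d := d) q c (fun _ => 0) (fun _ => 0) a b := by
  intro s t _ _ _ ψ
  simp [pairing_zero]

lemma Duhamel.mono {q : ℝ} {c : ℂ} {v u : ℝ → L2 d} {a b a' b' : ℝ} (h : Duhamel q c v u a b)
    (ha : a ≤ a') (hb : b' ≤ b) : Duhamel q c v u a' b' :=
  fun s t h1 h2 h3 ψ => h s t (ha.trans h1) h2 (h3.trans hb) ψ

lemma Duhamel.congr {q : ℝ} {c : ℂ} {v u v' u' : ℝ → L2 d} {a b : ℝ} (h : Duhamel q c v u a b)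
    (hv : EqOn v v' (Icc a b)) (hu : EqOn u u' (Icc a b)) : Duhamel q c v' u' a b := by
  intro s t h1 h2 h3 ψ
  rw [← hv ⟨h1.trans h2, h3⟩, ← hv ⟨h1, h2.trans h3⟩, h s t h1 h2 h3 ψ]
  congr 1
  refine intervalIntegral.integral_congr fun r hr => ?_
  rw [uIcc_of_le h2] at hr
  simp only [hu ⟨h1.trans hr.1, hr.2.trans h3⟩]

/-- A bound for the difference of the source terms. -/
def diffSize (q : ℝ) (u₁ u₂ : ℝ → L2 d) (I : Set ℝ) : ℝ≥0∞ :=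
  (stNorm q u₁ I ^ q + stNorm q u₂ I ^ q) * stNorm q (fun r => u₁ r - u₂ r) I

lemma stNorm_S_ne_top {q : ℝ} (hq : 1 ≤ q) (hD : Dispersive d q) (ψ : L2 d) (I : Set ℝ) :
    stNorm q (fun r => S r ψ) I ≠ ∞ := by
  obtain ⟨C, hC, hS⟩ := strichartz hq hD
  refine ne_top_of_le_ne_top (ENNReal.mul_ne_top hC (enorm_ne_top (x := ψ))) (le_trans ?_ (hS ψ))
  unfold stNorm
  gcongr; exact Measure.restrict_le_self

lemma intervalIntegrable_pairing {q : ℝ} (hq : 1 ≤ q) (hD : Dispersive d q) {u : ℝ → L2 d}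
    (hu : Continuous u) {a b : ℝ} (huf : stNorm q u (Icc a b) ≠ ∞) (ψ : L2 d) {s t : ℝ}
    (hs : a ≤ s) (hst : s ≤ t) (ht : t ≤ b) :
    IntervalIntegrable (fun r => pairing q (S r ψ) (u r)) volume s t := by
  rw [intervalIntegrable_iff_integrableOn_Ioc_of_le hst]
  exact (integrableOn_pairing hq (continuous_S ψ) hu (stNorm_S_ne_top hq hD ψ _) huf).mono_set
    (Ioc_subset_Icc_self.trans (Icc_subset_Icc hs ht))

/-- The difference of the sources is at most a multiple of (|u₁|^q + |u₂|^q)|u₁ - u₂|, whose dual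
norm Hölder bounds by `diffSize`; the two dual estimates do the rest. Source and solution are kept
separate so that one statement serves the iteration (v = F(u)), stability (v = u) and comparison
with zero. The constant does not depend on the interval. -/
theorem exists_duhamel_estimates {q : ℝ} (hq : 1 ≤ q) (hD : Dispersive d q) (c : ℂ) :
    ∃ C : ℝ≥0∞, C ≠ ∞ ∧ ∀ (a b : ℝ) (v₁ v₂ u₁ u₂ : ℝ → L2 d), a ≤ b → Continuous u₁ → Continuous u₂ →
      stNorm q u₁ (Icc a b) ≠ ∞ → stNorm q u₂ (Icc a b) ≠ ∞ →
      Duhamel q c v₁ u₁ a b → Duhamel q c v₂ u₂ a b →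
      ‖S (-b) (v₁ b - v₂ b) - S (-a) (v₁ a - v₂ a)‖ₑ ≤ C * diffSize q u₁ u₂ (Icc a b) ∧
      stNorm q (fun t => v₁ t - v₂ t - S (t - a) (v₁ a - v₂ a)) (Icc a b) ≤
        C * diffSize q u₁ u₂ (Icc a b) := by
  obtain ⟨C₁, hC₁, hest₁⟩ := exists_enorm_le_of_dual hq hD
  obtain ⟨C₂, hC₂, hest₂⟩ := exists_stNorm_le_of_dual hq hD
  set K := ‖c‖ₑ * ENNReal.ofReal (q + 1) with hK
  have hKt : K ≠ ∞ := ENNReal.mul_ne_top enorm_ne_top ENNReal.ofReal_ne_top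
  refine ⟨(C₁ + C₂) * K, by finiteness, fun a b v₁ v₂ u₁ u₂ hab hu₁ hu₂ hf₁ hf₂ h₁ h₂ => ?_⟩
  have hn₁ := measurable_nrm hq hu₁
  have hn₂ := measurable_nrm hq hu₂
  have hn := measurable_nrm hq (hu₁.sub hu₂)
  set F : ℝ → ℝ≥0∞ := fun r => nrm q (u₁ r) ^ q * nrm q (u₁ r - u₂ r : L2 d) with hF
  set G : ℝ → ℝ≥0∞ := fun r => nrm q (u₂ r) ^ q * nrm q (u₁ r - u₂ r : L2 d) with hG
  have hFm : Measurable F := (hn₁.pow_const _).mul hn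
  have hGm : Measurable G := (hn₂.pow_const _).mul hn
  set m : ℝ → ℝ≥0∞ := fun r => K * (F + G) r with hm
  have hmm : Measurable m := (hFm.add hGm).const_mul _
  have hσ : 1 ≤ (q + 2) / (q + 1) := by rw [one_le_div (by linarith)]; linarith
  have hM : (∫⁻ r in Icc a b, m r ^ ((q + 2) / (q + 1))) ^ ((q + 1) / (q + 2)) ≤
      K * diffSize q u₁ u₂ (Icc a b) := by
    calc _ = K * (∫⁻ r in Icc a b, (F + G) r ^ ((q + 2) / (q + 1))) ^ (1 / ((q + 2) / (q + 1))) := by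
          simp_rw [hm, ENNReal.mul_rpow_of_nonneg _ _ (by positivity : 0 ≤ (q + 2) / (q + 1))]
          rw [lintegral_const_mul' _ _ (ENNReal.rpow_ne_top_of_nonneg (by positivity) hKt),
            ENNReal.mul_rpow_of_nonneg _ _ (by positivity), ← ENNReal.rpow_mul, one_div_div,
            show (q + 2) / (q + 1) * ((q + 1) / (q + 2)) = 1 by field_simp, ENNReal.rpow_one]
      _ ≤ K * ((∫⁻ r in Icc a b, F r ^ ((q + 2) / (q + 1))) ^ (1 / ((q + 2) / (q + 1))) +
          (∫⁻ r in Icc a b, G r ^ ((q + 2) / (q + 1))) ^ (1 / ((q + 2) / (q + 1)))) := by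
          gcongr
          exact ENNReal.lintegral_Lp_add_le hFm.aemeasurable hGm.aemeasurable hσ
      _ ≤ _ := by
          rw [one_div_div, diffSize, add_mul]
          gcongr
          · exact lintegral_rpow_mul_le hq hn₁.aemeasurable hn.aemeasurable
          · exact lintegral_rpow_mul_le hq hn₂.aemeasurable hn.aemeasurable
  have hdual : ∀ t ∈ Icc a b, ∀ ψ : L2 d,
      ‖inner ℂ ψ (S (-t) (v₁ t - v₂ t) - S (-a) (v₁ a - v₂ a))‖ₑ ≤
        ∫⁻ r in Icc a t, nrm q (S r ψ) * m r := by
    intro t ht ψ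
    have e : S (-t) (v₁ t - v₂ t) - S (-a) (v₁ a - v₂ a) =
        (S (-t) (v₁ t) - S (-a) (v₁ a)) - (S (-t) (v₂ t) - S (-a) (v₂ a)) := by
      rw [map_sub, map_sub]; abel
    rw [e, inner_sub_right, h₁ a t le_rfl ht.1 ht.2, h₂ a t le_rfl ht.1 ht.2, ← mul_sub,
      ← intervalIntegral.integral_sub (intervalIntegrable_pairing hq hD hu₁ hf₁ ψ le_rfl ht.1 ht.2)
        (intervalIntegrable_pairing hq hD hu₂ hf₂ ψ le_rfl ht.1 ht.2),
      intervalIntegral.integral_of_le ht.1, ← integral_const_mul]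
    refine (enorm_integral_le_lintegral_enorm _).trans ?_
    refine (lintegral_mono_set Ioc_subset_Icc_self).trans ?_
    have hsub : Icc a t ⊆ Icc a b := Icc_subset_Icc_right ht.2
    refine lintegral_mono_ae ?_
    filter_upwards [ae_nrm_ne_top hq (continuous_S ψ) (stNorm_S_ne_top hq hD ψ (Icc a t)),
      ae_nrm_ne_top hq hu₁ (ne_top_of_le_ne_top hf₁ (stNorm_mono hq u₁ hsub)),
      ae_nrm_ne_top hq hu₂ (ne_top_of_le_ne_top hf₂ (stNorm_mono hq u₂ hsub))] with r hr1 hr2 hr3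
    rw [enorm_mul]
    refine (mul_le_mul' le_rfl (enorm_pairing_sub_le hq hr1 hr2 hr3)).trans (le_of_eq ?_)
    simp only [hm, hK, hF, hG, Pi.add_apply]
    ring
  constructor
  · refine (hest₁ (Icc a b) m hmm _ (hdual b ⟨hab, le_rfl⟩)).trans ?_
    rw [mul_assoc]
    gcongr
    exact le_self_add
  · refine (hest₂ a b m hmm _ fun t ht ψ => ?_).trans ?_
    · refine le_trans (le_of_eq ?_) (hdual t ht ψ)
      congr 2
      rw [map_sub, ← S_add, show -t + (t - a) = -a by ring]
    · rw [mul_assoc]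
      gcongr
      exact le_add_self

/-! ### Small intervals -/

/-- Absolute continuity of the integral. The smallness needed by the critical theory comes from
shortening the interval, with one δ for all positions. -/
lemma exists_delta_lintegral {f : ℝ → ℝ≥0∞} {a b : ℝ} (h : ∫⁻ r in Icc a b, f r ≠ ∞) {ε : ℝ≥0∞}
    (hε : ε ≠ 0) : ∃ δ : ℝ, 0 < δ ∧ ∀ s t, a ≤ s → t ≤ b → t - s ≤ δ →
      ∫⁻ r in Icc s t, f r ≤ ε := by
  obtain ⟨δ, hδ, H⟩ := exists_pos_setLIntegral_lt_of_measure_lt h hε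
  obtain ⟨δ', hδ', hlt⟩ : ∃ δ' : ℝ, 0 < δ' ∧ ENNReal.ofReal δ' < δ := by
    obtain ⟨x, hx0, hx⟩ := exists_between hδ
    refine ⟨x.toReal, ENNReal.toReal_pos hx0.ne' hx.ne_top, ?_⟩
    rwa [ENNReal.ofReal_toReal hx.ne_top]
  refine ⟨δ', hδ', fun s t hs ht hst => ?_⟩
  have hsub : Icc s t ⊆ Icc a b := Icc_subset_Icc hs ht
  have h1 := H (Icc s t) (by
    rw [Measure.restrict_apply measurableSet_Icc, inter_eq_left.2 hsub, Real.volume_Icc]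
    exact (ENNReal.ofReal_le_ofReal hst).trans_lt hlt)
  rw [Measure.restrict_restrict measurableSet_Icc, inter_eq_left.2 hsub] at h1
  exact h1.le

lemma exists_delta_stNorm {q : ℝ} (hq : 1 ≤ q) {u : ℝ → L2 d} {a b : ℝ}
    (h : stNorm q u (Icc a b) ≠ ∞) {ε : ℝ≥0∞} (hε : ε ≠ 0) :
    ∃ δ : ℝ, 0 < δ ∧ ∀ s t, a ≤ s → t ≤ b → t - s ≤ δ → stNorm q u (Icc s t) ≤ ε := by
  have hq2 : 0 < q + 2 := by linarith
  have hε' : ε ^ (q + 2) ≠ 0 := by simp [ENNReal.rpow_eq_zero_iff, hε, hq2.not_gt]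
  obtain ⟨δ, hδ, H⟩ := exists_delta_lintegral (lintegral_ne_top_of_stNorm hq h) hε'
  refine ⟨δ, hδ, fun s t hs ht hst => ?_⟩
  rw [stNorm, one_div, ENNReal.rpow_inv_le_iff hq2]
  exact H s t hs ht hst

/-- Induction on the number of steps of length δ needed to reach t; an interval of finite length
needs finitely many. -/
lemma interval_chain {P : ℝ → Prop} {a b δ : ℝ} (hδ : 0 < δ) (h0 : P a)
    (step : ∀ s t, a ≤ s → s ≤ t → t ≤ b → t - s ≤ δ → P s → P t) : ∀ t ∈ Icc a b, P t := by
  have key : ∀ n : ℕ, ∀ t ∈ Icc a b, t ≤ a + n * δ → P t := by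
    intro n
    induction n with
    | zero =>
      intro t ht h
      have : t = a := le_antisymm (by simpa using h) ht.1
      rwa [this]
    | succ n ih =>
      intro t ht h
      push_cast at h
      have hs : max a (t - δ) ∈ Icc a b := ⟨le_max_left _ _, max_le (ht.1.trans ht.2) (by linarith [ht.2])⟩
      refine step (max a (t - δ)) t (le_max_left _ _) (max_le ht.1 (by linarith)) ht.2
        (by linarith [le_max_right a (t - δ)]) (ih _ hs ?_)
      exact max_le (le_add_of_nonneg_right (by positivity)) (by linarith)
  intro t ht
  obtain ⟨n, hn⟩ := exists_nat_ge ((t - a) / δ)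
  rw [div_le_iff₀ hδ] at hn
  exact key n t ht (by linarith)

lemma continuousOn_Icc_of_enorm {E : Type*} [SeminormedAddCommGroup E] {z : ℝ → E} {a b : ℝ}
    (h : ∀ ε : ℝ≥0∞, ε ≠ 0 → ∃ δ : ℝ, 0 < δ ∧ ∀ s t, a ≤ s → s ≤ t → t ≤ b → t - s ≤ δ →
      ‖z t - z s‖ₑ ≤ ε) : ContinuousOn z (Icc a b) := by
  intro t ht
  refine EMetric.tendsto_nhds.2 fun ε hε => ?_
  obtain ⟨ε', hε', hlt⟩ := exists_between hε
  obtain ⟨δ, hδ, H⟩ := h ε' hε'.ne'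
  filter_upwards [self_mem_nhdsWithin, mem_nhdsWithin_of_mem_nhds (Metric.ball_mem_nhds t hδ)]
    with x hx hxt
  rw [Metric.mem_ball, Real.dist_eq, abs_lt] at hxt
  refine lt_of_le_of_lt ?_ hlt
  rcases le_total x t with hle | hle
  · rw [edist_comm, edist_eq_enorm_sub]; exact H x t hx.1 hle ht.2 (by linarith)
  · rw [edist_eq_enorm_sub]; exact H t x ht.1 hle hx.2 (by linarith)

/-! ### The linear problem with a source term -/

lemma diffSize_zero {q : ℝ} (hq : 1 ≤ q) (u : ℝ → L2 d) (I : Set ℝ) :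
    diffSize q u (fun _ => 0) I = stNorm q u I ^ (q + 1) := by
  simp only [diffSize, stNorm_zero hq, sub_zero]
  rw [ENNReal.zero_rpow_of_pos (by linarith), add_zero,
    ENNReal.rpow_add_of_nonneg _ _ (by linarith) zero_le_one, ENNReal.rpow_one]

theorem exists_duhamel_bounds {q : ℝ} (hq : 1 ≤ q) (hD : Dispersive d q) (c : ℂ) :
    ∃ C : ℝ≥0∞, C ≠ ∞ ∧ ∀ (a b : ℝ) (v u : ℝ → L2 d), a ≤ b → Continuous u →
      stNorm q u (Icc a b) ≠ ∞ → Duhamel q c v u a b →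
      ‖S (-b) (v b) - S (-a) (v a)‖ₑ ≤ C * stNorm q u (Icc a b) ^ (q + 1) ∧
      stNorm q (fun t => v t - S (t - a) (v a)) (Icc a b) ≤ C * stNorm q u (Icc a b) ^ (q + 1) := by
  obtain ⟨C, hC, h⟩ := exists_duhamel_estimates hq hD c
  refine ⟨C, hC, fun a b v u hab hu huf hv => ?_⟩
  have := h a b v (fun _ => 0) u (fun _ => 0) hab hu continuous_const huf
    (by rw [stNorm_zero hq]; simp) hv (Duhamel.zero q c a b)
  simpa only [diffSize_zero hq, sub_zero] using this

lemma pairing_smul {q : ℝ} (k : ℂ) (ψ f : L2 d) :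
    pairing q (k • ψ) f = (starRingEnd ℂ) k * pairing q ψ f := by
  rw [pairing, pairing, ← integral_const_mul]
  refine integral_congr_ae ?_
  filter_upwards [Lp.coeFn_smul k ψ] with x hx
  rw [hx, Pi.smul_apply, inner_smul_left]

lemma pairing_add {q : ℝ} (hq : 1 ≤ q) {ψ₁ ψ₂ f : L2 d} (h1 : nrm q ψ₁ ≠ ∞) (h2 : nrm q ψ₂ ≠ ∞)
    (hf : nrm q f ≠ ∞) : pairing q (ψ₁ + ψ₂) f = pairing q ψ₁ f + pairing q ψ₂ f := by
  rw [pairing, pairing, pairing, ← integral_add (integrable_pairing hq h1 hf) (integrable_pairing hq h2 hf)]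
  refine integral_congr_ae ?_
  filter_upwards [Lp.coeFn_add ψ₁ ψ₂] with x hx
  rw [hx, Pi.add_apply, inner_add_left]

lemma enorm_integral_pairing_le {q : ℝ} (hq : 1 ≤ q) {φ u : ℝ → L2 d} (hφ : Continuous φ)
    (hu : Continuous u) {s t : ℝ} (hst : s ≤ t) :
    ‖∫ r in s..t, pairing q (φ r) (u r)‖ₑ ≤
      stNorm q φ (Icc s t) * stNorm q u (Icc s t) ^ (q + 1) := by
  rw [intervalIntegral.integral_of_le hst, ← lintegral_nrm_rpow hq]
  refine (enorm_integral_le_lintegral_enorm _).trans ?_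
  refine (lintegral_mono_set Ioc_subset_Icc_self).trans ?_
  refine le_trans ?_ (lintegral_holder hq (measurable_nrm hq hφ) ((measurable_nrm hq hu).pow_const _) _)
  exact lintegral_mono fun r => enorm_pairing_le hq _ _

/-- The functional is antilinear, so its conjugate is represented by the Riesz theorem. -/
lemma exists_riesz {E : Type*} [NormedAddCommGroup E] [InnerProductSpace ℂ E] [CompleteSpace E]
    (B : E → ℂ) (M : ℝ) (hadd : ∀ x y, B (x + y) = B x + B y)
    (hsmul : ∀ (k : ℂ) x, B (k • x) = (starRingEnd ℂ) k * B x) (hM : ∀ x, ‖B x‖ ≤ M * ‖x‖) :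
    ∃ z : E, ∀ x, inner ℂ x z = B x := by
  let L : E →ₗ[ℂ] ℂ :=
    { toFun := fun x => (starRingEnd ℂ) (B x)
      map_add' := fun x y => by rw [hadd, map_add]
      map_smul' := fun k x => by rw [hsmul, map_mul, Complex.conj_conj]; rfl }
  let L' : E →L[ℂ] ℂ := L.mkContinuous M fun x => by
    show ‖(starRingEnd ℂ) (B x)‖ ≤ _
    rw [RCLike.norm_conj]; exact hM x
  refine ⟨(InnerProductSpace.toDual ℂ E).symm L', fun x => ?_⟩
  rw [← inner_conj_symm, InnerProductSpace.toDual_symm_apply]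
  exact Complex.conj_conj _

/-- The source need not take values in L², so ∫ S(-r)|u|^q u dr is not taken as an integral in L².
It is defined weakly: Strichartz makes the tested integral a bounded antilinear functional of ψ, and
its representative z(t) gives v(t) = S(t)(z₀ + z(t)). -/
theorem exists_duhamel {q : ℝ} (hq : 1 ≤ q) (hD : Dispersive d q) (c : ℂ) {a b : ℝ} (hab : a ≤ b)
    {u : ℝ → L2 d} (hu : Continuous u) (huf : stNorm q u (Icc a b) ≠ ∞) (z₀ : L2 d) :
    ∃ v : ℝ → L2 d, Continuous v ∧ v a = S a z₀ ∧ Duhamel q c v u a b ∧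
      stNorm q v (Icc a b) ≠ ∞ := by
  obtain ⟨C, hC, hest⟩ := exists_duhamel_bounds hq hD c
  obtain ⟨A, hA, hstr⟩ := strichartz hq hD
  set U := stNorm q u (Icc a b) with hU
  have hU1 : U ^ (q + 1) ≠ ∞ := ENNReal.rpow_ne_top_of_nonneg (by linarith) huf
  have hex : ∀ t ∈ Icc a b, ∃ z : L2 d, ∀ ψ,
      inner ℂ ψ z = c * ∫ r in a..t, pairing q (S r ψ) (u r) := by
    intro t ht
    have hsub : Icc a t ⊆ Icc a b := Icc_subset_Icc_right ht.2
    refine exists_riesz _ (‖c‖ * (A * U ^ (q + 1)).toReal) (fun ψ₁ ψ₂ => ?_) (fun k ψ => ?_)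
      (fun ψ => ?_)
    · rw [← mul_add, ← intervalIntegral.integral_add
        (intervalIntegrable_pairing hq hD hu huf ψ₁ le_rfl ht.1 ht.2)
        (intervalIntegrable_pairing hq hD hu huf ψ₂ le_rfl ht.1 ht.2)]
      congr 1
      rw [intervalIntegral.integral_of_le ht.1, intervalIntegral.integral_of_le ht.1]
      refine integral_congr_ae ?_
      have hm : volume.restrict (Ioc a t) ≤ volume.restrict (Icc a b) :=
        Measure.restrict_mono (Ioc_subset_Icc_self.trans hsub) le_rfl
      filter_upwards [ae_mono hm (ae_nrm_ne_top hq hu huf),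
        ae_mono hm (ae_nrm_ne_top hq (continuous_S ψ₁) (stNorm_S_ne_top hq hD ψ₁ _)),
        ae_mono hm (ae_nrm_ne_top hq (continuous_S ψ₂) (stNorm_S_ne_top hq hD ψ₂ _))]
        with r h1 h2 h3
      rw [map_add, pairing_add hq h2 h3 h1]
    · simp_rw [map_smul, pairing_smul]
      rw [intervalIntegral.integral_const_mul]
      ring
    · rw [norm_mul, mul_assoc]
      gcongr
      have h1 : ‖∫ r in a..t, pairing q (S r ψ) (u r)‖ₑ ≤ A * U ^ (q + 1) * ‖ψ‖ₑ := by
        refine (enorm_integral_pairing_le hq (continuous_S ψ) hu ht.1).trans ?_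
        calc _ ≤ (A * ‖ψ‖ₑ) * U ^ (q + 1) := by
              gcongr
              · refine le_trans ?_ (hstr ψ)
                unfold stNorm
                gcongr; exact Measure.restrict_le_self
              · exact stNorm_mono hq u hsub
          _ = _ := by ring
      have h2 := ENNReal.toReal_mono (by finiteness) h1
      rwa [ENNReal.toReal_mul, toReal_enorm, toReal_enorm] at h2
  choose! z hz using hex
  -- Freezing `z` outside `[a, b]` makes `v` continuous on all of `ℝ`, the convention for all curves
  -- here.
  have hp : ∀ t, (projIcc a b hab t : ℝ) ∈ Icc a b := fun t => (projIcc a b hab t).2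
  have hpe : ∀ t ∈ Icc a b, (projIcc a b hab t : ℝ) = t := fun t ht => by
    rw [projIcc_of_mem hab ht]
  set v : ℝ → L2 d := fun t => S t (z₀ + z (projIcc a b hab t)) with hv
  have hvD : Duhamel q c v u a b := by
    intro s t hs hst ht ψ
    have hsm : s ∈ Icc a b := ⟨hs, hst.trans ht⟩
    have htm : t ∈ Icc a b := ⟨hs.trans hst, ht⟩
    simp only [hv, S_neg_S, hpe s hsm, hpe t htm]
    rw [add_sub_add_left_eq_sub, inner_sub_right, hz s hsm, hz t htm, ← mul_sub,
      intervalIntegral.integral_interval_sub_left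
        (intervalIntegrable_pairing hq hD hu huf ψ le_rfl htm.1 ht)
        (intervalIntegrable_pairing hq hD hu huf ψ le_rfl hs hsm.2)]
  have hzc : ContinuousOn z (Icc a b) := by
    refine continuousOn_Icc_of_enorm fun ε hε => ?_
    obtain ⟨ε', hε', hle⟩ : ∃ ε' : ℝ≥0∞, ε' ≠ 0 ∧ C * ε' ^ (q + 1) ≤ ε := by
      refine ⟨(min (ε / (C + 1)) 1) ^ (1 / (q + 1)), ?_, ?_⟩
      · have h0 : ε / (C + 1) ≠ 0 := ENNReal.div_ne_zero.2 ⟨hε, by finiteness⟩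
        have h2 : min (ε / (C + 1)) 1 ≠ 0 := by
          rcases min_choice (ε / (C + 1)) 1 with h | h <;> rw [h]
          · exact h0
          · exact one_ne_zero
        exact (ENNReal.rpow_pos (pos_iff_ne_zero.2 h2) (by
          exact ne_top_of_le_ne_top ENNReal.one_ne_top (min_le_right _ _))).ne'
      · rw [← ENNReal.rpow_mul, one_div_mul_cancel (by linarith), ENNReal.rpow_one]
        calc C * min (ε / (C + 1)) 1 ≤ (C + 1) * (ε / (C + 1)) := by
              gcongr
              · exact le_self_add
              · exact min_le_left _ _
          _ ≤ ε := ENNReal.mul_div_le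
    obtain ⟨δ, hδ, H⟩ := exists_delta_stNorm hq huf hε'
    refine ⟨δ, hδ, fun s t hs hst ht hd => ?_⟩
    have hsm : s ∈ Icc a b := ⟨hs, hst.trans ht⟩
    have htm : t ∈ Icc a b := ⟨hs.trans hst, ht⟩
    have h1 := (hest s t v u hst hu (ne_top_of_le_ne_top huf (stNorm_mono hq u (Icc_subset_Icc hs ht)))
      (hvD.mono hs ht)).1
    simp only [hv, S_neg_S, hpe s hsm, hpe t htm, add_sub_add_left_eq_sub] at h1
    refine h1.trans (le_trans ?_ hle)
    gcongr
    exact H s t hs ht hd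
  have hvc : Continuous v := by
    refine continuous_S_comp continuous_id (continuous_const.add ?_)
    exact hzc.comp_continuous (continuous_subtype_val.comp continuous_projIcc) hp
  refine ⟨v, hvc, ?_, hvD, ?_⟩
  · have : z a = 0 := ext_inner_left ℂ fun ψ => by
      rw [hz a ⟨le_rfl, hab⟩]; simp
    simp only [hv, hpe a ⟨le_rfl, hab⟩, this, add_zero]
  · have h1 := (hest a b v u hab hu huf hvD).2
    have hc1 : Continuous fun t => S (t - a) (v a) := continuous_S_comp (by fun_prop) continuous_const
    have h2 : stNorm q (fun t => S (t - a) (v a)) (Icc a b) ≠ ∞ := by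
      have : ∀ t (f : L2 d), S (t - a) f = S t (S (-a) f) := fun t f => by
        rw [← S_add, sub_eq_add_neg]
      simp_rw [this]; exact stNorm_S_ne_top hq hD _ _
    have h3 : stNorm q v (Icc a b) ≤ stNorm q (fun t => v t - S (t - a) (v a)) (Icc a b) +
        stNorm q (fun t => S (t - a) (v a)) (Icc a b) := by
      refine le_trans (le_of_eq ?_) (stNorm_add_le hq (hvc.sub hc1) hc1 (Icc a b))
      congr 1
      funext t
      exact (sub_add_cancel _ _).symm
    refine ne_top_of_le_ne_top (ENNReal.add_ne_top.2 ⟨?_, h2⟩) h3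
    exact ne_top_of_le_ne_top (ENNReal.mul_ne_top hC hU1) h1

/-! ### Stability and uniqueness of mild solutions -/

/-- A solution on `[a, b]`, in integral form. -/
structure IsMild (q : ℝ) (c : ℂ) (u : ℝ → L2 d) (a b : ℝ) : Prop where
  continuous : Continuous u
  stNorm_ne_top : stNorm q u (Icc a b) ≠ ∞
  duhamel : Duhamel q c u u a b

lemma IsMild.mono {q : ℝ} (hq : 1 ≤ q) {c : ℂ} {u : ℝ → L2 d} {a b a' b' : ℝ} (h : IsMild q c u a b)
    (ha : a ≤ a') (hb : b' ≤ b) : IsMild q c u a' b' :=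
  ⟨h.continuous, ne_top_of_le_ne_top h.stNorm_ne_top (stNorm_mono hq u (Icc_subset_Icc ha hb)),
    h.duhamel.mono ha hb⟩

lemma stNorm_sub_le {q : ℝ} (hq : 1 ≤ q) {u v : ℝ → L2 d} (hu : Continuous u) (hv : Continuous v)
    (I : Set ℝ) : stNorm q (fun r => u r - v r) I ≤ stNorm q u I + stNorm q v I := by
  have h1 : stNorm q (fun r => -v r) I = stNorm q v I := by
    unfold stNorm; simp_rw [nrm_neg]
  rw [← h1]
  refine le_trans (le_of_eq ?_) (stNorm_add_le hq hu (v := fun r => -v r) hv.neg I)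
  simp_rw [sub_eq_add_neg]

lemma exists_small {q : ℝ} (hq : 1 ≤ q) {C : ℝ≥0∞} (hC : C ≠ ∞) :
    ∃ η : ℝ≥0∞, η ≠ 0 ∧ η ≠ ∞ ∧ C * (η ^ q + η ^ q) ≤ 2⁻¹ := by
  set x : ℝ≥0∞ := (4 * (C + 1))⁻¹ with hx
  have hx0 : x ≠ 0 := ENNReal.inv_ne_zero.2 (by finiteness)
  have hxt : x ≠ ∞ := ENNReal.inv_ne_top.2 (by simp)
  refine ⟨x ^ (1 / q), (ENNReal.rpow_pos (pos_iff_ne_zero.2 hx0) hxt).ne',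
    ENNReal.rpow_ne_top_of_nonneg (by positivity) hxt, ?_⟩
  rw [← ENNReal.rpow_mul, one_div_mul_cancel (by linarith), ENNReal.rpow_one]
  have h1 : (C + 1) * (C + 1)⁻¹ = 1 := ENNReal.mul_inv_cancel (by simp) (by finiteness)
  have h4 : (4 : ℝ≥0∞)⁻¹ = 2⁻¹ * 2⁻¹ := by
    rw [← ENNReal.mul_inv (by simp) (by simp)]; norm_num
  calc C * (x + x) ≤ (C + 1) * (x + x) := by gcongr; exact le_self_add
    _ = (C + 1) * (C + 1)⁻¹ * (2⁻¹ * (2 * 2⁻¹)) := by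
        rw [hx, ENNReal.mul_inv (by simp) (by simp), h4]; ring
    _ = 2⁻¹ := by rw [h1, ENNReal.mul_inv_cancel (by simp) (by simp)]; ring

/-- Absorption of a term with coefficient at most 1/2; it is legitimate only because W is finite. -/
lemma le_two_mul_of_le_add {W X Y : ℝ≥0∞} (hW : W ≠ ∞) (hY : Y ≤ 2⁻¹) (h : W ≤ X + Y * W) :
    W ≤ 2 * X := by
  have h1 : 2⁻¹ * W + 2⁻¹ * W ≤ X + 2⁻¹ * W := by
    rw [← add_mul, ENNReal.inv_two_add_inv_two, one_mul]
    exact h.trans (by gcongr)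
  have h2 : 2⁻¹ * W ≤ X := (ENNReal.add_le_add_iff_right (by finiteness)).1 h1
  calc W = 2 * (2⁻¹ * W) := by rw [← mul_assoc, ENNReal.mul_inv_cancel (by simp) (by simp), one_mul]
    _ ≤ _ := by gcongr

/-- While both σ-norms are at most η, the nonlinear part of the difference is at most half the
difference and is absorbed, leaving a bound by the free evolution of the initial difference. The
second bound keeps the powers of the σ-norms, which tend to 0 on short intervals; this gives
continuity in time in H¹. -/
theorem exists_stability {q : ℝ} (hq : 1 ≤ q) (hD : Dispersive d q) (c : ℂ) :
    ∃ C : ℝ≥0∞, C ≠ ∞ ∧ ∃ η : ℝ≥0∞, η ≠ 0 ∧ ∀ (a b : ℝ) (u₁ u₂ : ℝ → L2 d), a ≤ b →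
      IsMild q c u₁ a b → IsMild q c u₂ a b → stNorm q u₁ (Icc a b) ≤ η → stNorm q u₂ (Icc a b) ≤ η →
      ‖u₁ b - u₂ b‖ₑ ≤ C * ‖u₁ a - u₂ a‖ₑ ∧
      ‖S (-b) (u₁ b - u₂ b) - S (-a) (u₁ a - u₂ a)‖ₑ ≤
        C * (stNorm q u₁ (Icc a b) ^ q + stNorm q u₂ (Icc a b) ^ q) * ‖u₁ a - u₂ a‖ₑ := by
  obtain ⟨C, hC, hest⟩ := exists_duhamel_estimates hq hD c
  obtain ⟨A, hA, hstr⟩ := strichartz hq hD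
  obtain ⟨η, hη0, hηt, hη⟩ := exists_small hq hC
  refine ⟨1 + A + 2 * C * A, by finiteness, η, hη0, fun a b u₁ u₂ hab h₁ h₂ hs₁ hs₂ => ?_⟩
  obtain ⟨e1, e2⟩ := hest a b u₁ u₂ u₁ u₂ hab h₁.continuous h₂.continuous h₁.stNorm_ne_top
    h₂.stNorm_ne_top h₁.duhamel h₂.duhamel
  set W := stNorm q (fun r => u₁ r - u₂ r) (Icc a b) with hW
  set V := stNorm q u₁ (Icc a b) ^ q + stNorm q u₂ (Icc a b) ^ q with hV
  set D := ‖u₁ a - u₂ a‖ₑ with hDdef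
  have hdiff : diffSize q u₁ u₂ (Icc a b) = V * W := rfl
  rw [hdiff] at e1 e2
  have hVη : C * V ≤ 2⁻¹ := by
    refine le_trans ?_ hη
    rw [hV]; gcongr
  have hSc : Continuous fun t => S (t - a) (u₁ a - u₂ a) :=
    continuous_S_comp (by fun_prop) continuous_const
  have hWt : W ≠ ∞ := by
    exact ne_top_of_le_ne_top (ENNReal.add_ne_top.2 ⟨h₁.stNorm_ne_top, h₂.stNorm_ne_top⟩)
      (stNorm_sub_le hq h₁.continuous h₂.continuous _)
  have hWle : W ≤ 2 * (A * D) := by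
    refine le_two_mul_of_le_add hWt hVη ?_
    calc W ≤ stNorm q (fun t => u₁ t - u₂ t - S (t - a) (u₁ a - u₂ a)) (Icc a b) +
          stNorm q (fun t => S (t - a) (u₁ a - u₂ a)) (Icc a b) := by
          refine le_trans (le_of_eq ?_)
            (stNorm_add_le hq ((h₁.continuous.sub h₂.continuous).sub hSc) hSc (Icc a b))
          rw [hW]; congr 1; funext t; exact (sub_add_cancel _ _).symm
      _ ≤ C * (V * W) + A * D := by
          gcongr
          have : ∀ t (f : L2 d), S (t - a) f = S t (S (-a) f) := fun t f => by
            rw [← S_add, sub_eq_add_neg]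
          simp_rw [this]
          have h5 : ‖S (-a) (u₁ a - u₂ a)‖ₑ = D := by
            rw [hDdef, ← ofReal_norm, norm_S, ofReal_norm]
          rw [← h5]
          refine le_trans ?_ (hstr _)
          unfold stNorm
          gcongr; exact Measure.restrict_le_self
      _ = _ := by ring
  constructor
  · calc ‖u₁ b - u₂ b‖ₑ = ‖S (-b) (u₁ b - u₂ b)‖ₑ := by
          rw [← ofReal_norm, ← ofReal_norm, norm_S]
      _ = ‖(S (-b) (u₁ b - u₂ b) - S (-a) (u₁ a - u₂ a)) + S (-a) (u₁ a - u₂ a)‖ₑ := by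
          rw [sub_add_cancel]
      _ ≤ ‖S (-b) (u₁ b - u₂ b) - S (-a) (u₁ a - u₂ a)‖ₑ + ‖S (-a) (u₁ a - u₂ a)‖ₑ := enorm_add_le _ _
      _ ≤ C * V * W + D := by
          gcongr
          · rw [mul_assoc]; exact e1
          · rw [hDdef, ← ofReal_norm, norm_S, ofReal_norm]
      _ ≤ 2⁻¹ * (2 * (A * D)) + D := by gcongr
      _ = (1 + A) * D := by
          rw [← mul_assoc, ENNReal.inv_mul_cancel (by simp) (by simp)]; ring
      _ ≤ _ := mul_le_mul' le_self_add le_rfl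
  · calc _ ≤ C * (V * (2 * (A * D))) := e1.trans (by gcongr)
      _ = (2 * C * A) * V * D := by ring
      _ ≤ _ := by gcongr; exact le_add_self

/-- Finite σ-norms are small on short intervals, so stability applies on each, with initial
difference 0, and the intervals chain. No smallness of the solutions themselves is assumed. -/
theorem IsMild.eqOn {q : ℝ} (hq : 1 ≤ q) (hD : Dispersive d q) {c : ℂ} {u₁ u₂ : ℝ → L2 d} {a b : ℝ}
    (h₁ : IsMild q c u₁ a b) (h₂ : IsMild q c u₂ a b) (h0 : u₁ a = u₂ a) : EqOn u₁ u₂ (Icc a b) := by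
  obtain ⟨C, hC, η, hη, hst⟩ := exists_stability hq hD c
  obtain ⟨δ₁, hδ₁, H₁⟩ := exists_delta_stNorm hq h₁.stNorm_ne_top hη
  obtain ⟨δ₂, hδ₂, H₂⟩ := exists_delta_stNorm hq h₂.stNorm_ne_top hη
  refine interval_chain (lt_min hδ₁ hδ₂) h0 fun s t hs hst' ht hd he => ?_
  have := (hst s t u₁ u₂ hst' (h₁.mono hq hs ht) (h₂.mono hq hs ht)
    (H₁ s t hs ht (hd.trans (min_le_left _ _))) (H₂ s t hs ht (hd.trans (min_le_right _ _)))).1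
  rw [he, sub_self, enorm_zero, mul_zero, nonpos_iff_eq_zero, enorm_eq_zero, sub_eq_zero] at this
  exact this

/-! ### Local existence -/

/-- Lower semicontinuity, since the norm is a supremum of functionals continuous on L². -/
lemma nrm_rpow_le_liminf {q : ℝ} (hq : 1 ≤ q) {f : ℕ → L2 d} {g : L2 d}
    (h : Tendsto f atTop (𝓝 g)) :
    nrm q g ^ (q + 2) ≤ liminf (fun n => nrm q (f n) ^ (q + 2)) atTop := by
  rw [nrm, eLpNorm'_rpow hq, ← iSup_truncInt hq]
  refine iSup_le fun k => ?_
  have h1 : Tendsto (fun n => truncInt q k (f n)) atTop (𝓝 (truncInt q k g)) := by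
    simp_rw [truncInt_eq hq]
    have hc : Continuous fun f : L2 d => inner ℂ (truncL2 hq k f) f :=
      (continuous_truncL2 hq k).inner continuous_id
    exact ((ENNReal.continuous_ofReal.comp (Complex.continuous_re.comp hc)).tendsto g).comp h
  rw [← h1.liminf_eq]
  refine liminf_le_liminf (Eventually.of_forall fun n => ?_)
  show truncInt q k (f n) ≤ nrm q (f n) ^ (q + 2)
  rw [nrm, eLpNorm'_rpow hq, ← iSup_truncInt hq]
  exact le_iSup (fun k => truncInt q k (f n)) k

lemma stNorm_le_of_tendsto {q : ℝ} (hq : 1 ≤ q) {f : ℕ → ℝ → L2 d} {g : ℝ → L2 d} {I : Set ℝ}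
    (hI : MeasurableSet I) (hf : ∀ n, Continuous (f n))
    (h : ∀ r ∈ I, Tendsto (fun n => f n r) atTop (𝓝 (g r))) {B : ℝ≥0∞}
    (hB : ∀ n, stNorm q (f n) I ≤ B) : stNorm q g I ≤ B := by
  have hq2 : 0 < q + 2 := by linarith
  have hB' : ∀ n, ∫⁻ r in I, nrm q (f n r) ^ (q + 2) ≤ B ^ (q + 2) := fun n => by
    have := hB n
    rwa [stNorm, one_div, ENNReal.rpow_inv_le_iff hq2] at this
  rw [stNorm, one_div, ENNReal.rpow_inv_le_iff hq2]
  calc _ ≤ ∫⁻ r in I, liminf (fun n => nrm q (f n r) ^ (q + 2)) atTop :=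
        setLIntegral_mono' hI fun r hr => nrm_rpow_le_liminf hq (h r hr)
    _ ≤ liminf (fun n => ∫⁻ r in I, nrm q (f n r) ^ (q + 2)) atTop :=
        lintegral_liminf_le fun n => (measurable_nrm hq (hf n)).pow_const _
    _ ≤ B ^ (q + 2) := by
        refine (liminf_le_liminf (Eventually.of_forall hB')).trans (le_of_eq ?_)
        simp

lemma stNorm_sub_le_geometric {q : ℝ} (hq : 1 ≤ q) {x : ℕ → ℝ → L2 d} (hx : ∀ n, Continuous (x n))
    {I : Set ℝ} {A : ℝ≥0∞} (h : ∀ n, stNorm q (fun r => x (n + 1) r - x n r) I ≤ A / 2 ^ n) (j : ℕ) :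
    ∀ n, stNorm q (fun r => x (n + j) r - x n r) I ≤ 2 * A / 2 ^ n := by
  induction j with
  | zero => intro n; simp [stNorm_zero hq]
  | succ j ih =>
    intro n
    have e : (fun r => x (n + (j + 1)) r - x n r) =
        fun r => (x (n + 1 + j) r - x (n + 1) r) + (x (n + 1) r - x n r) := by
      funext r; rw [sub_add_sub_cancel, add_right_comm, add_assoc]
    rw [e]
    refine (stNorm_add_le hq ((hx _).sub (hx _)) ((hx _).sub (hx _)) I).trans ?_
    refine (add_le_add (ih (n + 1)) (h n)).trans (le_of_eq ?_)
    have : 2 * A / 2 ^ (n + 1) = A / 2 ^ n := by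
      rw [pow_succ', ENNReal.mul_div_mul_left _ _ (by simp) (by simp)]
    rw [this, two_mul, ENNReal.add_div]

/-- Picard iteration in the ball of σ-norm η, started from the free evolution. Smallness is asked of
the free evolution of z₀ and not of z₀. Completeness of the ball in the σ-norm is avoided: the
iterates converge uniformly in L², and the σ-norm bounds pass to the limit by lower semicontinuity.
-/
theorem exists_local {q : ℝ} (hq : 1 ≤ q) (hD : Dispersive d q) (c : ℂ) :
    ∃ η : ℝ≥0∞, η ≠ 0 ∧ ∀ (a b : ℝ) (z₀ : L2 d), a ≤ b →
      stNorm q (fun r => S r z₀) (Icc a b) ≤ η → ∃ u : ℝ → L2 d, u a = S a z₀ ∧ IsMild q c u a b := by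
  obtain ⟨C, hC, hest⟩ := exists_duhamel_estimates hq hD c
  obtain ⟨η, hη0, hηt, hη⟩ := exists_small hq hC
  have h2 : (2 : ℝ≥0∞)⁻¹ ≤ 1 := by simp
  refine ⟨η / 2, ENNReal.div_ne_zero.2 ⟨hη0, by simp⟩, fun a b z₀ hab hz => ?_⟩
  set I := Icc a b with hI
  let T := {u : ℝ → L2 d // Continuous u ∧ u a = S a z₀ ∧ stNorm q u I ≤ η}
  have hT : ∀ u : T, stNorm q u.1 I ≠ ∞ := fun u => ne_top_of_le_ne_top hηt u.2.2.2
  have hsize : ∀ u₁ u₂ : T, C * diffSize q u₁.1 u₂.1 I ≤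
      2⁻¹ * stNorm q (fun r => u₁.1 r - u₂.1 r) I := by
    intro u₁ u₂
    rw [diffSize, ← mul_assoc]
    gcongr
    refine le_trans ?_ hη
    gcongr
    · exact u₁.2.2.2
    · exact u₂.2.2.2
  have hmap : ∀ u : T, ∃ v : T, Duhamel q c v.1 u.1 a b := by
    intro u
    obtain ⟨v, hvc, hva, hvD, -⟩ := exists_duhamel hq hD c hab u.2.1 (hT u) z₀
    refine ⟨⟨v, hvc, hva, ?_⟩, hvD⟩
    have h1 := (hest a b v (fun _ => 0) u.1 (fun _ => 0) hab u.2.1 continuous_const (hT u)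
      (by rw [stNorm_zero hq]; simp) hvD (Duhamel.zero q c a b)).2
    rw [diffSize_zero hq] at h1
    have hSz : ∀ t, S (t - a) (v a - 0) = S t z₀ := fun t => by
      rw [sub_zero, hva, ← S_add, sub_add_cancel]
    simp_rw [hSz, sub_zero] at h1
    calc stNorm q v I ≤ stNorm q (fun t => v t - S t z₀) I + stNorm q (fun t => S t z₀) I := by
          refine le_trans (le_of_eq ?_)
            (stNorm_add_le hq (hvc.sub (continuous_S z₀)) (continuous_S z₀) I)
          congr 1; funext t; exact (sub_add_cancel _ _).symm
      _ ≤ C * η ^ (q + 1) + η / 2 := by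
          gcongr
          refine h1.trans ?_
          gcongr
          exact u.2.2.2
      _ = C * η ^ q * η + η / 2 := by
          rw [ENNReal.rpow_add_of_nonneg _ _ (by linarith) zero_le_one, ENNReal.rpow_one, mul_assoc]
      _ ≤ 2⁻¹ * η + η / 2 := by
          gcongr
          refine le_trans ?_ hη
          gcongr
          exact le_self_add
      _ = η := by rw [mul_comm, ← div_eq_mul_inv, ENNReal.add_halves]
  choose F hF using hmap
  let x0 : T := ⟨fun r => S r z₀, continuous_S z₀, rfl, hz.trans ENNReal.half_le_self⟩
  let x : ℕ → T := fun n => F^[n] x0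
  have hxs : ∀ n, x (n + 1) = F (x n) := fun n => Function.iterate_succ_apply' F n x0
  have hstep : ∀ u₁ u₂ : T,
      stNorm q (fun r => (F u₁).1 r - (F u₂).1 r) I ≤ 2⁻¹ * stNorm q (fun r => u₁.1 r - u₂.1 r) I ∧
      ∀ t ∈ I, ‖(F u₁).1 t - (F u₂).1 t‖ₑ ≤ 2⁻¹ * stNorm q (fun r => u₁.1 r - u₂.1 r) I := by
    intro u₁ u₂
    have h0 : (F u₁).1 a - (F u₂).1 a = 0 := by rw [(F u₁).2.2.1, (F u₂).2.2.1, sub_self]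
    constructor
    · have h1 := (hest a b _ _ u₁.1 u₂.1 hab u₁.2.1 u₂.2.1 (hT u₁) (hT u₂) (hF u₁) (hF u₂)).2
      simp_rw [h0, map_zero, sub_zero] at h1
      exact h1.trans (hsize u₁ u₂)
    · intro t ht
      have hsub : Icc a t ⊆ I := Icc_subset_Icc_right ht.2
      have h1 := (hest a t _ _ u₁.1 u₂.1 ht.1 u₁.2.1 u₂.2.1
        (ne_top_of_le_ne_top (hT u₁) (stNorm_mono hq _ hsub))
        (ne_top_of_le_ne_top (hT u₂) (stNorm_mono hq _ hsub))
        ((hF u₁).mono le_rfl ht.2) ((hF u₂).mono le_rfl ht.2)).1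
      rw [h0, map_zero, sub_zero, ← ofReal_norm, norm_S, ofReal_norm] at h1
      refine h1.trans (le_trans ?_ (hsize u₁ u₂))
      unfold diffSize
      gcongr
      all_goals exact stNorm_mono hq _ hsub
  set A : ℝ≥0∞ := stNorm q (fun r => (x 1).1 r - (x 0).1 r) I with hA
  have hAt : A ≠ ∞ := by
    exact ne_top_of_le_ne_top (ENNReal.add_ne_top.2 ⟨hT _, hT _⟩)
      (stNorm_sub_le hq (x 1).2.1 (x 0).2.1 _)
  have hW : ∀ n, stNorm q (fun r => (x (n + 1)).1 r - (x n).1 r) I ≤ A / 2 ^ n := by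
    intro n
    induction n with
    | zero => simp [hA]
    | succ n ih =>
      have h1 := (hstep (x (n + 1)) (x n)).1
      rw [← hxs, ← hxs] at h1
      refine h1.trans ((mul_le_mul' le_rfl ih).trans (le_of_eq ?_))
      rw [div_eq_mul_inv, div_eq_mul_inv, pow_succ, ENNReal.mul_inv (by simp) (by simp)]
      ring
  -- The index is shifted by one because the L² distance of two images is controlled by the
  -- σ-distance of their sources.
  have hN : ∀ t ∈ I, ∀ n, edist ((x (n + 1)).1 t) ((x (n + 1 + 1)).1 t) ≤ A / 2 ^ n := by
    intro t ht n
    have h1 := (hstep (x (n + 1)) (x n)).2 t ht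
    rw [← hxs, ← hxs] at h1
    rw [edist_comm, edist_eq_enorm_sub]
    refine h1.trans (((mul_le_mul' le_rfl (hW n)).trans (mul_le_mul' h2 le_rfl)).trans (le_of_eq (one_mul _)))
  have hp : ∀ t, (projIcc a b hab t : ℝ) ∈ I := fun t => (projIcc a b hab t).2
  have hlim : ∀ t, ∃ y, Tendsto (fun n => (x (n + 1)).1 (projIcc a b hab t)) atTop (𝓝 y) := fun t =>
    cauchySeq_tendsto_of_complete (cauchySeq_of_edist_le_geometric_two A hAt (hN _ (hp t)))
  choose u hu using hlim
  have huI : ∀ t ∈ I, Tendsto (fun n => (x (n + 1)).1 t) atTop (𝓝 (u t)) := fun t ht => by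
    have := hu t
    rwa [projIcc_of_mem hab ht] at this
  have hpow : Tendsto (fun n : ℕ => 2 * A / 2 ^ n) atTop (𝓝 0) := by
    have h5 : Tendsto (fun n : ℕ => 2 * A * (2⁻¹ : ℝ≥0∞) ^ n) atTop (𝓝 (2 * A * 0)) :=
      ENNReal.Tendsto.const_mul (ENNReal.tendsto_pow_atTop_nhds_zero_of_lt_one (by simp))
        (Or.inr (by finiteness))
    rw [mul_zero] at h5
    refine h5.congr fun n => ?_
    rw [div_eq_mul_inv, ENNReal.inv_pow]
  have huc : Continuous u := by
    have hun : TendstoUniformly (fun n t => (x (n + 1)).1 (projIcc a b hab t)) u atTop := by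
      rw [EMetric.tendstoUniformly_iff]
      intro ε hε
      filter_upwards [(tendsto_order.1 hpow).2 ε hε] with n hn t
      rw [edist_comm]
      exact (edist_le_of_edist_le_geometric_two_of_tendsto A (hN _ (hp t)) (hu t) n).trans_lt hn
    refine hun.continuous (Eventually.of_forall fun n => ?_).frequently
    exact (x (n + 1)).2.1.comp (continuous_subtype_val.comp continuous_projIcc)
  have hua : u a = S a z₀ := by
    refine tendsto_nhds_unique (huI a ⟨le_rfl, hab⟩) ?_
    simp_rw [fun n => (x (n + 1)).2.2.1]
    exact tendsto_const_nhds
  have hun : stNorm q u I ≤ η :=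
    stNorm_le_of_tendsto hq measurableSet_Icc (fun n => (x (n + 1)).2.1) huI fun n => (x (n + 1)).2.2.2
  let U : T := ⟨u, huc, hua, hun⟩
  have hUx : ∀ n, stNorm q (fun r => u r - (x (n + 1)).1 r) I ≤ 2 * A / 2 ^ n := by
    intro n
    refine stNorm_le_of_tendsto hq (f := fun j r => (x (n + 1 + j)).1 r - (x (n + 1)).1 r)
      measurableSet_Icc (fun j => (x _).2.1.sub (x _).2.1) (fun r hr => ?_) (fun j => ?_)
    · refine Tendsto.sub ?_ tendsto_const_nhds
      have := (huI r hr).comp (tendsto_add_atTop_nat n)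
      refine this.congr fun j => ?_
      simp only [Function.comp_apply]
      rw [show j + n + 1 = n + 1 + j by ring]
    · have h6 := stNorm_sub_le_geometric hq (x := fun m => (x (m + 1)).1) (I := I) (A := A)
        (fun m => (x _).2.1) (fun m => ?_) j n
      · simpa only [add_right_comm] using h6
      · refine (hW (m + 1)).trans ?_
        gcongr
        · exact one_le_two
        · omega
  -- `F U` and `u` are both limits of the iterates, the first because `F` maps σ-convergence to L²
  -- convergence.
  have hfix : EqOn (F U).1 u I := by
    intro t ht
    refine tendsto_nhds_unique (f := fun n => (x (n + 1 + 1)).1 t) ?_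
      ((huI t ht).comp (tendsto_add_atTop_nat 1))
    rw [tendsto_iff_edist_tendsto_0]
    refine tendsto_of_tendsto_of_tendsto_of_le_of_le tendsto_const_nhds hpow (fun _ => zero_le) fun n => ?_
    have h1 := (hstep U (x (n + 1))).2 t ht
    rw [← hxs] at h1
    rw [edist_comm, edist_eq_enorm_sub]
    exact h1.trans (((mul_le_mul' le_rfl (hUx n)).trans (mul_le_mul' h2 le_rfl)).trans (le_of_eq (one_mul _)))
  exact ⟨u, hua, huc, hT U, (hF U).congr hfix fun _ _ => rfl⟩

/-! ### Functions whose increments are controlled by a small multiple of a measure -/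

/-- Replaces the argument that a vanishing derivative forces constancy. Increments at most ε∫f on
short intervals add up to at most ε∫f over the whole interval, and ε is arbitrary. -/
lemma eq_of_increments_le {E : Type*} [NormedAddCommGroup E] {H : ℝ → E} {f : ℝ → ℝ≥0∞} {a b : ℝ}
    (hab : a ≤ b) (hf : ∫⁻ r in Ioc a b, f r ≠ ∞)
    (h : ∀ ε : ℝ≥0∞, ε ≠ 0 → ε ≠ ∞ → ∃ δ : ℝ, 0 < δ ∧ ∀ s t, a ≤ s → s ≤ t → t ≤ b → t - s ≤ δ →
      ‖H t - H s‖ₑ ≤ ε * ∫⁻ r in Ioc s t, f r) : H b = H a := by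
  have key : ∀ ε : ℝ≥0∞, ε ≠ 0 → ε ≠ ∞ → ‖H b - H a‖ₑ ≤ ε * ∫⁻ r in Ioc a b, f r := by
    intro ε h0 ht
    obtain ⟨δ, hδ, hst⟩ := h ε h0 ht
    refine interval_chain (P := fun t => ‖H t - H a‖ₑ ≤ ε * ∫⁻ r in Ioc a t, f r) hδ (by simp)
      (fun s t hs hle ht hd hP => ?_) b ⟨hab, le_rfl⟩
    rw [← Ioc_union_Ioc_eq_Ioc hs hle, lintegral_union measurableSet_Ioc (by
      simp [disjoint_left]; intro x _ h1 h2; linarith), mul_add]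
    calc ‖H t - H a‖ₑ = ‖(H s - H a) + (H t - H s)‖ₑ := by congr 1; abel
      _ ≤ _ := (enorm_add_le _ _).trans (add_le_add hP (hst s t hs hle ht hd))
  have hlim : Tendsto (fun n : ℕ => ((n + 1 : ℕ) : ℝ≥0∞)⁻¹ * ∫⁻ r in Ioc a b, f r) atTop (𝓝 0) := by
    have := ENNReal.Tendsto.mul_const (b := ∫⁻ r in Ioc a b, f r)
      (ENNReal.tendsto_inv_nat_nhds_zero.comp (tendsto_add_atTop_nat 1)) (Or.inr hf)
    rwa [zero_mul] at this
  have := ge_of_tendsto' hlim fun n => key _ (by simp) (by simp)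
  rwa [nonpos_iff_eq_zero, enorm_eq_zero, sub_eq_zero] at this

lemma exists_rpow_small {C : ℝ≥0∞} (hC : C ≠ ∞) {p : ℝ} (hp : 0 < p) {ε : ℝ≥0∞} (hε : ε ≠ 0) :
    ∃ ε' : ℝ≥0∞, ε' ≠ 0 ∧ ε' ≠ ∞ ∧ C * ε' ^ p ≤ ε := by
  have h0 : ε / (C + 1) ≠ 0 := ENNReal.div_ne_zero.2 ⟨hε, by finiteness⟩
  have ht : min (ε / (C + 1)) 1 ≠ ∞ := ne_top_of_le_ne_top ENNReal.one_ne_top (min_le_right _ _)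
  have h2 : min (ε / (C + 1)) 1 ≠ 0 := by
    rcases min_choice (ε / (C + 1)) 1 with h | h <;> rw [h]
    · exact h0
    · exact one_ne_zero
  refine ⟨(min (ε / (C + 1)) 1) ^ (1 / p), (ENNReal.rpow_pos (pos_iff_ne_zero.2 h2) ht).ne',
    ENNReal.rpow_ne_top_of_nonneg (by positivity) ht, ?_⟩
  rw [← ENNReal.rpow_mul, one_div_mul_cancel hp.ne', ENNReal.rpow_one]
  calc C * min (ε / (C + 1)) 1 ≤ (C + 1) * (ε / (C + 1)) := by
        gcongr
        · exact le_self_add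
        · exact min_le_left _ _
    _ ≤ ε := ENNReal.mul_div_le

/-! ### The mass -/

lemma pairing_self {q : ℝ} (hq : 1 ≤ q) (f : L2 d) :
    pairing q f f = (((nrm q f ^ (q + 2)).toReal : ℝ) : ℂ) := by
  have hfm := L2.measurable f
  rw [nrm, eLpNorm'_rpow hq, pairing]
  have h1 : ∀ x, inner ℂ (f x) (powN q (f x)) = ((‖f x‖ ^ (q + 2) : ℝ) : ℂ) := fun x => by
    rw [RCLike.inner_apply, powN, mul_assoc, Complex.mul_conj, Complex.normSq_eq_norm_sq,
      ← Complex.ofReal_mul, Real.rpow_add_of_nonneg (norm_nonneg _) (by linarith) (by norm_num)]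
    norm_num
  simp_rw [h1]
  rw [integral_complex_ofReal, integral_eq_lintegral_of_nonneg_ae
    (Eventually.of_forall fun x => by positivity) (hfm.norm.pow_const _).aestronglyMeasurable]
  congr 2
  refine lintegral_congr fun x => ?_
  rw [← ofReal_norm, ENNReal.ofReal_rpow_of_nonneg (norm_nonneg _) (by linarith)]

lemma intervalIntegrable_nrm {q : ℝ} (hq : 1 ≤ q) {u : ℝ → L2 d} (hu : Continuous u) {a b : ℝ}
    (hab : a ≤ b) (h : stNorm q u (Icc a b) ≠ ∞) :
    IntervalIntegrable (fun r => (nrm q (u r) ^ (q + 2)).toReal) volume a b := by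
  rw [intervalIntegrable_iff_integrableOn_Ioc_of_le hab]
  refine integrable_toReal_of_lintegral_ne_top ((measurable_nrm hq hu).pow_const _).aemeasurable ?_
  exact ne_top_of_le_ne_top (lintegral_ne_top_of_stNorm hq h) (lintegral_mono_set Ioc_subset_Icc_self)

/-- Mild solutions are not differentiated. With z_t = S(-t)u(t), expand ‖z_t‖² about z_s. The linear
term is 2 Re of c times the integral of the pairing of S(r)z_s with u(r); replacing S(r)z_s by u(r)
gives the main term, with an error of σ-norm O(U^{q+1}), where U is the σ-norm of u on [s, t]. This
error and the quadratic term are both O(U^{2q+2}) = U^q · O(U^{q+2}). Since U^{q+2} is an additive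
integral and U^q is small on short intervals, `eq_of_increments_le` applies. -/
theorem IsMild.mass {q : ℝ} (hq : 1 ≤ q) (hD : Dispersive d q) {c : ℂ} {u : ℝ → L2 d} {a b : ℝ}
    (hab : a ≤ b) (h : IsMild q c u a b) :
    ‖u b‖ ^ 2 - 2 * c.re * ∫ r in a..b, (nrm q (u r) ^ (q + 2)).toReal = ‖u a‖ ^ 2 := by
  obtain ⟨C, hC, hest⟩ := exists_duhamel_bounds hq hD c
  set g : ℝ → ℝ := fun r => (nrm q (u r) ^ (q + 2)).toReal with hg
  set H : ℝ → ℝ := fun t => ‖u t‖ ^ 2 - 2 * c.re * ∫ r in a..t, g r with hH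
  suffices H b = H a by simpa [hH] using this
  have hfin := lintegral_ne_top_of_stNorm hq h.stNorm_ne_top
  refine eq_of_increments_le (f := fun r => nrm q (u r) ^ (q + 2)) hab
    (ne_top_of_le_ne_top hfin (lintegral_mono_set Ioc_subset_Icc_self)) fun ε hε _ => ?_
  obtain ⟨ε', hε', -, hε2⟩ := exists_rpow_small (C := 2 * ‖c‖ₑ * C + C ^ 2) (by finiteness)
    (show 0 < q by linarith) hε
  obtain ⟨δ, hδ, hsm⟩ := exists_delta_stNorm hq h.stNorm_ne_top hε'
  refine ⟨δ, hδ, fun s t hs hst ht hd => ?_⟩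
  have hm := h.mono hq hs ht
  have hsmall := hsm s t hs ht hd
  set U := stNorm q u (Icc s t) with hU
  obtain ⟨e1, e2⟩ := hest s t u u hst h.continuous hm.stNorm_ne_top hm.duhamel
  set zs := S (-s) (u s) with hzs
  set zt := S (-t) (u t) with hzt
  set w : ℝ → L2 d := fun r => S r zs - u r with hw
  have hwc : Continuous w := (continuous_S zs).sub h.continuous
  have hSz : ∀ r, S (r - s) (u s) = S r zs := fun r => by rw [hzs, ← S_add, sub_eq_add_neg]
  have hwn : stNorm q w (Icc s t) ≤ C * U ^ (q + 1) := by
    rw [hw, stNorm_sub_comm]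
    simpa only [hSz] using e2
  have hint1 := intervalIntegrable_nrm hq h.continuous hst hm.stNorm_ne_top
  have hsplit : ∫ r in s..t, pairing q (S r zs) (u r) =
      (∫ r in s..t, pairing q (w r) (u r)) + ((∫ r in s..t, g r : ℝ) : ℂ) := by
    rw [← intervalIntegral.integral_ofReal, ← intervalIntegral.integral_add]
    · rw [intervalIntegral.integral_of_le hst, intervalIntegral.integral_of_le hst]
      refine integral_congr_ae ?_
      have hmm : volume.restrict (Ioc s t) ≤ volume.restrict (Icc s t) :=
        Measure.restrict_mono Ioc_subset_Icc_self le_rfl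
      filter_upwards [ae_mono hmm (ae_nrm_ne_top hq h.continuous hm.stNorm_ne_top),
        ae_mono hmm (ae_nrm_ne_top hq (continuous_S zs) (stNorm_S_ne_top hq hD zs _))] with r h1 h2
      rw [hg, ← pairing_self hq, ← pairing_add hq
        (ne_top_of_le_ne_top (ENNReal.add_ne_top.2 ⟨h2, h1⟩) (nrm_sub_le hq _ _)) h1 h1,
        sub_add_cancel]
    · rw [intervalIntegrable_iff_integrableOn_Ioc_of_le hst]
      exact (integrableOn_pairing hq hwc h.continuous
        (ne_top_of_le_ne_top (by have := hm.stNorm_ne_top; finiteness [ENNReal.rpow_ne_top_of_nonneg (by linarith : 0 ≤ q + 1) this]) hwn) hm.stNorm_ne_top).mono_set Ioc_subset_Icc_self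
    · exact ⟨hint1.1.ofReal, hint1.2.ofReal⟩
  have hHH : H t - H s = 2 * (c * ∫ r in s..t, pairing q (w r) (u r)).re + ‖zt - zs‖ ^ 2 := by
    have h1 : ‖u t‖ ^ 2 = ‖u s‖ ^ 2 + 2 * (inner ℂ zs (zt - zs)).re + ‖zt - zs‖ ^ 2 := by
      have := norm_add_sq (𝕜 := ℂ) zs (zt - zs)
      rw [add_sub_cancel, hzt, hzs, norm_S, norm_S] at this
      exact this
    have h2 : inner ℂ zs (zt - zs) = c * ∫ r in s..t, pairing q (S r zs) (u r) :=
      h.duhamel s t hs hst ht zs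
    have h3 : (∫ r in a..t, g r) - ∫ r in a..s, g r = ∫ r in s..t, g r :=
      intervalIntegral.integral_interval_sub_left
        (intervalIntegrable_nrm hq h.continuous (hs.trans hst) (h.mono hq le_rfl ht).stNorm_ne_top)
        (intervalIntegrable_nrm hq h.continuous hs (h.mono hq le_rfl (hst.trans ht)).stNorm_ne_top)
    rw [h2, hsplit, mul_add, Complex.add_re, Complex.re_mul_ofReal] at h1
    simp only [hH]
    rw [h1, ← h3]; ring
  have hUX : U ^ (q + 2) = ∫⁻ r in Ioc s t, nrm q (u r) ^ (q + 2) := by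
    rw [hU, stNorm, ← ENNReal.rpow_mul, one_div_mul_cancel (by linarith), ENNReal.rpow_one]
    exact setLIntegral_congr Ioc_ae_eq_Icc.symm
  calc ‖H t - H s‖ₑ ≤ 2 * (‖c‖ₑ * (C * U ^ (q + 1) * U ^ (q + 1))) + (C * U ^ (q + 1)) ^ 2 := by
        rw [hHH]
        refine (enorm_add_le _ _).trans (add_le_add ?_ ?_)
        · rw [enorm_mul]
          have h4 : ‖(c * ∫ r in s..t, pairing q (w r) (u r)).re‖ₑ ≤
              ‖c * ∫ r in s..t, pairing q (w r) (u r)‖ₑ := by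
            rw [← ofReal_norm, ← ofReal_norm]
            exact ENNReal.ofReal_le_ofReal (Complex.abs_re_le_norm _)
          have h5 : ‖(2 : ℝ)‖ₑ = 2 := by rw [← ofReal_norm]; simp
          rw [h5]
          refine mul_le_mul' le_rfl (h4.trans ?_)
          rw [enorm_mul]
          refine mul_le_mul' le_rfl ((enorm_integral_pairing_le hq hwc h.continuous hst).trans ?_)
          exact mul_le_mul' hwn le_rfl
        · rw [enorm_pow, enorm_norm]
          exact pow_le_pow_left' e1 2
    _ = (2 * ‖c‖ₑ * C + C ^ 2) * U ^ q * U ^ (q + 2) := by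
        have h6 : U ^ (q + 1) * U ^ (q + 1) = U ^ q * U ^ (q + 2) := by
          rw [← ENNReal.rpow_add_of_nonneg _ _ (by linarith) (by linarith),
            ← ENNReal.rpow_add_of_nonneg _ _ (by linarith) (by linarith)]
          congr 1; ring
        rw [mul_assoc (_ + _), ← h6]; ring
    _ ≤ ε * ∫⁻ r in Ioc s t, nrm q (u r) ^ (q + 2) := by
        rw [← hUX]
        gcongr
        refine le_trans ?_ hε2
        gcongr

/-- The mass lost cannot exceed the initial mass. This is where the sign of the damping enters; the
bound is independent of the length of the interval. -/
theorem IsMild.lintegral_le {q : ℝ} (hq : 1 ≤ q) (hD : Dispersive d q) {c : ℂ} (hc : c.re < 0)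
    {u : ℝ → L2 d} {a b : ℝ} (hab : a ≤ b) (h : IsMild q c u a b) :
    ∫⁻ r in Icc a b, nrm q (u r) ^ (q + 2) ≤ ENNReal.ofReal (‖u a‖ ^ 2 / (2 * -c.re)) := by
  have h1 := h.mass hq hD hab
  have hfin := lintegral_ne_top_of_stNorm hq h.stNorm_ne_top
  have h2 : ∫ r in a..b, (nrm q (u r) ^ (q + 2)).toReal =
      (∫⁻ r in Icc a b, nrm q (u r) ^ (q + 2)).toReal := by
    have hm := (measurable_nrm hq h.continuous).pow_const (q + 2)
    rw [intervalIntegral.integral_of_le hab, ← setLIntegral_congr Ioc_ae_eq_Icc, integral_toReal hm.aemeasurable]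
    refine ae_lt_top hm ?_
    exact ne_top_of_le_ne_top hfin (lintegral_mono_set Ioc_subset_Icc_self)
  rw [h2] at h1
  rw [← ENNReal.ofReal_toReal hfin]
  refine ENNReal.ofReal_le_ofReal ?_
  rw [le_div_iff₀ (by linarith)]
  nlinarith [sq_nonneg ‖u b‖]

/-! ### Global existence -/

lemma IsMild.glue {q : ℝ} (hq : 1 ≤ q) (hD : Dispersive d q) {c : ℂ} {u v : ℝ → L2 d} {a s b : ℝ}
    (has : a ≤ s) (hsb : s ≤ b) (hu : IsMild q c u a s) (hv : IsMild q c v s b) (h : u s = v s) :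
    ∃ w : ℝ → L2 d, IsMild q c w a b ∧ EqOn w u (Icc a s) := by
  set w : ℝ → L2 d := fun t => if t ≤ s then u t else v t with hw
  have hwu : EqOn u w (Icc a s) := fun t ht => by simp [hw, ht.2]
  have hwv : EqOn v w (Icc s b) := fun t ht => by
    rcases ht.1.eq_or_lt with h1 | h1
    · simp [hw, ← h1, h]
    · simp [hw, h1.not_ge]
  have hwc : Continuous w := hu.continuous.if_le hv.continuous continuous_id continuous_const
    fun x hx => by
      have hx : x = s := hx
      rw [hx, h]
  have hfin : stNorm q w (Icc a b) ≠ ∞ := by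
    unfold stNorm
    refine ENNReal.rpow_ne_top_of_nonneg (by positivity) ?_
    rw [← Icc_union_Icc_eq_Icc has hsb]
    refine ne_top_of_le_ne_top ?_ (lintegral_union_le _ _ _)
    refine ENNReal.add_ne_top.2 ⟨?_, ?_⟩
    · refine lintegral_ne_top_of_stNorm hq ?_
      rw [← stNorm_congr measurableSet_Icc hwu]; exact hu.stNorm_ne_top
    · refine lintegral_ne_top_of_stNorm hq ?_
      rw [← stNorm_congr measurableSet_Icc hwv]; exact hv.stNorm_ne_top
  have h1 : Duhamel q c w w a s := hu.duhamel.congr hwu hwu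
  have h2 : Duhamel q c w w s b := hv.duhamel.congr hwv hwv
  refine ⟨w, ⟨hwc, hfin, fun r t hr hrt ht ψ => ?_⟩, fun t ht => (hwu ht).symm⟩
  rcases le_total t s with hts | hst
  · exact h1 r t hr hrt hts ψ
  rcases le_total s r with hsr | hrs
  · exact h2 r t hsr hrt ht ψ
  · have e1 := h1 r s hr hrs le_rfl ψ
    have e2 := h2 s t le_rfl hst ht ψ
    rw [← intervalIntegral.integral_add_adjacent_intervals
      (intervalIntegrable_pairing hq hD hwc hfin ψ hr hrs hsb)
      (intervalIntegrable_pairing hq hD hwc hfin ψ has hst ht), mul_add, ← e1, ← e2, ← inner_add_right]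
    congr 1; abel

/-- Suppose the existence times have a finite supremum T, approached by β n. The mass bound makes
the σ-norm converge, so its tails vanish and z n = S(-β n)u(β n) is Cauchy with some limit L. The
free evolution of L has small σ-norm near T, hence so has that of z n on [β n, T + h] for large n,
and the local theorem restarts the solution at β n and carries it past T. -/
theorem exists_mild {q : ℝ} (hq : 1 ≤ q) (hD : Dispersive d q) {c : ℂ} (hc : c.re < 0) (u₀ : L2 d) :
    ∀ b : ℝ, 0 ≤ b → ∃ u : ℝ → L2 d, u 0 = u₀ ∧ IsMild q c u 0 b := by
  obtain ⟨C, hC, hest⟩ := exists_duhamel_bounds hq hD c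
  obtain ⟨A, hA, hstr⟩ := strichartz hq hD
  obtain ⟨η, hη, hloc⟩ := exists_local (d := d) hq hD c
  set B : Set ℝ := {b | 0 ≤ b ∧ ∃ u : ℝ → L2 d, u 0 = u₀ ∧ IsMild q c u 0 b} with hB
  have hdown : ∀ b ∈ B, ∀ b', 0 ≤ b' → b' ≤ b → b' ∈ B := fun b hb b' h0 hle =>
    ⟨h0, hb.2.imp fun u hu => ⟨hu.1, hu.2.mono hq le_rfl hle⟩⟩
  have h0 : (0 : ℝ) ∈ B := by
    refine ⟨le_rfl, fun _ => u₀, rfl, continuous_const, ?_, fun s t h1 h2 h3 ψ => ?_⟩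
    · simp only [stNorm, Icc_self, Measure.restrict_singleton, Real.volume_singleton, zero_smul,
        lintegral_zero_measure]
      exact ENNReal.rpow_ne_top_of_nonneg (by positivity) ENNReal.zero_ne_top
    · have hs : s = 0 := le_antisymm (h2.trans h3) h1
      have ht : t = 0 := le_antisymm h3 (h1.trans h2)
      simp [hs, ht]
  by_contra! hcon
  obtain ⟨b₁, hb₁, hno⟩ := hcon
  have hbdd : BddAbove B := ⟨b₁, fun b hb => by
    by_contra! hlt
    obtain ⟨-, u, hu0, hu⟩ := hdown b hb b₁ hb₁ hlt.le
    exact hno u hu0 hu⟩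
  obtain ⟨β, hβm, hβt, hβ⟩ := exists_seq_tendsto_sSup ⟨0, h0⟩ hbdd
  set T := sSup B with hT
  choose hβ0 u hu0 hu using hβ
  have hagree : ∀ n m, n ≤ m → EqOn (u n) (u m) (Icc 0 (β n)) := fun n m hnm =>
    (hu n).eqOn hq hD ((hu m).mono hq le_rfl (hβm hnm)) (by rw [hu0, hu0])
  have hq2 : 0 < q + 2 := by linarith
  set X : ℕ → ℝ≥0∞ := fun n => ∫⁻ r in Icc 0 (β n), nrm q (u n r) ^ (q + 2) with hX
  set M := ENNReal.ofReal (‖u₀‖ ^ 2 / (2 * -c.re)) with hM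
  have hXM : ∀ n, X n ≤ M := fun n => by
    have := (hu n).lintegral_le hq hD hc (hβ0 n)
    rwa [hu0] at this
  have hXt : ∀ n, X n ≠ ∞ := fun n => ne_top_of_le_ne_top ENNReal.ofReal_ne_top (hXM n)
  have hXadd : ∀ n m, n ≤ m → X n + stNorm q (u m) (Icc (β n) (β m)) ^ (q + 2) = X m := by
    intro n m hnm
    have e1 : X n = ∫⁻ r in Icc 0 (β n), nrm q (u m r) ^ (q + 2) :=
      setLIntegral_congr_fun measurableSet_Icc fun r hr => by
        simp only [hagree n m hnm hr]
    rw [e1, stNorm, ← ENNReal.rpow_mul, one_div_mul_cancel hq2.ne', ENNReal.rpow_one,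
      ← setLIntegral_congr (Ioc_ae_eq_Icc (a := β n)), ← lintegral_union measurableSet_Ioc,
      Icc_union_Ioc_eq_Icc (hβ0 n) (hβm hnm)]
    rw [disjoint_left]
    intro x h1 h2
    exact absurd h1.2 (not_le.2 h2.1)
  set x : ℕ → ℝ := fun n => (X n).toReal with hx
  have hxc : CauchySeq x := by
    have hmono : Monotone x := fun n m hnm => by
      refine ENNReal.toReal_mono (hXt m) ?_
      rw [← hXadd n m hnm]; exact le_self_add
    refine (tendsto_atTop_ciSup hmono ⟨M.toReal, ?_⟩).cauchySeq
    rintro _ ⟨n, rfl⟩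
    exact ENNReal.toReal_mono ENNReal.ofReal_ne_top (hXM n)
  set z : ℕ → L2 d := fun n => S (-β n) (u n (β n)) with hz
  have hzc : CauchySeq z := by
    rw [EMetric.cauchySeq_iff']
    intro ε hε
    obtain ⟨ε₁, hε₁, hε₁lt⟩ := exists_between hε
    obtain ⟨ε', hε', hεt, hle⟩ := exists_rpow_small hC (show 0 < q + 1 by linarith) hε₁.ne'
    have hpos : 0 < (ε' ^ (q + 2)).toReal :=
      ENNReal.toReal_pos (ENNReal.rpow_pos (pos_iff_ne_zero.2 hε') hεt).ne'
        (ENNReal.rpow_ne_top_of_nonneg hq2.le hεt)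
    obtain ⟨N, hN⟩ := Metric.cauchySeq_iff'.1 hxc _ hpos
    refine ⟨N, fun n hn => lt_of_le_of_lt ?_ hε₁lt⟩
    rw [edist_eq_enorm_sub]
    have h1 := (hest (β N) (β n) (u n) (u n) (hβm hn) (hu n).continuous
      ((hu n).mono hq (hβ0 N) le_rfl).stNorm_ne_top ((hu n).mono hq (hβ0 N) le_rfl).duhamel).1
    have h2 : u n (β N) = u N (β N) := (hagree N n hn ⟨hβ0 N, le_rfl⟩).symm
    rw [h2] at h1
    refine h1.trans (le_trans ?_ hle)
    gcongr
    have h3 := hXadd N n hn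
    have h4 : stNorm q (u n) (Icc (β N) (β n)) ^ (q + 2) ≤ ε' ^ (q + 2) := by
      have ht : stNorm q (u n) (Icc (β N) (β n)) ^ (q + 2) ≠ ∞ :=
        ne_top_of_le_ne_top (hXt n) (by rw [← h3]; exact le_add_self)
      have h5 := hN n hn
      rw [Real.dist_eq, hx] at h5
      simp only at h5
      rw [← h3, ENNReal.toReal_add (hXt N) ht, add_sub_cancel_left,
        abs_of_nonneg ENNReal.toReal_nonneg] at h5
      exact (ENNReal.toReal_le_toReal ht (ENNReal.rpow_ne_top_of_nonneg hq2.le hεt)).1 h5.le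
    exact (ENNReal.rpow_le_rpow_iff hq2).1 h4
  obtain ⟨L, hL⟩ := cauchySeq_tendsto_of_complete hzc
  have hη2 : η / 2 ≠ 0 := ENNReal.div_ne_zero.2 ⟨hη, by simp⟩
  obtain ⟨δ, hδ, hsm⟩ := exists_delta_stNorm (a := T - 1) (b := T + 1) hq
    (stNorm_S_ne_top hq hD L _) hη2
  -- Then `[T - h, T + h]` has length at most `δ` and lies in `[T - 1, T + 1]`, where `δ` controls
  -- the free evolution of `L`.
  set h := min (δ / 2) 1 with hh
  have hh0 : 0 < h := lt_min (by linarith) one_pos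
  obtain ⟨n, hn1, hn2⟩ : ∃ n, T - h ≤ β n ∧ A * ‖z n - L‖ₑ ≤ η / 2 := by
    have e1 : ∀ᶠ n in atTop, T - h ≤ β n := hβt.eventually_const_le (by linarith)
    have e2 : Tendsto (fun n => A * ‖z n - L‖ₑ) atTop (𝓝 (A * 0)) := by
      refine ENNReal.Tendsto.const_mul ?_ (Or.inr hA)
      have := tendsto_iff_edist_tendsto_0.1 hL
      simpa only [edist_eq_enorm_sub] using this
    rw [mul_zero] at e2
    have e3 := e2.eventually_le_const (pos_iff_ne_zero.2 hη2)
    exact (e1.and e3).exists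
  have hβT : β n ≤ T := le_csSup hbdd ⟨hβ0 n, u n, hu0 n, hu n⟩
  have hsmall : stNorm q (fun r => S r (z n)) (Icc (β n) (T + h)) ≤ η := by
    have e1 : stNorm q (fun r => S r (z n)) (Icc (β n) (T + h)) ≤
        stNorm q (fun r => S r (z n - L)) (Icc (β n) (T + h)) +
        stNorm q (fun r => S r L) (Icc (β n) (T + h)) := by
      refine le_trans (le_of_eq ?_) (stNorm_add_le hq (continuous_S _) (continuous_S _) _)
      simp_rw [← map_add, sub_add_cancel]
    refine e1.trans ?_
    rw [← ENNReal.add_halves η]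
    refine add_le_add (le_trans ?_ hn2) ?_
    · refine le_trans ?_ (hstr _)
      unfold stNorm
      gcongr; exact Measure.restrict_le_self
    · have := min_le_left (δ / 2) 1
      have := min_le_right (δ / 2) 1
      exact hsm _ _ (by linarith) (by linarith) (by linarith)
  obtain ⟨v, hva, hv⟩ := hloc (β n) (T + h) (z n) (by linarith) hsmall
  obtain ⟨w, hw, hwu⟩ := (hu n).glue hq hD (hβ0 n) (by linarith) hv (by
    rw [hva, hz, S_S_neg])
  have hmem : T + h ∈ B := ⟨by linarith [hβ0 n], w, by rw [hwu ⟨le_rfl, hβ0 n⟩, hu0], hw⟩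
  linarith [le_csSup hbdd hmem]

theorem exists_global_mild {q : ℝ} (hq : 1 ≤ q) (hD : Dispersive d q) {c : ℂ} (hc : c.re < 0)
    (u₀ : L2 d) : ∃ u : ℝ → L2 d, u 0 = u₀ ∧ ∀ b, 0 ≤ b → IsMild q c u 0 b := by
  choose! u hu0 hu using exists_mild hq hD hc u₀
  have hagree : ∀ b b', 0 ≤ b → b ≤ b' → EqOn (u b) (u b') (Icc 0 b) := fun b b' h0 hle =>
    (hu b h0).eqOn hq hD ((hu b' (h0.trans hle)).mono hq le_rfl hle) (by
      rw [hu0 b h0, hu0 b' (h0.trans hle)])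
  -- Diagonal choice: by uniqueness any later solution has the same value at `t`. Negative times are
  -- frozen at 0, for global continuity.
  set U : ℝ → L2 d := fun t => u (max 0 t) (max 0 t) with hU
  have hUe : ∀ b, 0 ≤ b → ∀ t, t ≤ b → U t = u b (max 0 t) := fun b hb t ht =>
    hagree _ b (le_max_left _ _) (max_le hb ht) ⟨le_max_left _ _, le_rfl⟩
  have hUI : ∀ b, 0 ≤ b → EqOn (u b) U (Icc 0 b) := fun b hb t ht => by
    rw [hUe b hb t ht.2, max_eq_right ht.1]
  have hUc : Continuous U := by
    rw [continuous_iff_continuousAt]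
    intro t
    have hb : 0 ≤ |t| + 1 := by positivity
    have h1 : ContinuousAt (fun r => u (|t| + 1) (max 0 r)) t :=
      ((hu _ hb).continuous.comp (continuous_const.max continuous_id)).continuousAt
    refine h1.congr ?_
    filter_upwards [Iio_mem_nhds (show t < |t| + 1 by linarith [le_abs_self t])] with r hr
    exact (hUe _ hb r (le_of_lt hr)).symm
  refine ⟨U, by simp [hU, hu0 0 le_rfl], fun b hb => ⟨hUc, ?_, (hu b hb).duhamel.congr (hUI b hb) (hUI b hb)⟩⟩
  rw [← stNorm_congr measurableSet_Icc (hUI b hb)]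
  exact (hu b hb).stNorm_ne_top

/-! ### The free group on Schwartz functions: difference quotients -/

/-- A Schwartz function as an element of `L²`. -/
abbrev toL2 (φ : 𝓢(Space d, ℂ)) : L2 d := φ.toLp 2 (volume : Measure (Space d))

lemma fourier_schwartzS (t : ℝ) (φ : 𝓢(Space d, ℂ)) (ξ : Space d) :
    𝓕 (schwartzS t φ) ξ = phase t ξ * 𝓕 φ ξ := by
  rw [schwartzS, SchwartzMap.fourierMultiplierCLM_apply, fourier_fourierInv_eq,
    SchwartzMap.smulLeftCLM_apply_apply (hasTemperateGrowth_phase t), smul_eq_mul]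

lemma fourier_sub_schwartz (F G : 𝓢(Space d, ℂ)) : 𝓕 (F - G) = 𝓕 F - 𝓕 G :=
  map_sub (FourierTransform.fourierCLM ℂ 𝓢(Space d, ℂ)) F G

lemma fourier_laplacian (φ : 𝓢(Space d, ℂ)) (ξ : Space d) :
    𝓕 (Δ φ) ξ = (-(4 * Real.pi ^ 2 * ‖ξ‖ ^ 2) : ℝ) * 𝓕 φ ξ := by
  have hg : ((‖·‖ ^ 2 : Space d → ℝ)).HasTemperateGrowth := by fun_prop
  rw [SchwartzMap.laplacian_eq_fourierMultiplierCLM, FourierTransform.fourier_smul,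
    SchwartzMap.fourierMultiplierCLM_apply, fourier_fourierInv_eq, smul_apply,
    SchwartzMap.smulLeftCLM_apply_apply hg]
  simp only [Complex.real_smul]
  push_cast; ring

lemma norm_toLp_le_of_fourier {F G : 𝓢(Space d, ℂ)} {k : ℝ}
    (h : ∀ ξ, ‖𝓕 F ξ‖ ≤ k * ‖𝓕 G ξ‖) :
    ‖toL2 F‖ ≤ k * ‖toL2 G‖ := by
  rw [← SchwartzMap.norm_fourier_toL2_eq F, ← SchwartzMap.norm_fourier_toL2_eq G]
  refine Lp.norm_le_mul_norm_of_ae_le_mul ?_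
  filter_upwards [(𝓕 F).coeFn_toLp 2, (𝓕 G).coeFn_toLp 2] with ξ h1 h2
  rw [h1, h2]; exact h ξ

lemma toLp_sub (F G : 𝓢(Space d, ℂ)) :
    toL2 (F - G) = toL2 F - toL2 G :=
  map_sub (SchwartzMap.toLpCLM ℂ ℂ 2 (volume : Measure (Space d))) F G

lemma toLp_smul (k : ℂ) (F : 𝓢(Space d, ℂ)) : toL2 (k • F) = k • toL2 F :=
  map_smul (SchwartzMap.toLpCLM ℂ ℂ 2 (volume : Measure (Space d))) k F

lemma phase_eq_exp (t : ℝ) (ξ : Space d) :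
    phase t ξ = Complex.exp (Complex.I * (-(4 * Real.pi ^ 2 * t * ‖ξ‖ ^ 2) : ℝ)) := by
  rw [phase, mul_comm]

lemma norm_phase_sub_le (t r : ℝ) (ξ : Space d) :
    ‖phase t ξ - phase r ξ‖ ≤ |t - r| * (4 * Real.pi ^ 2 * ‖ξ‖ ^ 2) := by
  have h1 : phase t ξ - phase r ξ = phase r ξ * (phase (t - r) ξ - 1) := by
    rw [mul_sub, ← phase_add, mul_one, add_sub_cancel]
  rw [h1, norm_mul, norm_phase, one_mul, phase_eq_exp]
  refine Real.norm_exp_I_mul_ofReal_sub_one_le.trans (le_of_eq ?_)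
  rw [norm_neg, norm_mul, norm_mul, Real.norm_eq_abs (t - r), Real.norm_of_nonneg (by positivity),
    Real.norm_of_nonneg (by positivity)]
  ring

lemma norm_exp_I_sub_sub_le (θ : ℝ) :
    ‖Complex.exp (Complex.I * θ) - 1 - Complex.I * θ‖ ≤ 2 * θ ^ 2 := by
  have hn : ‖Complex.I * (θ : ℂ)‖ = |θ| := by simp
  rcases le_total |θ| 1 with h | h
  · refine (Complex.norm_exp_sub_one_sub_id_le (by rwa [hn])).trans ?_
    rw [hn, sq_abs]; nlinarith [sq_nonneg θ]
  -- For |θ| ≥ 1 both terms are at most |θ| ≤ θ², whence the constant 2.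
  · refine (norm_sub_le _ _).trans ?_
    have h1 : ‖Complex.exp (Complex.I * θ) - 1‖ ≤ |θ| := Real.norm_exp_I_mul_ofReal_sub_one_le
    rw [hn]
    nlinarith [sq_abs θ, abs_nonneg θ]

lemma norm_S_toLp_sub_le (t r : ℝ) (φ : 𝓢(Space d, ℂ)) :
    ‖S t (toL2 φ) - S r (toL2 φ)‖ ≤ |t - r| * ‖toL2 (Δ φ)‖ := by
  rw [S_toLp, S_toLp, ← toLp_sub]
  refine norm_toLp_le_of_fourier fun ξ => ?_
  rw [fourier_laplacian, fourier_sub_schwartz, sub_apply, fourier_schwartzS,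
    fourier_schwartzS, ← sub_mul, norm_mul, norm_mul, Complex.norm_real, norm_neg,
    Real.norm_of_nonneg (by positivity), ← mul_assoc]
  gcongr
  exact norm_phase_sub_le t r ξ

lemma norm_S_toLp_sub_sub_le (h : ℝ) (φ : 𝓢(Space d, ℂ)) :
    ‖S h (toL2 φ) - toL2 φ - (Complex.I * h) • toL2 (Δ φ)‖ ≤
      2 * h ^ 2 * ‖toL2 (Δ (Δ φ))‖ := by
  rw [S_toLp, ← toLp_smul, ← toLp_sub, ← toLp_sub]
  refine norm_toLp_le_of_fourier fun ξ => ?_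
  have h1 : 𝓕 (schwartzS h φ - φ - (Complex.I * h) • Δ φ) ξ =
      (phase h ξ - 1 - Complex.I * (-(4 * Real.pi ^ 2 * h * ‖ξ‖ ^ 2) : ℝ)) * 𝓕 φ ξ := by
    rw [fourier_sub_schwartz, fourier_sub_schwartz, FourierTransform.fourier_smul,
      sub_apply, sub_apply, smul_apply, fourier_schwartzS,
      fourier_laplacian, smul_eq_mul]
    push_cast; ring
  rw [h1, norm_mul, fourier_laplacian, fourier_laplacian, ← mul_assoc, norm_mul, ← mul_assoc]
  gcongr
  rw [phase_eq_exp]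
  refine (norm_exp_I_sub_sub_le _).trans (le_of_eq ?_)
  rw [norm_mul, Complex.norm_real, norm_neg, Real.norm_of_nonneg (by positivity)]
  ring

lemma norm_laplacian_schwartzS_le (t : ℝ) (φ : 𝓢(Space d, ℂ)) :
    ‖toL2 (Δ (schwartzS t φ))‖ ≤ ‖toL2 (Δ φ)‖ := by
  refine (norm_toLp_le_of_fourier (k := 1) fun ξ => ?_).trans (one_mul _).le
  rw [fourier_laplacian, fourier_laplacian, fourier_schwartzS, norm_mul, norm_mul, norm_mul,
    norm_phase, one_mul, one_mul]

lemma norm_laplacian_laplacian_schwartzS_le (t : ℝ) (φ : 𝓢(Space d, ℂ)) :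
    ‖toL2 (Δ (Δ (schwartzS t φ)))‖ ≤ ‖toL2 (Δ (Δ φ))‖ := by
  refine (norm_toLp_le_of_fourier (k := 1) fun ξ => ?_).trans (one_mul _).le
  rw [fourier_laplacian, fourier_laplacian, fourier_laplacian, fourier_laplacian, fourier_schwartzS,
    norm_mul, norm_mul, norm_mul, norm_mul, norm_phase, one_mul, one_mul, norm_mul]

lemma norm_schwartzS_apply_le (t : ℝ) (φ : 𝓢(Space d, ℂ)) (x : Space d) :
    ‖schwartzS t φ x‖ ≤ ∫ ξ, ‖𝓕 φ ξ‖ := by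
  rw [schwartzS_apply]
  refine (norm_integral_le_integral_norm _).trans (le_of_eq ?_)
  refine integral_congr_ae (Eventually.of_forall fun ξ => ?_)
  simp only
  rw [norm_mul, norm_mul, norm_phase, one_mul,
    show 2 * (Real.pi : ℂ) * Complex.I * (inner ℝ x ξ : ℝ) = (2 * Real.pi * inner ℝ x ξ : ℝ) * Complex.I by
      push_cast; ring, Complex.norm_exp_ofReal_mul_I, one_mul]

lemma nrm_le_of_ae_le {q : ℝ} (hq : 1 ≤ q) {f : L2 d} {A : ℝ} (hA : ∀ᵐ x, ‖f x‖ ≤ A) :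
    nrm q f ≤ (ENNReal.ofReal A ^ q * ENNReal.ofReal (‖f‖ ^ 2)) ^ (1 / (q + 2)) := by
  have hfm := L2.measurable f
  rw [nrm_eq, ← L2.lintegral_enorm_sq, ← lintegral_const_mul _ (by fun_prop)]
  refine ENNReal.rpow_le_rpow (lintegral_mono_ae ?_) (by positivity)
  filter_upwards [hA] with x hx
  rw [ENNReal.rpow_add_of_nonneg _ _ (by linarith) (by norm_num)]
  gcongr
  rw [← ofReal_norm]
  exact ENNReal.ofReal_le_ofReal hx

/-- Interpolation between a uniform sup bound and the Lipschitz bound in L². Some modulus of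
continuity in the σ-norm is needed to replace S(r - t)φ by φ in the nonlinear term. -/
lemma exists_nrm_S_toLp_sub_le {q : ℝ} (hq : 1 ≤ q) (φ : 𝓢(Space d, ℂ)) :
    ∃ K : ℝ≥0∞, K ≠ ∞ ∧ ∀ t r : ℝ, nrm q (S t (toL2 φ) - S r (toL2 φ) : L2 d) ≤
      K * ENNReal.ofReal |t - r| ^ (2 / (q + 2)) := by
  set A := 2 * ∫ ξ, ‖𝓕 φ ξ‖ with hA
  set N := ‖toL2 (Δ φ)‖ with hN
  refine ⟨(ENNReal.ofReal A ^ q * ENNReal.ofReal (N ^ 2)) ^ (1 / (q + 2)),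
    ENNReal.rpow_ne_top_of_nonneg (by positivity) (ENNReal.mul_ne_top
      (ENNReal.rpow_ne_top_of_nonneg (by positivity) ENNReal.ofReal_ne_top) ENNReal.ofReal_ne_top),
    fun t r => ?_⟩
  have h1 : ∀ᵐ x, ‖(S t (toL2 φ) - S r (toL2 φ) : L2 d) x‖ ≤ A := by
    rw [S_toLp, S_toLp, ← toLp_sub]
    filter_upwards [(schwartzS t φ - schwartzS r φ).coeFn_toLp 2] with x hx
    rw [hx, sub_apply, hA, two_mul]
    exact (norm_sub_le _ _).trans
      (add_le_add (norm_schwartzS_apply_le t φ x) (norm_schwartzS_apply_le r φ x))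
  refine (nrm_le_of_ae_le hq h1).trans ?_
  have h2 : ENNReal.ofReal |t - r| ^ (2 / (q + 2)) = ENNReal.ofReal (|t - r| ^ 2) ^ (1 / (q + 2)) := by
    rw [ENNReal.ofReal_pow (abs_nonneg _), ← ENNReal.rpow_natCast, ← ENNReal.rpow_mul]
    congr 1; push_cast; ring
  rw [h2, ← ENNReal.mul_rpow_of_nonneg _ _ (by positivity), mul_assoc,
    ← ENNReal.ofReal_mul (by positivity)]
  gcongr
  refine (pow_le_pow_left₀ (norm_nonneg _) (norm_S_toLp_sub_le t r φ) 2).trans (le_of_eq ?_)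
  ring

lemma nrm_toLp_ne_top {q : ℝ} (hq : 1 ≤ q) (φ : 𝓢(Space d, ℂ)) : nrm q (toL2 φ) ≠ ∞ := by
  have h1 : ∀ᵐ x, ‖toL2 φ x‖ ≤ ∫ ξ, ‖𝓕 φ ξ‖ := by
    have h0 : toL2 φ = (schwartzS 0 φ).toLp 2 := by rw [← S_toLp, S_zero]
    rw [h0]
    filter_upwards [(schwartzS 0 φ).coeFn_toLp 2] with x hx
    rw [hx]; exact norm_schwartzS_apply_le 0 φ x
  refine ne_top_of_le_ne_top ?_ (nrm_le_of_ae_le hq h1)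
  exact ENNReal.rpow_ne_top_of_nonneg (by positivity) (ENNReal.mul_ne_top
      (ENNReal.rpow_ne_top_of_nonneg (by positivity) ENNReal.ofReal_ne_top) ENNReal.ofReal_ne_top)

/-! ### Complex conjugation on Schwartz functions -/

/-- The complex conjugate of a Schwartz function. -/
def conjS (φ : 𝓢(Space d, ℂ)) : 𝓢(Space d, ℂ) :=
  φ.postcompCLM (Complex.conjCLE : ℂ →L[ℝ] ℂ)

@[simp] lemma conjS_apply (φ : 𝓢(Space d, ℂ)) (x : Space d) : conjS φ x = (starRingEnd ℂ) (φ x) := rfl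

lemma conjS_conjS (φ : 𝓢(Space d, ℂ)) : conjS (conjS φ) = φ := by
  ext x; simp

lemma laplacian_conjS (φ : 𝓢(Space d, ℂ)) : Δ (conjS φ) = conjS (Δ φ) := by
  ext x
  rw [SchwartzMap.laplacian_apply, conjS_apply, SchwartzMap.laplacian_apply]
  have h : ContDiffAt ℝ 2 (φ : Space d → ℂ) x := (φ.smooth 2).contDiffAt
  exact h.laplacian_CLM_comp_left (l := (Complex.conjCLE : ℂ →L[ℝ] ℂ))

/-- Distributions pair bilinearly and L² sesquilinearly; conjugating the test function converts one
into the other. -/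
lemma toDistr_apply (f : L2 d) (φ : 𝓢(Space d, ℂ)) :
    toDistr f φ = inner ℂ (toL2 (conjS φ)) f := by
  rw [toDistr, Lp.toTemperedDistribution_apply, L2.inner_def]
  refine integral_congr_ae ?_
  filter_upwards [(conjS φ).coeFn_toLp 2] with x hx
  rw [hx, RCLike.inner_apply, conjS_apply, Complex.conj_conj, smul_eq_mul, mul_comm]

lemma laplacian_toDistr_apply (f : L2 d) (φ : 𝓢(Space d, ℂ)) :
    (Δ (toDistr f)) φ = inner ℂ (toL2 (Δ (conjS φ))) f := by
  rw [TemperedDistribution.laplacian_apply_apply, toDistr_apply, laplacian_conjS]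

/-- The hypothesis p = 4/d is used here: focusing and damping terms merge into one power with a
complex coefficient. -/
lemma integral_nonlinearity {a p : ℝ} (hp : p = 4 / (d : ℝ)) (f : L2 d) (φ : 𝓢(Space d, ℂ)) :
    ∫ x, nonlinearity d a p (f x) * φ x =
      (1 + Complex.I * a) * pairing (4 / d) (toL2 (conjS φ)) f := by
  rw [pairing, ← integral_const_mul]
  refine integral_congr_ae ?_
  filter_upwards [(conjS φ).coeFn_toLp 2] with x hx
  rw [hx, RCLike.inner_apply, conjS_apply, Complex.conj_conj, nonlinearity, hp, powN]
  ring

/-! ### Distributional solutions and Duhamel's formula -/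

/-- The defect of the equation, tested against `φ` and integrated over `[s, t]`. -/
def weakDefect (q : ℝ) (c : ℂ) (u : ℝ → L2 d) (φ : 𝓢(Space d, ℂ)) (s t : ℝ) : ℂ :=
  inner ℂ (toL2 φ) (u t - u s) - Complex.I * (∫ r in s..t, inner ℂ (toL2 (Δ φ)) (u r)) -
    c * ∫ r in s..t, pairing q (toL2 φ) (u r)

/-- The defect of Duhamel's formula, tested against `ψ`. -/
def mildDefect (q : ℝ) (c : ℂ) (u : ℝ → L2 d) (ψ : L2 d) (s t : ℝ) : ℂ :=
  inner ℂ ψ (S (-t) (u t) - S (-s) (u s)) - c * ∫ r in s..t, pairing q (S r ψ) (u r)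

lemma pairing_sub {q : ℝ} (hq : 1 ≤ q) {ψ₁ ψ₂ f : L2 d} (h1 : nrm q ψ₁ ≠ ∞) (h2 : nrm q ψ₂ ≠ ∞)
    (hf : nrm q f ≠ ∞) : pairing q (ψ₁ - ψ₂) f = pairing q ψ₁ f - pairing q ψ₂ f := by
  rw [eq_sub_iff_add_eq, ← pairing_add hq
    (ne_top_of_le_ne_top (ENNReal.add_ne_top.2 ⟨h1, h2⟩) (nrm_sub_le hq _ _)) h2 hf, sub_add_cancel]

lemma nrm_S_toLp_ne_top {q : ℝ} (hq : 1 ≤ q) (t : ℝ) (φ : 𝓢(Space d, ℂ)) :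
    nrm q (S t (toL2 φ)) ≠ ∞ := by
  rw [S_toLp]; exact nrm_toLp_ne_top hq _

lemma intervalIntegrable_pairing_const {q : ℝ} (hq : 1 ≤ q) {u : ℝ → L2 d} (hu : Continuous u)
    {a b : ℝ} (hab : a ≤ b) (huf : stNorm q u (Icc a b) ≠ ∞) (φ : 𝓢(Space d, ℂ)) :
    IntervalIntegrable (fun r => pairing q (toL2 φ) (u r)) volume a b := by
  rw [intervalIntegrable_iff_integrableOn_Ioc_of_le hab]
  refine (integrableOn_pairing hq (φ := fun _ => toL2 φ) continuous_const hu ?_ huf).mono_set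
    Ioc_subset_Icc_self
  unfold stNorm
  rw [setLIntegral_const, Real.volume_Icc]
  have := nrm_toLp_ne_top hq φ
  refine ENNReal.rpow_ne_top_of_nonneg (by positivity) (ENNReal.mul_ne_top ?_ ENNReal.ofReal_ne_top)
  exact ENNReal.rpow_ne_top_of_nonneg (by linarith) this

/-- The mild defect is tested with S(-t)φ, because S(r)S(-t)φ = S(r - t)φ is close to φ for r in [s,
t]. The error has three parts: the second-order Taylor remainder of the group, the oscillation of u
in the Laplacian term, and S(r - t)φ - φ in the nonlinear term. -/
lemma enorm_weakDefect_sub_mildDefect_le {q : ℝ} (hq : 1 ≤ q) (hD : Dispersive d q) (c : ℂ)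
    {u : ℝ → L2 d} (hu : Continuous u) {s t : ℝ} (hst : s ≤ t) (huf : stNorm q u (Icc s t) ≠ ∞)
    (φ : 𝓢(Space d, ℂ)) {B ω : ℝ} {κ : ℝ≥0∞} (hB : ‖u s‖ ≤ B) (hω : ∀ r ∈ Icc s t, ‖u s - u r‖ ≤ ω)
    (hκ : ∀ r ∈ Icc s t, nrm q (S (r - t) (toL2 φ) - toL2 φ : L2 d) ≤ κ) :
    ‖weakDefect q c u φ s t - mildDefect q c u (S (-t) (toL2 φ)) s t‖ₑ ≤
      ENNReal.ofReal (t - s) * ENNReal.ofReal (2 * (t - s) * ‖toL2 (Δ (Δ φ))‖ * B + ‖toL2 (Δ φ)‖ * ω) +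
        ‖c‖ₑ * (κ * ∫⁻ r in Ioc s t, nrm q (u r) ^ (q + 1)) := by
  set Φ := toL2 φ with hΦ
  set R : L2 d := S (-(t - s)) Φ - Φ - (Complex.I * (-(t - s) : ℝ)) • toL2 (Δ φ) with hR
  have hSr : ∀ r, S r (S (-t) Φ) = S (r - t) Φ := fun r => by rw [← S_add, sub_eq_add_neg]
  have e1 : inner ℂ Φ (u t - u s) - inner ℂ (S (-t) Φ) (S (-t) (u t) - S (-s) (u s)) =
      inner ℂ R (u s) + Complex.I * ((t - s : ℝ) : ℂ) * inner ℂ (toL2 (Δ φ)) (u s) := by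
    have h1 : inner ℂ (S (-t) Φ) (S (-s) (u s)) = inner ℂ (S (-(t - s)) Φ) (u s) := by
      rw [inner_S, neg_neg, hSr, neg_sub]
    rw [inner_sub_right, inner_sub_right, inner_S_S, h1, hR, inner_sub_left, inner_sub_left,
      inner_smul_left, map_mul, Complex.conj_I, Complex.conj_ofReal]
    push_cast; ring
  have hc1 : Continuous fun r => inner ℂ (toL2 (Δ φ)) (u r) := continuous_const.inner hu
  have e2 : Complex.I * ((t - s : ℝ) : ℂ) * inner ℂ (toL2 (Δ φ)) (u s) -
      Complex.I * (∫ r in s..t, inner ℂ (toL2 (Δ φ)) (u r)) =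
      Complex.I * ∫ r in s..t, inner ℂ (toL2 (Δ φ)) (u s - u r) := by
    simp_rw [inner_sub_right]
    rw [intervalIntegral.integral_sub (by simp) (hc1.intervalIntegrable _ _),
      intervalIntegral.integral_const, Complex.real_smul]
    ring
  have e3 : (∫ r in s..t, pairing q (S r (S (-t) Φ)) (u r)) - ∫ r in s..t, pairing q Φ (u r) =
      ∫ r in s..t, pairing q (S (r - t) Φ - Φ) (u r) := by
    rw [← intervalIntegral.integral_sub
      (intervalIntegrable_pairing hq hD hu huf _ le_rfl hst le_rfl)
      (intervalIntegrable_pairing_const hq hu hst huf φ),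
      intervalIntegral.integral_of_le hst, intervalIntegral.integral_of_le hst]
    refine integral_congr_ae ?_
    have hmm : volume.restrict (Ioc s t) ≤ volume.restrict (Icc s t) :=
      Measure.restrict_mono Ioc_subset_Icc_self le_rfl
    filter_upwards [ae_mono hmm (ae_nrm_ne_top hq hu huf)] with r hr
    rw [hSr, pairing_sub hq (nrm_S_toLp_ne_top hq _ φ) (nrm_toLp_ne_top hq φ) hr]
  have e4 : weakDefect q c u φ s t - mildDefect q c u (S (-t) Φ) s t =
      (inner ℂ R (u s) + Complex.I * ∫ r in s..t, inner ℂ (toL2 (Δ φ)) (u s - u r)) +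
        c * ∫ r in s..t, pairing q (S (r - t) Φ - Φ) (u r) := by
    rw [← e3, ← e2, weakDefect, mildDefect]
    linear_combination e1
  rw [e4]
  have ht0 : 0 ≤ t - s := sub_nonneg.2 hst
  refine (enorm_add_le _ _).trans (add_le_add ?_ ?_)
  · rw [← ENNReal.ofReal_mul ht0, ← ofReal_norm]
    refine ENNReal.ofReal_le_ofReal ?_
    have n1 : ‖R‖ ≤ 2 * (t - s) ^ 2 * ‖toL2 (Δ (Δ φ))‖ := by
      have := norm_S_toLp_sub_sub_le (-(t - s)) φ
      rwa [neg_sq] at this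
    have n2 : ‖∫ r in s..t, inner ℂ (toL2 (Δ φ)) (u s - u r)‖ ≤ ‖toL2 (Δ φ)‖ * ω * |t - s| := by
      refine intervalIntegral.norm_integral_le_of_norm_le_const fun r hr => ?_
      rw [uIoc_of_le hst] at hr
      refine (norm_inner_le_norm _ _).trans ?_
      gcongr
      exact hω r ⟨hr.1.le, hr.2⟩
    rw [abs_of_nonneg ht0] at n2
    calc _ ≤ ‖R‖ * ‖u s‖ + 1 * (‖toL2 (Δ φ)‖ * ω * (t - s)) := by
          refine (norm_add_le _ _).trans (add_le_add (norm_inner_le_norm _ _) ?_)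
          rw [norm_mul, Complex.norm_I]
          gcongr
      _ ≤ 2 * (t - s) ^ 2 * ‖toL2 (Δ (Δ φ))‖ * B + 1 * (‖toL2 (Δ φ)‖ * ω * (t - s)) := by gcongr
      _ = _ := by ring
  · rw [enorm_mul]
    gcongr
    rw [intervalIntegral.integral_of_le hst]
    refine (enorm_integral_le_lintegral_enorm _).trans ?_
    rw [← lintegral_const_mul _ ((measurable_nrm hq hu).pow_const _)]
    refine setLIntegral_mono' measurableSet_Ioc fun r hr => ?_
    exact (enorm_pairing_le hq _ _).trans (mul_le_mul' (hκ r ⟨hr.1.le, hr.2⟩) le_rfl)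

/-- Puts the error in the form required by `eq_of_increments_le`. The test function may vary with t:
one implication fixes the weak test function, the other fixes S(-t)φ_t. -/
theorem exists_delta_weakDefect_sub_mildDefect {q : ℝ} (hq : 1 ≤ q) (hD : Dispersive d q) (c : ℂ)
    {u : ℝ → L2 d} (hu : Continuous u) {b : ℝ} (huf : stNorm q u (Icc 0 b) ≠ ∞)
    (φ : ℝ → 𝓢(Space d, ℂ)) {N₁ N₂ : ℝ} {K : ℝ≥0∞} (hK : K ≠ ∞) (hN₁ : ∀ t, ‖toL2 (Δ (φ t))‖ ≤ N₁)
    (hN₂ : ∀ t, ‖toL2 (Δ (Δ (φ t)))‖ ≤ N₂)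
    (hφK : ∀ r t, nrm q (S (r - t) (toL2 (φ t)) - toL2 (φ t) : L2 d) ≤
      K * ENNReal.ofReal |r - t| ^ (2 / (q + 2))) {ε : ℝ≥0∞} (hε : ε ≠ 0) (hεt : ε ≠ ∞) :
    ∃ δ : ℝ, 0 < δ ∧ ∀ s t, 0 ≤ s → s ≤ t → t ≤ b → t - s ≤ δ →
      ‖weakDefect q c u (φ t) s t - mildDefect q c u (S (-t) (toL2 (φ t))) s t‖ₑ ≤
        ε * ∫⁻ r in Ioc s t, (1 + nrm q (u r) ^ (q + 2)) := by
  obtain ⟨B, hB⟩ := isCompact_Icc.exists_bound_of_continuousOn (hu.continuousOn (s := Icc 0 b))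
  have hN₁0 : 0 ≤ N₁ := (norm_nonneg _).trans (hN₁ 0)
  have hN₂0 : 0 ≤ N₂ := (norm_nonneg _).trans (hN₂ 0)
  set e := ε.toReal with he
  have he0 : 0 < e := ENNReal.toReal_pos hε hεt
  -- The error budget: a quarter of `ε` each for the oscillation of `u` (`ω`) and the Taylor
  -- remainder (`δ₂`), and half for the nonlinear term (`κ'`).
  set ω := e / (4 * (N₁ + 1)) with hω
  have hω0 : 0 < ω := by positivity
  obtain ⟨δ₁, hδ₁, H₁⟩ := Metric.uniformContinuousOn_iff.1
    (isCompact_Icc.uniformContinuousOn_of_continuous (hu.continuousOn (s := Icc 0 b))) ω hω0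
  have hε2 : ε / 2 ≠ 0 := ENNReal.div_ne_zero.2 ⟨hε, by simp⟩
  obtain ⟨κ', hκ0, hκt, hκ⟩ := exists_rpow_small (C := ‖c‖ₑ * K) (by finiteness)
    (show 0 < 2 / (q + 2) by positivity) hε2
  set δ₂ := e / (4 * (2 * N₂ * |B| + 1)) with hδ₂
  have hδ₂0 : 0 < δ₂ := by positivity
  refine ⟨min (min (δ₁ / 2) δ₂) κ'.toReal, lt_min (lt_min (by linarith) hδ₂0)
    (ENNReal.toReal_pos hκ0 hκt), fun s t hs hst ht hd => ?_⟩
  have hd1 : t - s ≤ δ₁ / 2 := hd.trans ((min_le_left _ _).trans (min_le_left _ _))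
  have hd2 : t - s ≤ δ₂ := hd.trans ((min_le_left _ _).trans (min_le_right _ _))
  have hd3 : t - s ≤ κ'.toReal := hd.trans (min_le_right _ _)
  have ht0 : 0 ≤ t - s := sub_nonneg.2 hst
  have hsm : s ∈ Icc 0 b := ⟨hs, hst.trans ht⟩
  have hest := enorm_weakDefect_sub_mildDefect_le hq hD c hu hst
    (ne_top_of_le_ne_top huf (stNorm_mono hq u (Icc_subset_Icc hs ht))) (φ t) (B := |B|) (ω := ω)
    (κ := K * κ' ^ (2 / (q + 2))) ((hB s hsm).trans (le_abs_self B)) (fun r hr => by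
      rw [← dist_eq_norm]
      refine (H₁ s hsm r ⟨hs.trans hr.1, hr.2.trans ht⟩ ?_).le
      rw [Real.dist_eq, abs_sub_comm, abs_of_nonneg (sub_nonneg.2 hr.1)]
      linarith [hr.2])
    (fun r hr => by
      refine (hφK r t).trans ?_
      gcongr
      rw [abs_sub_comm, abs_of_nonneg (sub_nonneg.2 hr.2)]
      exact ENNReal.ofReal_le_of_le_toReal (by linarith [hr.1]))
  refine hest.trans ?_
  have hX : 2 * (t - s) * ‖toL2 (Δ (Δ (φ t)))‖ * |B| + ‖toL2 (Δ (φ t))‖ * ω ≤ e / 2 := by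
    have h1 : 2 * (t - s) * ‖toL2 (Δ (Δ (φ t)))‖ * |B| ≤ e / 4 := by
      calc _ ≤ 2 * δ₂ * N₂ * |B| := by gcongr; exact hN₂ t
        _ = δ₂ * (2 * N₂ * |B|) := by ring
        _ ≤ δ₂ * (2 * N₂ * |B| + 1) := by gcongr; linarith
        _ = e / 4 := by rw [hδ₂]; field_simp
    have h2 : ‖toL2 (Δ (φ t))‖ * ω ≤ e / 4 := by
      calc _ ≤ (N₁ + 1) * ω := by gcongr; linarith [hN₁ t]
        _ = e / 4 := by rw [hω]; field_simp
    linarith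
  have hX2 : ENNReal.ofReal (2 * (t - s) * ‖toL2 (Δ (Δ (φ t)))‖ * |B| + ‖toL2 (Δ (φ t))‖ * ω) ≤ ε / 2 := by
    refine (ENNReal.ofReal_le_ofReal hX).trans (le_of_eq ?_)
    rw [ENNReal.ofReal_div_of_pos two_pos, he, ENNReal.ofReal_toReal hεt]; simp
  have hI1 : ENNReal.ofReal (t - s) ≤ ∫⁻ r in Ioc s t, (1 + nrm q (u r) ^ (q + 2)) := by
    rw [← Real.volume_Ioc, ← setLIntegral_one]
    exact lintegral_mono fun r => le_self_add
  have hI2 : ∫⁻ r in Ioc s t, nrm q (u r) ^ (q + 1) ≤ ∫⁻ r in Ioc s t, (1 + nrm q (u r) ^ (q + 2)) := by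
    refine lintegral_mono fun r => ?_
    rcases le_total (nrm q (u r)) 1 with h | h
    · exact (ENNReal.rpow_le_one h (by linarith)).trans le_self_add
    · exact (ENNReal.rpow_le_rpow_of_exponent_le h (by linarith)).trans le_add_self
  calc _ ≤ (∫⁻ r in Ioc s t, (1 + nrm q (u r) ^ (q + 2))) * (ε / 2) +
        ‖c‖ₑ * ((K * κ' ^ (2 / (q + 2))) * ∫⁻ r in Ioc s t, (1 + nrm q (u r) ^ (q + 2))) := by
        gcongr
    _ = (ε / 2 + ‖c‖ₑ * K * κ' ^ (2 / (q + 2))) * ∫⁻ r in Ioc s t, (1 + nrm q (u r) ^ (q + 2)) := by ring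
    _ ≤ (ε / 2 + ε / 2) * ∫⁻ r in Ioc s t, (1 + nrm q (u r) ^ (q + 2)) := by gcongr
    _ = _ := by rw [ENNReal.add_halves]

lemma lintegral_one_add_ne_top {q : ℝ} (hq : 1 ≤ q) {u : ℝ → L2 d} {b : ℝ}
    (huf : stNorm q u (Icc 0 b) ≠ ∞) : ∫⁻ r in Ioc 0 b, (1 + nrm q (u r) ^ (q + 2)) ≠ ∞ := by
  refine ne_top_of_le_ne_top ?_ (lintegral_mono_set Ioc_subset_Icc_self)
  rw [lintegral_add_left measurable_const, setLIntegral_one, Real.volume_Icc]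
  exact ENNReal.add_ne_top.2 ⟨ENNReal.ofReal_ne_top, lintegral_ne_top_of_stNorm hq huf⟩

/-- The weak defect is additive over adjacent intervals and differs little from the mild defect,
which vanishes for a mild solution. -/
theorem weakDefect_eq_zero {q : ℝ} (hq : 1 ≤ q) (hD : Dispersive d q) {c : ℂ} {u : ℝ → L2 d} {b : ℝ}
    (hb : 0 ≤ b) (h : IsMild q c u 0 b) (φ : 𝓢(Space d, ℂ)) : weakDefect q c u φ 0 b = 0 := by
  obtain ⟨K, hK, hφK⟩ := exists_nrm_S_toLp_sub_le hq φ
  have hu := h.continuous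
  have hc1 : Continuous fun r => inner ℂ (toL2 (Δ φ)) (u r) := continuous_const.inner hu
  have hadd : ∀ s t, 0 ≤ s → s ≤ t → t ≤ b →
      weakDefect q c u φ 0 t - weakDefect q c u φ 0 s = weakDefect q c u φ s t := by
    intro s t hs hst ht
    have h1 := intervalIntegral.integral_add_adjacent_intervals
      (hc1.intervalIntegrable 0 s) (hc1.intervalIntegrable (μ := volume) s t)
    have h2 := intervalIntegral.integral_add_adjacent_intervals
      (intervalIntegrable_pairing_const hq hu hs (h.mono hq le_rfl (hst.trans ht)).stNorm_ne_top φ)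
      (intervalIntegrable_pairing_const hq hu hst (h.mono hq hs ht).stNorm_ne_top φ)
    simp only [weakDefect, inner_sub_right]
    rw [← h1, ← h2]; ring
  have h0 : weakDefect q c u φ 0 0 = 0 := by simp [weakDefect]
  rw [← h0]
  refine eq_of_increments_le (H := fun t => weakDefect q c u φ 0 t) hb
    (lintegral_one_add_ne_top hq h.stNorm_ne_top) fun ε hε hεt => ?_
  obtain ⟨δ, hδ, H⟩ := exists_delta_weakDefect_sub_mildDefect hq hD c hu h.stNorm_ne_top (fun _ => φ) hK
    (fun _ => le_rfl) (fun _ => le_rfl) (fun r t => by simpa using hφK (r - t) 0) hε hεt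
  refine ⟨δ, hδ, fun s t hs hst ht hd => ?_⟩
  have h3 := H s t hs hst ht hd
  have h4 : mildDefect q c u (S (-t) (toL2 φ)) s t = 0 := by
    rw [mildDefect, h.duhamel s t hs hst ht, sub_self]
  rw [h4, sub_zero] at h3
  rwa [hadd s t hs hst ht]

/-- The converse comparison, now with additive mild defect. The weak equation is tested on short
intervals with φ_t = S(t)φ, so that S(-t)φ_t = φ stays fixed. -/
theorem isMild_of_weakDefect {q : ℝ} (hq : 1 ≤ q) (hD : Dispersive d q) {c : ℂ} {u : ℝ → L2 d} {b : ℝ}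
    (hu : Continuous u) (huf : stNorm q u (Icc 0 b) ≠ ∞)
    (h : ∀ φ, ∀ t ∈ Icc 0 b, weakDefect q c u φ 0 t = 0) : IsMild q c u 0 b := by
  refine ⟨hu, huf, ?_⟩
  have hufm : ∀ s t, 0 ≤ s → t ≤ b → stNorm q u (Icc s t) ≠ ∞ := fun s t hs ht =>
    ne_top_of_le_ne_top huf (stNorm_mono hq u (Icc_subset_Icc hs ht))
  have hweak : ∀ φ s t, 0 ≤ s → s ≤ t → t ≤ b → weakDefect q c u φ s t = 0 := by
    intro φ s t hs hst ht
    have hc1 : Continuous fun r => inner ℂ (toL2 (Δ φ)) (u r) := continuous_const.inner hu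
    have h1 := intervalIntegral.integral_add_adjacent_intervals
      (hc1.intervalIntegrable 0 s) (hc1.intervalIntegrable (μ := volume) s t)
    have h2 := intervalIntegral.integral_add_adjacent_intervals
      (intervalIntegrable_pairing_const hq hu hs (hufm _ _ le_rfl (hst.trans ht)) φ)
      (intervalIntegrable_pairing_const hq hu hst (hufm _ _ hs ht) φ)
    have e1 := h φ s ⟨hs, hst.trans ht⟩
    have e2 := h φ t ⟨hs.trans hst, ht⟩
    simp only [weakDefect, inner_sub_right] at e1 e2 ⊢
    rw [← h1, ← h2] at e2
    linear_combination e2 - e1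
  have hmild : ∀ φ : 𝓢(Space d, ℂ), ∀ t ∈ Icc 0 b, mildDefect q c u (toL2 φ) 0 t = 0 := by
    intro φ b' hb'
    obtain ⟨K, hK, hφK⟩ := exists_nrm_S_toLp_sub_le hq φ
    have hadd : ∀ s t, 0 ≤ s → s ≤ t → t ≤ b' →
        mildDefect q c u (toL2 φ) 0 t - mildDefect q c u (toL2 φ) 0 s = mildDefect q c u (toL2 φ) s t := by
      intro s t hs hst ht
      have ht' := ht.trans hb'.2
      have h2 := intervalIntegral.integral_add_adjacent_intervals
        (intervalIntegrable_pairing hq hD hu (hufm 0 b le_rfl le_rfl) (toL2 φ) le_rfl hs (hst.trans ht'))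
        (intervalIntegrable_pairing hq hD hu (hufm 0 b le_rfl le_rfl) (toL2 φ) hs hst ht')
      simp only [mildDefect, inner_sub_right]
      rw [← h2]; ring
    have h0 : mildDefect q c u (toL2 φ) 0 0 = 0 := by simp [mildDefect]
    rw [← h0]
    refine eq_of_increments_le (H := fun t => mildDefect q c u (toL2 φ) 0 t) hb'.1
      (lintegral_one_add_ne_top hq (hufm 0 b' le_rfl hb'.2)) fun ε hε hεt => ?_
    obtain ⟨δ, hδ, H⟩ := exists_delta_weakDefect_sub_mildDefect hq hD c hu (hufm 0 b' le_rfl hb'.2)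
      (fun t => schwartzS t φ) hK (fun t => norm_laplacian_schwartzS_le t φ)
      (fun t => norm_laplacian_laplacian_schwartzS_le t φ) (fun r t => by
        have := hφK r t
        rwa [show S (r - t) (toL2 (schwartzS t φ)) = S r (toL2 φ) by
          rw [toL2, ← S_toLp, ← S_add, sub_add_cancel], show toL2 (schwartzS t φ) = S t (toL2 φ) from
          (S_toLp t φ).symm]) hε hεt
    refine ⟨δ, hδ, fun s t hs hst ht hd => ?_⟩
    have h3 := H s t hs hst ht hd
    rw [hweak _ s t hs hst (ht.trans hb'.2), zero_sub, enorm_neg,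
      show S (-t) (toL2 (schwartzS t φ)) = toL2 φ by rw [toL2, ← S_toLp, S_neg_S]] at h3
    rwa [hadd s t hs hst ht]
  rcases lt_or_ge b 0 with hb | hb
  · intro s t hs hst ht
    linarith
  -- So far Duhamel's formula is known only against Schwartz functions. Comparing `u` with the
  -- linear solution `v` of the same source and datum reduces the extension to all ψ to the density
  -- of Schwartz functions in L².
  obtain ⟨v, -, hv0, hv, -⟩ := exists_duhamel hq hD c hb hu huf (u 0)
  have hzero : ∀ t ∈ Icc 0 b, S (-t) (u t) - S (-0) (u 0) = S (-t) (v t) - S (-0) (v 0) := by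
    intro t ht
    have hdense := SchwartzMap.denseRange_toLpCLM (F := ℂ) (p := 2) (by simp)
      (μ := (volume : Measure (Space d)))
    refine hdense.eq_of_inner_right (𝕜 := ℂ) fun φ => ?_
    have h1 := hmild φ t ht
    rw [mildDefect, ← hv 0 t le_rfl ht.1 ht.2, sub_eq_zero] at h1
    exact h1
  refine hv.congr (fun t ht => ?_) (fun _ _ => rfl)
  have h1 := hzero t ht
  rw [hv0, S_zero] at h1
  have h2 := sub_left_injective h1
  have h3 : S t (S (-t) (u t)) = S t (S (-t) (v t)) := congrArg _ h2
  rw [S_S_neg, S_S_neg] at h3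
  exact h3.symm

/-! ### Well-posedness in `L²` -/

lemma sigmaNorm_eq (u : ℝ → L2 d) (I : Set ℝ) : sigmaNorm u I = stNorm (4 / d) u I := by
  have h0 : sigma d ≠ 0 := by
    rw [sigma, Ne, ENNReal.ofReal_eq_zero, not_le]; positivity
  have ht : sigma d ≠ ∞ := ENNReal.ofReal_ne_top
  have hr : (sigma d).toReal = 4 / d + 2 := ENNReal.toReal_ofReal (by positivity)
  rw [sigmaNorm, eLpNorm_eq_eLpNorm' h0 ht, hr, eLpNorm'_eq_lintegral_enorm, stNorm]
  simp_rw [eLpNorm_eq_eLpNorm' h0 ht, hr, enorm_eq_self]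

/-- The coefficient of the nonlinearity after division of the equation by `-i`. -/
def coeff (a : ℝ) : ℂ := Complex.I * (1 + Complex.I * a)

lemma coeff_re (a : ℝ) : (coeff a).re = -a := by simp [coeff]

lemma one_le_four_div (hd : 1 ≤ d) (hd' : d ≤ 4) : (1 : ℝ) ≤ 4 / d := by
  have h1 : (0 : ℝ) < d := by exact_mod_cast hd
  rw [one_le_div h1]; exact_mod_cast hd'

lemma Icc_subset_timeInterval {T : EReal} {b : ℝ} (hb : b ∈ timeInterval T) :
    Icc 0 b ⊆ timeInterval T := fun t ht =>
  ⟨ht.1, lt_of_le_of_lt (by exact_mod_cast ht.2) hb.2⟩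

lemma weakForm_iff {q : ℝ} (hq : 1 ≤ q) {a : ℝ} {u : ℝ → L2 d} (hu : Continuous u) {t : ℝ} (ht : 0 ≤ t)
    (huf : stNorm q u (Icc 0 t) ≠ ∞) (φ : 𝓢(Space d, ℂ)) :
    weakDefect q (coeff a) u φ 0 t = 0 ↔
      inner ℂ (toL2 φ) (u t) = inner ℂ (toL2 φ) (u 0) + Complex.I * ∫ s in (0 : ℝ)..t,
        (inner ℂ (toL2 (Δ φ)) (u s) + (1 + Complex.I * a) * pairing q (toL2 φ) (u s)) := by
  have hc1 : Continuous fun r => inner ℂ (toL2 (Δ φ)) (u r) := continuous_const.inner hu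
  rw [intervalIntegral.integral_add (hc1.intervalIntegrable _ _)
    ((intervalIntegrable_pairing_const hq hu ht huf φ).const_mul _),
    intervalIntegral.integral_const_mul, weakDefect, inner_sub_right, coeff]
  constructor <;> intro h <;> linear_combination h

lemma SolvesEquation.isMild (hd : 1 ≤ d) (hd' : d ≤ 4) {a p : ℝ} (hp : p = 4 / (d : ℝ))
    {u₀ : L2 d} {u : ℝ → L2 d} {T : EReal} (h : SolvesEquation d a p u₀ u T)
    (hu : ContinuousOn u (timeInterval T)) {b : ℝ} (hb : b ∈ timeInterval T)
    (huf : sigmaNorm u (Icc 0 b) ≠ ∞) :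
    ∃ v : ℝ → L2 d, IsMild (4 / d) (coeff a) v 0 b ∧ EqOn u v (Icc 0 b) ∧ v 0 = u₀ := by
  have hq := one_le_four_div hd hd'
  have hsub := Icc_subset_timeInterval hb
  -- A solution on `[0, T)` may be arbitrary elsewhere; freezing it outside `[0, b]` gives a
  -- globally continuous curve.
  set v : ℝ → L2 d := fun t => u (projIcc 0 b hb.1 t) with hv
  have hvc : Continuous v := (hu.mono hsub).comp_continuous
    (continuous_subtype_val.comp continuous_projIcc) fun t => (projIcc 0 b hb.1 t).2
  have huv : EqOn u v (Icc 0 b) := fun t ht => by simp only [hv, projIcc_of_mem hb.1 ht]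
  have hv0 : v 0 = u₀ := by rw [← huv ⟨le_rfl, hb.1⟩, h.1]
  have hvf : stNorm (4 / d) v (Icc 0 b) ≠ ∞ := by
    rwa [← stNorm_congr measurableSet_Icc huv, ← sigmaNorm_eq]
  refine ⟨v, isMild_of_weakDefect hq (dispersive hd) hvc hvf fun φ t ht => ?_, huv, hv0⟩
  rw [weakForm_iff hq hvc ht.1 (ne_top_of_le_ne_top hvf (stNorm_mono hq v (Icc_subset_Icc_right ht.2)))]
  have h1 := h.2 (conjS φ) t (hsub ht)
  rw [toDistr_apply, toDistr_apply, conjS_conjS, huv ht, ← hv0] at h1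
  rw [h1]
  congr 2
  refine intervalIntegral.integral_congr fun r hr => ?_
  rw [uIcc_of_le ht.1] at hr
  rw [laplacian_toDistr_apply, integral_nonlinearity hp, conjS_conjS, huv ⟨hr.1, hr.2.trans ht.2⟩]

lemma solvesEquation_of_isMild (hd : 1 ≤ d) (hd' : d ≤ 4) {a p : ℝ} (hp : p = 4 / (d : ℝ))
    {u₀ : L2 d} {u : ℝ → L2 d} (h0 : u 0 = u₀) (hu : ∀ b, 0 ≤ b → IsMild (4 / d) (coeff a) u 0 b)
    (T : EReal) : SolvesEquation d a p u₀ u T := by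
  have hq := one_le_four_div hd hd'
  refine ⟨h0, fun φ t ht => ?_⟩
  have h1 := weakDefect_eq_zero hq (dispersive hd) ht.1 (hu t ht.1) (conjS φ)
  rw [weakForm_iff hq (hu t ht.1).continuous ht.1 (hu t ht.1).stNorm_ne_top, h0] at h1
  rw [toDistr_apply, toDistr_apply, h1]
  simp_rw [laplacian_toDistr_apply, integral_nonlinearity hp]

lemma SolvesEquation.eqOn (hd : 1 ≤ d) (hd' : d ≤ 4) {a p : ℝ} (hp : p = 4 / (d : ℝ))
    {u₀ : L2 d} {u v : ℝ → L2 d} {T : EReal} (h0 : u 0 = u₀)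
    (hu : ∀ b, 0 ≤ b → IsMild (4 / d) (coeff a) u 0 b) (h : SolvesEquation d a p u₀ v T)
    (hv : ContinuousOn v (timeInterval T))
    (hvf : ∀ t ∈ timeInterval T, sigmaNorm v (Icc 0 t) < ∞) : EqOn v u (timeInterval T) := by
  intro t ht
  obtain ⟨w, hw, hvw, hw0⟩ := h.isMild hd hd' hp hv ht (hvf t ht).ne
  rw [hvw ⟨ht.1, le_rfl⟩]
  exact hw.eqOn (one_le_four_div hd hd') (dispersive hd) (hu t ht.1) (hw0.trans h0.symm) ⟨ht.1, le_rfl⟩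

theorem hasUniqueGlobalSolution_L2 (hd : 1 ≤ d) (hd' : d ≤ 4) {a p : ℝ} (ha : 0 < a)
    (hp : p = 4 / (d : ℝ)) (u₀ : L2 d) : HasUniqueGlobalSolution (IsL2Solution d a p u₀) := by
  obtain ⟨u, h0, hu⟩ := exists_global_mild (one_le_four_div hd hd') (dispersive hd) (c := coeff a)
    (by rw [coeff_re]; linarith) u₀
  refine ⟨u, ⟨EReal.coe_lt_top 0, (hu 0 le_rfl).continuous.continuousOn, fun t ht => ?_,
    solvesEquation_of_isMild hd hd' hp h0 hu ⊤⟩, fun v T hv => ?_⟩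
  · rw [sigmaNorm_eq]; exact (hu t ht.1).stNorm_ne_top.lt_top
  · exact hv.equation.eqOn hd hd' hp h0 hu hv.continuous hv.sigma_loc

/-- The global solution extends every solution, so maximality forces an infinite lifespan. -/
lemma HasUniqueGlobalSolution.eq_top {Sol : (ℝ → L2 d) → EReal → Prop}
    (h : HasUniqueGlobalSolution Sol) {u : ℝ → L2 d} {T : EReal} (hu : IsMaximal Sol u T) : T = ⊤ := by
  obtain ⟨v, hv, huniq⟩ := h
  exact top_le_iff.1 (hu.2 v ⊤ hv (huniq u T hu.1).symm)

/-! ### Translations -/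

/-- Translation by `h` on `L²`: `f ↦ f(· + h)`. -/
def translate (h : Space d) : L2 d →ₗᵢ[ℂ] L2 d :=
  Lp.compMeasurePreservingₗᵢ ℂ (· + h) (measurePreserving_add_right volume h)

lemma translate_coe (h : Space d) (f : L2 d) : translate h f =ᵐ[volume] fun x => f (x + h) :=
  Lp.coeFn_compMeasurePreserving f (measurePreserving_add_right volume h)

lemma translate_translate_neg (h : Space d) (f : L2 d) : translate h (translate (-h) f) = f := by
  refine Lp.ext ?_
  filter_upwards [translate_coe h (translate (-h) f),
    (measurePreserving_add_right volume h).quasiMeasurePreserving.ae (translate_coe (-h) f)] with x h1 h2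
  rw [h1, h2, add_neg_cancel_right]

lemma inner_translate (h : Space d) (f g : L2 d) :
    inner ℂ f (translate h g) = inner ℂ (translate (-h) f) g := by
  rw [← (translate h).inner_map_map (translate (-h) f) g, translate_translate_neg]

lemma nrm_translate {q : ℝ} (h : Space d) (f : L2 d) : nrm q (translate h f) = nrm q f := by
  rw [nrm_eq, nrm_eq]
  congr 1
  rw [← lintegral_add_right_eq_self (fun x => ‖f x‖ₑ ^ (q + 2)) h]
  refine lintegral_congr_ae ?_
  filter_upwards [translate_coe h f] with x hx
  rw [hx]

lemma pairing_translate {q : ℝ} (h : Space d) (ψ f : L2 d) :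
    pairing q (translate h ψ) (translate h f) = pairing q ψ f := by
  rw [pairing, pairing, ← integral_add_right_eq_self (fun x => inner ℂ (ψ x) (powN q (f x))) h]
  refine integral_congr_ae ?_
  filter_upwards [translate_coe h f, translate_coe h ψ] with x hx hx'
  rw [hx, hx']

/-- The character `ξ ↦ e^{2πi⟨h, ξ⟩}`. -/
def char (h ξ : Space d) : ℂ := Complex.exp ((2 * Real.pi * inner ℝ h ξ : ℝ) * Complex.I)

lemma char_eq_exp (h ξ : Space d) :
    char h ξ = Complex.exp (Complex.I * (2 * Real.pi * inner ℝ h ξ : ℝ)) := by rw [char, mul_comm]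

lemma conj_char (h ξ : Space d) : (starRingEnd ℂ) (char h ξ) = char (-h) ξ := by
  rw [char, char, ← Complex.exp_conj, map_mul, Complex.conj_I, Complex.conj_ofReal, inner_neg_left]
  congr 1; push_cast; ring

lemma norm_char (h ξ : Space d) : ‖char h ξ‖ = 1 := Complex.norm_exp_ofReal_mul_I _

lemma hasTemperateGrowth_char (h : Space d) : (char h).HasTemperateGrowth := by
  have h2 : (fun ξ : Space d => (2 * Real.pi * inner ℝ h ξ : ℝ)).HasTemperateGrowth := by fun_prop
  exact hasTemperateGrowth_cexp_I.comp h2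

lemma memLp_char_mul (h : Space d) (f : L2 d) : MemLp (fun ξ => char h ξ * f ξ) 2 volume := by
  refine (Lp.memLp f).of_le (((hasTemperateGrowth_char h).1.continuous.aestronglyMeasurable).mul
    (Lp.aestronglyMeasurable f)) (Eventually.of_forall fun ξ => ?_)
  rw [norm_mul, norm_char, one_mul]

lemma fourierInv_char_smul (h : Space d) (φ : 𝓢(Space d, ℂ)) (x : Space d) :
    𝓕⁻ (SchwartzMap.smulLeftCLM ℂ (char h) φ) x = 𝓕⁻ φ (x + h) := by
  rw [SchwartzMap.fourierInv_coe, SchwartzMap.fourierInv_coe, Real.fourierInv_eq', Real.fourierInv_eq']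
  congr 1
  ext ξ
  rw [SchwartzMap.smulLeftCLM_apply_apply (hasTemperateGrowth_char h), smul_eq_mul, smul_eq_mul,
    smul_eq_mul, ← mul_assoc, char, ← Complex.exp_add, inner_add_right, real_inner_comm h ξ]
  congr 2; push_cast; ring

lemma translate_fourierInv (h : Space d) (φ : 𝓢(Space d, ℂ)) :
    translate h (toL2 (𝓕⁻ φ)) = toL2 (𝓕⁻ (SchwartzMap.smulLeftCLM ℂ (char h) φ)) := by
  refine Lp.ext ?_
  filter_upwards [translate_coe h (toL2 (𝓕⁻ φ)),
    (measurePreserving_add_right volume h).quasiMeasurePreserving.ae ((𝓕⁻ φ).coeFn_toLp 2 volume),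
    (𝓕⁻ (SchwartzMap.smulLeftCLM ℂ (char h) φ)).coeFn_toLp 2 volume] with x h1 h2 h3
  rw [h1, h2, h3, fourierInv_char_smul]

/-- Duality with Schwartz functions reduces the identity to the explicit inverse Fourier integral.
-/
lemma fourier_translate (h : Space d) (f : L2 d) :
    (𝓕 (translate h f) : L2 d) =ᵐ[volume] fun ξ => char h ξ * (𝓕 f : L2 d) ξ := by
  have key : 𝓕 (translate h f) = (memLp_char_mul h (𝓕 f)).toLp := by
    refine (SchwartzMap.denseRange_toLpCLM (F := ℂ) (p := 2) (by simp) (μ := volume)).eq_of_inner_right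
      (𝕜 := ℂ) fun φ => ?_
    show inner ℂ (toL2 φ) _ = inner ℂ (toL2 φ) _
    have h1 : ∀ φ : 𝓢(Space d, ℂ), ∀ g : L2 d, inner ℂ (toL2 φ) (𝓕 g) = inner ℂ (toL2 (𝓕⁻ φ)) g := by
      intro φ g
      rw [← Lp.inner_fourier_eq (toL2 (𝓕⁻ φ)), SchwartzMap.toLp_fourier_eq, fourier_fourierInv_eq]
    rw [h1, inner_translate, translate_fourierInv, ← h1, L2.inner_def, L2.inner_def]
    refine integral_congr_ae ?_
    filter_upwards [(memLp_char_mul h (𝓕 f)).coeFn_toLp, φ.coeFn_toLp 2,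
      (SchwartzMap.smulLeftCLM ℂ (char (-h)) φ).coeFn_toLp 2] with ξ h3 h4 h5
    rw [h3, h4, h5, SchwartzMap.smulLeftCLM_apply_apply (hasTemperateGrowth_char _), smul_eq_mul,
      RCLike.inner_apply, RCLike.inner_apply, map_mul, conj_char, neg_neg]
    ring
  rw [key]
  exact (memLp_char_mul h (𝓕 f)).coeFn_toLp

lemma fourier_injective {f g : L2 d} (h : (𝓕 f : L2 d) = 𝓕 g) : f = g := by
  simpa only [fourierInv_fourier_eq] using congrArg (fun x => (𝓕⁻ x : L2 d)) h

lemma translate_S (h : Space d) (t : ℝ) (f : L2 d) : translate h (S t f) = S t (translate h f) := by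
  refine fourier_injective (Lp.ext ?_)
  rw [fourier_S]
  filter_upwards [fourier_translate h (S t f), phaseMul_coe t (𝓕 (translate h f)), fourier_translate h f,
    phaseMul_coe t (𝓕 f)] with ξ h1 h2 h3 h4
  rw [h1, h2, h3, fourier_S, h4]; ring

lemma stNorm_translate {q : ℝ} (h : Space d) (u : ℝ → L2 d) (I : Set ℝ) :
    stNorm q (fun t => translate h (u t)) I = stNorm q u I := by
  simp only [stNorm, nrm_translate]

/-- The equation is translation invariant, so a translate can be compared with the solution itself
by the stability theorem. -/
lemma IsMild.translate {q : ℝ} {c : ℂ} {u : ℝ → L2 d} {a b : ℝ} (hu : IsMild q c u a b) (h : Space d) :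
    IsMild q c (fun t => translate h (u t)) a b where
  continuous := (DampedNLS.translate h).continuous.comp hu.continuous
  stNorm_ne_top := by rw [stNorm_translate]; exact hu.stNorm_ne_top
  duhamel s t hs hst ht ψ := by
    have h1 := hu.duhamel s t hs hst ht (DampedNLS.translate (-h) ψ)
    simp only [← translate_S, ← map_sub]
    rw [inner_translate, h1]
    congr 2
    ext r
    conv_rhs => rw [← translate_translate_neg h (S r ψ), pairing_translate, translate_S]

/-! ### The space `H¹` on the Fourier side -/

/-- The symbol `(1 + |ξ|²)^{-1/2}`. -/
def besselSymbol (ξ : Space d) : ℝ := (1 + ‖ξ‖ ^ 2) ^ (-1 / 2 : ℝ)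

lemma besselSymbol_pos (ξ : Space d) : 0 < besselSymbol ξ := by unfold besselSymbol; positivity

lemma besselSymbol_le_one (ξ : Space d) : besselSymbol ξ ≤ 1 :=
  Real.rpow_le_one_of_one_le_of_nonpos (by nlinarith [sq_nonneg ‖ξ‖]) (by norm_num)

lemma besselSymbol_sq (ξ : Space d) : (1 + ‖ξ‖ ^ 2) * besselSymbol ξ ^ 2 = 1 := by
  have h : (0 : ℝ) < 1 + ‖ξ‖ ^ 2 := by positivity
  rw [besselSymbol, ← Real.rpow_natCast (_ ^ (-1 / 2 : ℝ)), ← Real.rpow_mul h.le]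
  norm_num
  rw [Real.rpow_neg_one, mul_inv_cancel₀ h.ne']

lemma hasTemperateGrowth_besselSymbol :
    (fun ξ : Space d => (besselSymbol ξ : ℂ)).HasTemperateGrowth := by
  unfold besselSymbol; fun_prop

lemma memLp_besselSymbol_mul (f : L2 d) : MemLp (fun ξ => (besselSymbol ξ : ℂ) * f ξ) 2 volume := by
  refine (Lp.memLp f).of_le ((hasTemperateGrowth_besselSymbol.1.continuous.aestronglyMeasurable).mul
    (Lp.aestronglyMeasurable f)) (Eventually.of_forall fun ξ => ?_)
  rw [norm_mul, Complex.norm_real, Real.norm_of_nonneg (besselSymbol_pos ξ).le]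
  exact mul_le_of_le_one_left (norm_nonneg _) (besselSymbol_le_one ξ)

/-- `w = (1 - Δ/(4π²))^{1/2} f`. -/
def HasBessel (f w : L2 d) : Prop :=
  (𝓕 f : L2 d) =ᵐ[volume] fun ξ => (besselSymbol ξ : ℂ) * (𝓕 w : L2 d) ξ

lemma toDistr_injective {f g : L2 d} (h : toDistr f = toDistr g) : f = g := by
  refine (SchwartzMap.denseRange_toLpCLM (F := ℂ) (p := 2) (by simp) (μ := volume)).eq_of_inner_right
    (𝕜 := ℂ) fun φ => ?_
  have h1 := congrArg (fun T : 𝓢'(Space d, ℂ) => T (conjS φ)) h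
  simp only [toDistr_apply, conjS_conjS] at h1
  exact h1

lemma smulLeftCLM_besselSymbol_toDistr (f : L2 d) :
    TemperedDistribution.smulLeftCLM ℂ (fun ξ : Space d => (besselSymbol ξ : ℂ)) (toDistr f) =
      toDistr (memLp_besselSymbol_mul f).toLp := by
  ext φ
  rw [TemperedDistribution.smulLeftCLM_apply_apply, Lp.toTemperedDistribution_apply,
    Lp.toTemperedDistribution_apply]
  refine integral_congr_ae ?_
  filter_upwards [(memLp_besselSymbol_mul f).coeFn_toLp] with ξ h1
  rw [h1, SchwartzMap.smulLeftCLM_apply_apply hasTemperateGrowth_besselSymbol]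
  simp only [smul_eq_mul]; ring

/-- Inverting the potential puts the bounded symbol on w, which turns the distributional condition
into an almost everywhere identity between L² functions. -/
lemma besselPotential_toDistr_iff (f w : L2 d) :
    TemperedDistribution.besselPotential (Space d) ℂ 1 (toDistr f) = toDistr w ↔ HasBessel f w := by
  rw [← TemperedDistribution.besselPotential_neg_apply_eq_iff]
  have h1 : 𝓕 (TemperedDistribution.besselPotential (Space d) ℂ (-1) (toDistr w)) =
      toDistr (memLp_besselSymbol_mul (𝓕 w)).toLp := by
    rw [TemperedDistribution.fourier_besselPotential_eq_smulLeftCLM_fourier_apply, toDistr,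
      Lp.fourier_toTemperedDistribution_eq, ← smulLeftCLM_besselSymbol_toDistr]
    rfl
  have h2 : (𝓕 (toDistr f) : 𝓢'(Space d, ℂ)) = toDistr (𝓕 f) := Lp.fourier_toTemperedDistribution_eq f
  constructor
  · intro h
    rw [h, h2] at h1
    unfold HasBessel
    rw [toDistr_injective h1]
    exact (memLp_besselSymbol_mul (𝓕 w)).coeFn_toLp
  · intro h
    have h3 : (𝓕 f : L2 d) = (memLp_besselSymbol_mul (𝓕 w)).toLp :=
      Lp.ext (h.trans (memLp_besselSymbol_mul (𝓕 w)).coeFn_toLp.symm)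
    rw [← h3, ← h2] at h1
    simpa only [fourierInv_fourier_eq] using congrArg (fun x : 𝓢'(Space d, ℂ) => (𝓕⁻ x : 𝓢'(Space d, ℂ))) h1

lemma fourier_sub_L2 (f g : L2 d) : (𝓕 (f - g) : L2 d) = 𝓕 f - 𝓕 g :=
  map_sub (Lp.fourierTransformₗᵢ (Space d) ℂ) f g

lemma HasBessel.sub {f g v w : L2 d} (h₁ : HasBessel f v) (h₂ : HasBessel g w) :
    HasBessel (f - g) (v - w) := by
  unfold HasBessel
  rw [fourier_sub_L2, fourier_sub_L2]
  filter_upwards [h₁, h₂, Lp.coeFn_sub (𝓕 f) (𝓕 g), Lp.coeFn_sub (𝓕 v) (𝓕 w)] with ξ h1 h2 h3 h4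
  rw [h3, h4, Pi.sub_apply, Pi.sub_apply, h1, h2, mul_sub]

lemma HasBessel.S {f w : L2 d} (h : HasBessel f w) (t : ℝ) : HasBessel (S t f) (S t w) := by
  unfold HasBessel
  rw [fourier_S, fourier_S]
  filter_upwards [h, phaseMul_coe t (𝓕 f), phaseMul_coe t (𝓕 w)] with ξ h1 h2 h3
  rw [h2, h3, h1]; ring

lemma HasBessel.norm_le {f w : L2 d} (h : HasBessel f w) : ‖f‖ ≤ ‖w‖ := by
  rw [← Lp.norm_fourier_eq f, ← Lp.norm_fourier_eq w]
  refine Lp.norm_le_norm_of_ae_le ?_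
  filter_upwards [h] with ξ h1
  rw [h1, norm_mul, Complex.norm_real, Real.norm_of_nonneg (besselSymbol_pos ξ).le]
  exact mul_le_of_le_one_left (norm_nonneg _) (besselSymbol_le_one ξ)

lemma HasBessel.unique {f v w : L2 d} (h₁ : HasBessel f v) (h₂ : HasBessel f w) : v = w := by
  refine fourier_injective (Lp.ext ?_)
  filter_upwards [h₁, h₂] with ξ h1 h2
  exact mul_left_cancel₀ (Complex.ofReal_ne_zero.2 (besselSymbol_pos ξ).ne') (h1.symm.trans h2)

/-- The Dirichlet integral `∫ |ξ|² |𝓕 f|²`. -/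
def dirichlet (f : L2 d) : ℝ≥0∞ := ∫⁻ ξ, ENNReal.ofReal (‖ξ‖ ^ 2) * ‖(𝓕 f : L2 d) ξ‖ₑ ^ (2 : ℝ)

lemma enorm_sq_eq (f : L2 d) : ‖f‖ₑ ^ 2 = ∫⁻ ξ, ‖(𝓕 f : L2 d) ξ‖ₑ ^ (2 : ℝ) := by
  rw [L2.lintegral_enorm_sq, Lp.norm_fourier_eq, ENNReal.ofReal_pow (norm_nonneg _), ofReal_norm]

lemma enorm_besselSymbol_sq_mul (ξ : Space d) (x : ℝ≥0∞) :
    (1 + ENNReal.ofReal (‖ξ‖ ^ 2)) * (‖(besselSymbol ξ : ℂ)‖ₑ * x) ^ (2 : ℝ) = x ^ (2 : ℝ) := by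
  rw [ENNReal.mul_rpow_of_nonneg _ _ (by norm_num), ← mul_assoc]
  conv_rhs => rw [← one_mul (x ^ (2 : ℝ))]
  congr 1
  rw [← ofReal_norm, Complex.norm_real, Real.norm_of_nonneg (besselSymbol_pos ξ).le,
    ENNReal.rpow_two, ← ENNReal.ofReal_pow (besselSymbol_pos ξ).le, ← ENNReal.ofReal_one,
    ← ENNReal.ofReal_add one_pos.le (by positivity), ← ENNReal.ofReal_mul (by positivity), besselSymbol_sq]

lemma HasBessel.enorm_sq {f w : L2 d} (h : HasBessel f w) : ‖w‖ₑ ^ 2 = ‖f‖ₑ ^ 2 + dirichlet f := by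
  have hm := L2.measurable (𝓕 f : L2 d)
  rw [enorm_sq_eq, enorm_sq_eq f, dirichlet, ← lintegral_add_left (by fun_prop)]
  refine lintegral_congr_ae ?_
  filter_upwards [h] with ξ h1
  rw [h1, enorm_mul, ← enorm_besselSymbol_sq_mul ξ ‖(𝓕 w : L2 d) ξ‖ₑ]
  ring

lemma exists_hasBessel {f : L2 d} (h : dirichlet f ≠ ∞) : ∃ w, HasBessel f w := by
  have hm := L2.measurable (𝓕 f : L2 d)
  have hJ : Measurable (fun ξ : Space d => (besselSymbol ξ : ℂ)) :=
    hasTemperateGrowth_besselSymbol.1.continuous.measurable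
  have hw : MemLp (fun ξ => (besselSymbol ξ : ℂ)⁻¹ * (𝓕 f : L2 d) ξ) 2 volume := by
    refine ⟨(hJ.inv.mul hm).aestronglyMeasurable, ?_⟩
    rw [eLpNorm_lt_top_iff_lintegral_rpow_enorm_lt_top (by norm_num) (by norm_num)]
    have h1 : ∀ ξ, ‖(besselSymbol ξ : ℂ)⁻¹ * (𝓕 f : L2 d) ξ‖ₑ ^ (2 : ℝ) =
        ‖(𝓕 f : L2 d) ξ‖ₑ ^ (2 : ℝ) + ENNReal.ofReal (‖ξ‖ ^ 2) * ‖(𝓕 f : L2 d) ξ‖ₑ ^ (2 : ℝ) := by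
      intro ξ
      rw [← enorm_besselSymbol_sq_mul, ← enorm_mul,
        mul_inv_cancel_left₀ (Complex.ofReal_ne_zero.2 (besselSymbol_pos ξ).ne')]
      ring
    simp only [ENNReal.toReal_ofNat, h1]
    rw [lintegral_add_left (by fun_prop), ← enorm_sq_eq]
    exact ENNReal.add_lt_top.2 ⟨by finiteness, h.lt_top⟩
  refine ⟨𝓕⁻ hw.toLp, ?_⟩
  unfold HasBessel
  rw [fourier_fourierInv_eq]
  filter_upwards [hw.coeFn_toLp] with ξ h1
  rw [h1, mul_inv_cancel_left₀ (Complex.ofReal_ne_zero.2 (besselSymbol_pos ξ).ne')]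

/-! ### The Sobolev embedding `H¹ ⊆ L^{4/d+2}` -/

lemma lintegral_besselSymbol_ne_top :
    ∫⁻ ξ : Space d, ‖(besselSymbol ξ : ℂ)‖ₑ ^ ((d : ℝ) + 2) ≠ ∞ := by
  have h1 : Integrable (fun ξ : Space d => (1 + ‖ξ‖ ^ 2) ^ (-((d : ℝ) + 2) / 2)) :=
    integrable_rpow_neg_one_add_norm_sq (by simp)
  refine ne_top_of_le_ne_top h1.lintegral_lt_top.ne (le_of_eq (lintegral_congr fun ξ => ?_))
  rw [← ofReal_norm, Complex.norm_real, Real.norm_of_nonneg (besselSymbol_pos ξ).le,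
    ENNReal.ofReal_rpow_of_pos (besselSymbol_pos ξ), besselSymbol, ← Real.rpow_mul (by positivity)]
  congr 2; ring

/-- On the Fourier side f is the symbol times w. With r = 4/d + 2 and s = r/(r-1), Hölder gives 𝓕f ∈
L^s from 𝓕w ∈ L² and the symbol in L^{d+2}. The map from L^s back to L^r is Hausdorff–Young,
obtained from `marcinkiewicz` with B = 1. -/
lemma exists_sobolev (hd : 1 ≤ d) : ∃ C : ℝ≥0∞, C ≠ ∞ ∧ ∀ f w : L2 d, HasBessel f w →
    ∫⁻ x, ‖f x‖ₑ ^ (4 / d + 2 : ℝ) ≤ C * ‖w‖ₑ ^ (4 / d + 2 : ℝ) := by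
  have hd0 : (0 : ℝ) < d := by exact_mod_cast hd
  set r : ℝ := 4 / d + 2 with hr
  have hr2 : 2 < r := by rw [hr]; linarith [show (0 : ℝ) < 4 / d by positivity]
  set s : ℝ := r / (r - 1) with hs
  have hr1 : 0 < r - 1 := by linarith
  have hs0 : 0 < s := by positivity
  have hs2 : 0 < 2 - s := by rw [sub_pos, hs, div_lt_iff₀ hr1]; linarith
  obtain ⟨C, hC, H⟩ := marcinkiewicz (d := d) hr2
  set K := ∫⁻ ξ : Space d, ‖(besselSymbol ξ : ℂ)‖ₑ ^ ((d : ℝ) + 2) with hK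
  -- The exponent left for the symbol is 2r/(r-2) = d + 2, and (1 + |ξ|²)^{-(d+2)/2} is integrable
  -- because d + 2 > d.
  have hexp : s * (2 / (2 - s)) = d + 2 := by
    have h1 : r - 2 ≠ 0 := by linarith
    have h2 : 2 - s = (r - 2) / (r - 1) := by rw [hs]; field_simp; ring
    have h3 : r - 2 = 4 / d := by rw [hr]; ring
    have h4 : s * (2 / (2 - s)) = 2 * r / (r - 2) := by rw [h2, hs]; field_simp
    rw [h4, h3, hr]; field_simp; ring
  refine ⟨C * (K ^ ((2 - s) / 2)) ^ (r - 1), ENNReal.mul_ne_top hC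
    (ENNReal.rpow_ne_top_of_nonneg hr1.le (ENNReal.rpow_ne_top_of_nonneg (by positivity)
      lintegral_besselSymbol_ne_top)), fun f w hf => ?_⟩
  have h0 : ∀ g : L2 d, ‖fourierL2 g‖ ≤ ‖g‖ := fun g => by
    rw [← Lp.norm_fourier_eq, show fourierL2 g = 𝓕⁻ g from rfl, fourier_fourierInv_eq]
  have h1 := H fourierL2 1 one_pos h0 ae_enorm_fourierL2_le (𝓕 f)
  have h2 : fourierL2 (𝓕 f : L2 d) = f := by
    show 𝓕⁻ (𝓕 f : L2 d) = f
    rw [fourierInv_fourier_eq]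
  rw [h2, ENNReal.ofReal_one, ENNReal.one_rpow, mul_one, ← hs] at h1
  refine h1.trans ?_
  rw [mul_assoc]
  gcongr
  have hJ : Measurable (fun ξ : Space d => (besselSymbol ξ : ℂ)) :=
    hasTemperateGrowth_besselSymbol.1.continuous.measurable
  have hw := L2.measurable (𝓕 w : L2 d)
  have hconj : (2 / (2 - s)).HolderConjugate (2 / s) := by
    rw [Real.holderConjugate_iff]
    refine ⟨by rw [lt_div_iff₀ hs2]; linarith, by field_simp; ring⟩
  have h3 : ∫⁻ ξ, ‖(𝓕 f : L2 d) ξ‖ₑ ^ s ≤ K ^ ((2 - s) / 2) * ‖w‖ₑ ^ s := by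
    have h4 := ENNReal.lintegral_mul_le_Lp_mul_Lq volume hconj
      (f := fun ξ : Space d => ‖(besselSymbol ξ : ℂ)‖ₑ ^ s) (g := fun ξ => ‖(𝓕 w : L2 d) ξ‖ₑ ^ s)
      (hJ.enorm.pow_const s).aemeasurable (by fun_prop)
    have h5 : ∫⁻ ξ, ‖(𝓕 w : L2 d) ξ‖ₑ ^ (2 : ℝ) = ‖w‖ₑ ^ (2 : ℝ) := by
      rw [← enorm_sq_eq, ENNReal.rpow_two]
    simp only [← ENNReal.rpow_mul, hexp, one_div_div, mul_div_cancel₀ _ hs0.ne', h5] at h4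
    rw [show 2 * (s / 2) = s by ring] at h4
    refine (le_of_eq (lintegral_congr_ae ?_)).trans h4
    filter_upwards [hf] with ξ h6
    rw [h6, enorm_mul, ENNReal.mul_rpow_of_nonneg _ _ hs0.le, Pi.mul_apply]
  refine (ENNReal.rpow_le_rpow h3 hr1.le).trans (le_of_eq ?_)
  rw [ENNReal.mul_rpow_of_nonneg _ _ hr1.le, ← ENNReal.rpow_mul ‖w‖ₑ, hs, div_mul_cancel₀ _ hr1.ne']

/-! ### Difference quotients and the Dirichlet integral -/

/-- The contribution `∫ (2π⟨e, ξ⟩)² |𝓕 f|²` of a direction `e` to the Dirichlet integral. -/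
def directional (e : Space d) (f : L2 d) : ℝ≥0∞ :=
  ∫⁻ ξ, ENNReal.ofReal ((2 * Real.pi * inner ℝ e ξ) ^ 2) * ‖(𝓕 f : L2 d) ξ‖ₑ ^ (2 : ℝ)

lemma enorm_translate_sub_sq (h : Space d) (f : L2 d) :
    ‖translate h f - f‖ₑ ^ 2 = ∫⁻ ξ, ‖char h ξ - 1‖ₑ ^ 2 * ‖(𝓕 f : L2 d) ξ‖ₑ ^ (2 : ℝ) := by
  rw [enorm_sq_eq, fourier_sub_L2]
  refine lintegral_congr_ae ?_
  filter_upwards [fourier_translate h f, Lp.coeFn_sub (𝓕 (translate h f)) (𝓕 f)] with ξ h1 h2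
  rw [h2, Pi.sub_apply, h1, ← sub_one_mul, enorm_mul, ENNReal.mul_rpow_of_nonneg _ _ (by norm_num),
    ENNReal.rpow_two]

lemma char_smul_eq (t : ℝ) (e ξ : Space d) :
    char (t • e) ξ = Complex.exp (Complex.I * (t * (2 * Real.pi * inner ℝ e ξ) : ℝ)) := by
  rw [char_eq_exp, inner_smul_left]
  congr 3; simp; ring

lemma enorm_translate_sub_sq_le (t : ℝ) (e : Space d) (f : L2 d) :
    ‖translate (t • e) f - f‖ₑ ^ 2 ≤ ENNReal.ofReal (t ^ 2) * directional e f := by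
  have hm := L2.measurable (𝓕 f : L2 d)
  rw [enorm_translate_sub_sq, directional, ← lintegral_const_mul _ (by fun_prop)]
  refine lintegral_mono fun ξ => ?_
  rw [← mul_assoc, ← ENNReal.ofReal_mul (sq_nonneg t), ← mul_pow, char_smul_eq, ← ofReal_norm,
    ← ENNReal.ofReal_pow (norm_nonneg _)]
  gcongr ENNReal.ofReal ?_ * _
  rw [← sq_abs (t * _)]
  exact pow_le_pow_left₀ (norm_nonneg _) Real.norm_exp_I_mul_ofReal_sub_one_le 2

lemma tendsto_char_smul (e ξ : Space d) :
    Tendsto (fun n : ℕ => ENNReal.ofReal (((n : ℝ) + 1) ^ 2) * ‖char ((1 / ((n : ℝ) + 1)) • e) ξ - 1‖ₑ ^ 2)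
      atTop (𝓝 (ENNReal.ofReal ((2 * Real.pi * inner ℝ e ξ) ^ 2))) := by
  set θ : ℝ := 2 * Real.pi * inner ℝ e ξ with hθ
  have h1 : Tendsto (fun n : ℕ => (((n : ℝ) + 1 : ℝ) : ℂ) * (char ((1 / ((n : ℝ) + 1)) • e) ξ - 1)) atTop
      (𝓝 (Complex.I * θ)) := by
    rw [tendsto_iff_norm_sub_tendsto_zero]
    have h2 : Tendsto (fun n : ℕ => 2 * θ ^ 2 * (1 / ((n : ℝ) + 1))) atTop (𝓝 0) := by
      simpa only [mul_zero] using
        (tendsto_one_div_add_atTop_nhds_zero_nat (𝕜 := ℝ)).const_mul (2 * θ ^ 2)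
    refine squeeze_zero (fun n => norm_nonneg _) (fun n => ?_) h2
    have hn : (0 : ℝ) < n + 1 := by positivity
    have hn' : (((n : ℝ) + 1 : ℝ) : ℂ) ≠ 0 := by exact_mod_cast hn.ne'
    have h3 : (((n : ℝ) + 1 : ℝ) : ℂ) * (char ((1 / ((n : ℝ) + 1)) • e) ξ - 1) - Complex.I * θ =
        (((n : ℝ) + 1 : ℝ) : ℂ) * (Complex.exp (Complex.I * (1 / ((n : ℝ) + 1) * θ : ℝ)) - 1 -
          Complex.I * (1 / ((n : ℝ) + 1) * θ : ℝ)) := by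
      rw [char_smul_eq, mul_sub _ _ (Complex.I * _), ← hθ]
      congr 1
      push_cast at hn' ⊢
      field_simp
    rw [h3, norm_mul, Complex.norm_real, Real.norm_of_nonneg hn.le]
    refine (mul_le_mul_of_nonneg_left (norm_exp_I_sub_sub_le _) hn.le).trans (le_of_eq ?_)
    field_simp
  have h4 := ENNReal.tendsto_ofReal (h1.norm.pow 2)
  rw [norm_mul, Complex.norm_I, one_mul, Complex.norm_real, Real.norm_eq_abs, sq_abs] at h4
  refine h4.congr fun n => ?_
  rw [norm_mul, mul_pow, ENNReal.ofReal_mul (by positivity), Complex.norm_real, Real.norm_eq_abs, sq_abs,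
    ← ofReal_norm, ENNReal.ofReal_pow (norm_nonneg _)]

/-- Fatou's lemma along the steps t = 1/(n+1): rescaled, |e^{itθ} - 1|² tends to θ². -/
lemma directional_le {e : Space d} {f : L2 d} {A : ℝ≥0∞}
    (h : ∀ t : ℝ, ‖translate (t • e) f - f‖ₑ ^ 2 ≤ ENNReal.ofReal (t ^ 2) * A) : directional e f ≤ A := by
  have hm := L2.measurable (𝓕 f : L2 d)
  have hc : ∀ n : ℕ, Measurable (fun ξ : Space d => char ((1 / ((n : ℝ) + 1)) • e) ξ) := fun n =>
    (hasTemperateGrowth_char _).1.continuous.measurable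
  set F : ℕ → Space d → ℝ≥0∞ := fun n ξ => ENNReal.ofReal (((n : ℝ) + 1) ^ 2) *
    ‖char ((1 / ((n : ℝ) + 1)) • e) ξ - 1‖ₑ ^ 2 * ‖(𝓕 f : L2 d) ξ‖ₑ ^ (2 : ℝ) with hF
  have h1 : directional e f = ∫⁻ ξ, liminf (fun n => F n ξ) atTop := by
    refine lintegral_congr fun ξ => (Tendsto.liminf_eq ?_).symm
    exact ENNReal.Tendsto.mul_const (tendsto_char_smul e ξ) (Or.inr (by finiteness))
  rw [h1]
  refine (lintegral_liminf_le fun n => by have := hc n; fun_prop).trans ?_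
  refine liminf_le_of_le (by isBoundedDefault) fun b hb => ?_
  obtain ⟨n, hn⟩ := hb.exists
  refine hn.trans ?_
  simp only [hF, mul_assoc]
  rw [lintegral_const_mul _ (by have := hc n; fun_prop), ← enorm_translate_sub_sq]
  refine (mul_le_mul_right (h _) _).trans (le_of_eq ?_)
  rw [← mul_assoc, ← ENNReal.ofReal_mul (by positivity), ← mul_pow, mul_one_div_cancel (by positivity)]
  simp

lemma sum_directional (f : L2 d) :
    ∑ j, directional (EuclideanSpace.single j (1 : ℝ)) f =
      ENNReal.ofReal ((2 * Real.pi) ^ 2) * dirichlet f := by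
  have hm := L2.measurable (𝓕 f : L2 d)
  simp only [directional]
  rw [← lintegral_finsetSum _ (fun j _ => by fun_prop), dirichlet, ← lintegral_const_mul _ (by fun_prop)]
  refine lintegral_congr fun ξ => ?_
  rw [← Finset.sum_mul, ← mul_assoc, ← ENNReal.ofReal_mul (by positivity),
    ← ENNReal.ofReal_sum_of_nonneg (fun j _ => sq_nonneg _), EuclideanSpace.norm_sq_eq, Finset.mul_sum]
  congr 2
  refine Finset.sum_congr rfl fun j _ => ?_
  rw [EuclideanSpace.inner_single_left, mul_pow]
  simp

/-- Difference quotients in the coordinate directions recover the Dirichlet integral. This transfers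
Lipschitz control of translates to H¹ without differentiating the nonlinearity. -/
lemma dirichlet_le {f g : L2 d} {M : ℝ≥0∞}
    (h : ∀ y : Space d, ‖translate y f - f‖ₑ ≤ M * ‖translate y g - g‖ₑ) :
    dirichlet f ≤ M ^ 2 * dirichlet g := by
  have hpi : (0 : ℝ) < (2 * Real.pi) ^ 2 := by positivity
  rw [← ENNReal.mul_le_mul_iff_right (ENNReal.ofReal_pos.2 hpi).ne' ENNReal.ofReal_ne_top,
    mul_left_comm, ← sum_directional, ← sum_directional, Finset.mul_sum]
  refine Finset.sum_le_sum fun j _ => directional_le fun t => ?_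
  refine (pow_le_pow_left' (h _) 2).trans ?_
  rw [mul_pow, mul_left_comm]
  gcongr
  exact enorm_translate_sub_sq_le t _ g

/-! ### Persistence of `H¹` regularity -/

/-- Stability applied to u and its translate. The σ-norm is translation invariant, so the short
intervals and their number, hence δ and K, do not depend on h. -/
lemma IsMild.exists_translate_sub_le {q : ℝ} (hq : 1 ≤ q) (hD : Dispersive d q) {c : ℂ} {u : ℝ → L2 d}
    {b : ℝ} (hu : IsMild q c u 0 b) : ∃ K : ℝ≥0∞, K ≠ ∞ ∧ ∃ δ : ℝ, 0 < δ ∧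
      (∀ t ∈ Icc 0 b, ∀ h, ‖DampedNLS.translate h (u t) - u t‖ₑ ≤
        K * ‖DampedNLS.translate h (u 0) - u 0‖ₑ) ∧
      ∀ s t, 0 ≤ s → s ≤ t → t ≤ b → t - s ≤ δ → ∀ h,
        ‖DampedNLS.translate h (S (-t) (u t) - S (-s) (u s)) - (S (-t) (u t) - S (-s) (u s))‖ₑ ≤
          K * stNorm q u (Icc s t) ^ q * ‖DampedNLS.translate h (u 0) - u 0‖ₑ := by
  obtain ⟨C, hC, η, hη, H⟩ := exists_stability (d := d) hq hD c
  obtain ⟨δ, hδ, hδu⟩ := exists_delta_stNorm hq hu.stNorm_ne_top hη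
  have key : ∀ s t, 0 ≤ s → s ≤ t → t ≤ b → t - s ≤ δ → ∀ h,
      ‖DampedNLS.translate h (u t) - u t‖ₑ ≤ C * ‖DampedNLS.translate h (u s) - u s‖ₑ ∧
      ‖DampedNLS.translate h (S (-t) (u t) - S (-s) (u s)) - (S (-t) (u t) - S (-s) (u s))‖ₑ ≤
        C * (stNorm q u (Icc s t) ^ q + stNorm q u (Icc s t) ^ q) *
          ‖DampedNLS.translate h (u s) - u s‖ₑ := by
    intro s t hs hst ht hδst h
    have h1 := H s t _ _ hst ((hu.mono hq hs ht).translate h) (hu.mono hq hs ht)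
      (by rw [stNorm_translate]; exact hδu s t hs ht hδst) (hδu s t hs ht hδst)
    rw [stNorm_translate] at h1
    refine ⟨h1.1, le_of_eq_of_le ?_ h1.2⟩
    rw [map_sub, translate_S, translate_S, map_sub, map_sub]
    congr 1; abel
  have hP : ∀ t ∈ Icc 0 b, ∃ K : ℝ≥0∞, K ≠ ∞ ∧ ∀ r ∈ Icc 0 t, ∀ h,
      ‖DampedNLS.translate h (u r) - u r‖ₑ ≤ K * ‖DampedNLS.translate h (u 0) - u 0‖ₑ := by
    refine interval_chain hδ ⟨1, ENNReal.one_ne_top, fun r hr h => ?_⟩ fun s t hs hst ht hδst ⟨K, hK, hKr⟩ =>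
      ⟨K + C * K, by finiteness, fun r hr h => ?_⟩
    · rw [le_antisymm hr.2 hr.1, one_mul]
    · rcases le_total r s with hrs | hsr
      · exact (hKr r ⟨hr.1, hrs⟩ h).trans (by gcongr; exact le_self_add)
      · refine ((key s r hs hsr (hr.2.trans ht) (by linarith [hr.2]) h).1).trans ?_
        refine (mul_le_mul_right (hKr s ⟨hs, le_rfl⟩ h) C).trans ?_
        rw [← mul_assoc]
        gcongr
        exact le_add_self
  rcases lt_or_ge b 0 with hb | hb
  · exact ⟨0, ENNReal.zero_ne_top, δ, hδ, fun t ht => absurd (ht.1.trans ht.2) hb.not_ge,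
      fun s t hs hst ht => absurd (hs.trans (hst.trans ht)) hb.not_ge⟩
  obtain ⟨K, hK, hKr⟩ := hP b ⟨hb, le_rfl⟩
  refine ⟨K + C * 2 * K, by finiteness, δ, hδ, fun t ht h => ?_, fun s t hs hst ht hδst h => ?_⟩
  · exact (hKr t ht h).trans (by gcongr; exact le_self_add)
  · refine (key s t hs hst ht hδst h).2.trans ?_
    refine (mul_le_mul_right (hKr s ⟨hs, hst.trans ht⟩ h) _).trans ?_
    rw [← mul_assoc, ← two_mul]
    refine mul_le_mul_left ?_ _
    rw [show C * (2 * stNorm q u (Icc s t) ^ q) * K = C * 2 * K * stNorm q u (Icc s t) ^ q by ring]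
    exact mul_le_mul_left le_add_self _

/-- `dirichlet_le` keeps the Dirichlet integral finite. Continuity is shown for S(-t)w(t), since the
increments of S(-t)u(t) have Dirichlet integral controlled by a power of the σ-norm on [s, t].
Applying S(t) gives w back. -/
lemma IsMild.exists_bessel {q : ℝ} (hq : 1 ≤ q) (hD : Dispersive d q) {c : ℂ} {u : ℝ → L2 d} {b : ℝ}
    (hu : IsMild q c u 0 b) {w₀ : L2 d} (h0 : HasBessel (u 0) w₀) :
    ∃ w : ℝ → L2 d, ContinuousOn w (Icc 0 b) ∧ ∀ t ∈ Icc 0 b, HasBessel (u t) (w t) := by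
  obtain ⟨K, hK, δ, hδ, hKu, hKz⟩ := hu.exists_translate_sub_le hq hD
  have hD0 : dirichlet (u 0) ≠ ∞ := by
    refine ne_top_of_le_ne_top (b := ‖w₀‖ₑ ^ 2) (by finiteness) ?_
    rw [h0.enorm_sq]; exact le_add_self
  have hex : ∀ t, ∃ w, t ∈ Icc 0 b → HasBessel (u t) w := fun t => by
    by_cases ht : t ∈ Icc 0 b
    · obtain ⟨w, hw⟩ := exists_hasBessel (ne_top_of_le_ne_top (by finiteness) (dirichlet_le (hKu t ht)))
      exact ⟨w, fun _ => hw⟩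
    · exact ⟨0, fun h => absurd h ht⟩
  choose w hw using hex
  have hz : Continuous fun t => S (-t) (u t) := continuous_S_comp continuous_neg hu.continuous
  have hzw : ∀ t ∈ Icc 0 b, HasBessel (S (-t) (u t)) (S (-t) (w t)) := fun t ht => (hw t ht).S (-t)
  have hcont : ContinuousOn (fun t => S (-t) (w t)) (Icc 0 b) := by
    refine continuousOn_Icc_of_enorm fun ε hε => ?_
    -- The squared increment is an L² part plus a Dirichlet part; each receives half of ε².
    have hε2 : ε ^ 2 / 2 ≠ 0 := (ENNReal.half_pos (pow_ne_zero 2 hε)).ne'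
    obtain ⟨ε₁, hε₁, -, hε₁'⟩ := exists_rpow_small ENNReal.one_ne_top two_pos hε2
    obtain ⟨ε₂, hε₂, -, hε₂'⟩ := exists_rpow_small (C := K ^ 2 * dirichlet (u 0)) (p := q * 2)
      (by finiteness) (by positivity) hε2
    obtain ⟨δ₂, hδ₂, hδu⟩ := exists_delta_stNorm hq hu.stNorm_ne_top hε₂
    obtain ⟨δ₁, hδ₁, hδz⟩ := EMetric.uniformContinuousOn_iff.1
      ((isCompact_Icc (a := 0) (b := b)).uniformContinuousOn_of_continuous hz.continuousOn) ε₁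
      (pos_iff_ne_zero.2 hε₁)
    obtain ⟨δ₃, -, hδ₃, hδ₃'⟩ := ENNReal.lt_iff_exists_real_btwn.1 hδ₁
    rw [ENNReal.ofReal_pos] at hδ₃
    refine ⟨min δ (min δ₂ δ₃), lt_min hδ (lt_min hδ₂ hδ₃), fun s t hs hst ht hst' => ?_⟩
    rw [le_min_iff, le_min_iff] at hst'
    have hsb : s ∈ Icc 0 b := ⟨hs, hst.trans ht⟩
    have htb : t ∈ Icc 0 b := ⟨hs.trans hst, ht⟩
    rw [← ENNReal.pow_le_pow_left_iff two_ne_zero, ((hzw t htb).sub (hzw s hsb)).enorm_sq,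
      ← ENNReal.add_halves (ε ^ 2)]
    refine add_le_add ?_ ?_
    · have h1 : edist t s < δ₁ := by
        rw [edist_dist, Real.dist_eq, abs_of_nonneg (sub_nonneg.2 hst)]
        exact (ENNReal.ofReal_le_ofReal hst'.2.2).trans_lt hδ₃'
      have h2 := (hδz htb hsb h1).le
      rw [edist_eq_enorm_sub] at h2
      rw [one_mul, ENNReal.rpow_two] at hε₁'
      exact (pow_le_pow_left' h2 2).trans hε₁'
    · refine (dirichlet_le (hKz s t hs hst ht hst'.1)).trans (le_trans ?_ hε₂')
      have h3 := ENNReal.rpow_le_rpow (hδu s t hs ht hst'.2.1) (show 0 ≤ q by linarith)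
      rw [mul_pow, mul_right_comm, ENNReal.rpow_mul, ENNReal.rpow_two]
      gcongr
  refine ⟨w, ?_, hw⟩
  simpa using continuousOn_S continuousOn_id hcont

/-! ### Well-posedness in `H¹` -/

lemma continuousInH1_of_isMild {q : ℝ} (hq : 1 ≤ q) (hD : Dispersive d q) {c : ℂ} {u : ℝ → L2 d}
    (hu : ∀ b, 0 ≤ b → IsMild q c u 0 b) {w₀ : L2 d} (h0 : HasBessel (u 0) w₀) (T : EReal) :
    ContinuousInH1 u (timeInterval T) := by
  have hex : ∀ t : ℝ, ∃ w, 0 ≤ t → HasBessel (u t) w := fun t => by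
    by_cases ht : 0 ≤ t
    · obtain ⟨w, -, hw⟩ := (hu t ht).exists_bessel hq hD h0
      exact ⟨w t, fun _ => hw t ⟨ht, le_rfl⟩⟩
    · exact ⟨0, fun h => absurd h ht⟩
  choose w hw using hex
  refine ⟨w, ?_, fun t ht => (besselPotential_toDistr_iff _ _).2 (hw t ht.1)⟩
  refine ContinuousOn.mono (s := Ici 0) (fun t ht => ?_) fun t ht => ht.1
  have ht : 0 ≤ t := ht
  obtain ⟨v, hv, hvw⟩ := (hu (t + 1) (by linarith)).exists_bessel hq hD h0
  have h1 : ContinuousOn w (Icc 0 (t + 1)) :=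
    hv.congr fun r hr => (hw r hr.1).unique (hvw r hr)
  refine (h1 t ⟨ht, by linarith⟩).mono_of_mem_nhdsWithin ?_
  filter_upwards [self_mem_nhdsWithin, mem_nhdsWithin_of_mem_nhds (Iio_mem_nhds (lt_add_one t))]
    with r hr hr'
  exact ⟨hr, le_of_lt hr'⟩

lemma ContinuousInH1.continuousOn {u : ℝ → L2 d} {I : Set ℝ} (h : ContinuousInH1 u I) :
    ContinuousOn u I := by
  obtain ⟨w, hw, hwu⟩ := h
  have hb : ∀ t ∈ I, HasBessel (u t) (w t) := fun t ht => (besselPotential_toDistr_iff _ _).1 (hwu t ht)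
  intro t ht
  have h1 := tendsto_iff_norm_sub_tendsto_zero.1 (hw t ht)
  refine tendsto_iff_norm_sub_tendsto_zero.2 (squeeze_zero' (Eventually.of_forall fun r => norm_nonneg _)
    ?_ h1)
  filter_upwards [self_mem_nhdsWithin] with r hr
  exact ((hb r hr).sub (hb t ht)).norm_le

/-- Sobolev at each time and compactness of [0, t]; hence uniqueness for H¹ solutions reduces to the
L² theory. -/
lemma ContinuousInH1.sigmaNorm_lt_top (hd : 1 ≤ d) {u : ℝ → L2 d} {t : ℝ}
    (h : ContinuousInH1 u (Icc 0 t)) : sigmaNorm u (Icc 0 t) < ∞ := by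
  obtain ⟨w, hw, hwu⟩ := h
  obtain ⟨C, hC, H⟩ := exists_sobolev (d := d) hd
  obtain ⟨M, hM⟩ := isCompact_Icc.exists_bound_of_continuousOn hw
  have hr : (0 : ℝ) < 4 / d + 2 := by positivity
  rw [sigmaNorm_eq, stNorm]
  refine ENNReal.rpow_lt_top_of_nonneg (by positivity) (ne_top_of_le_ne_top
    (b := ∫⁻ _ in Icc 0 t, C * ENNReal.ofReal M ^ (4 / d + 2 : ℝ)) ?_ ?_)
  · rw [setLIntegral_const, Real.volume_Icc]
    exact ENNReal.mul_ne_top (ENNReal.mul_ne_top hC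
      (ENNReal.rpow_ne_top_of_nonneg hr.le ENNReal.ofReal_ne_top)) ENNReal.ofReal_ne_top
  · refine setLIntegral_mono' measurableSet_Icc fun r hr' => ?_
    rw [nrm_eq, ← ENNReal.rpow_mul, one_div_mul_cancel hr.ne', ENNReal.rpow_one]
    refine (H _ _ ((besselPotential_toDistr_iff _ _).1 (hwu r hr'))).trans ?_
    gcongr
    rw [← ofReal_norm]
    exact ENNReal.ofReal_le_ofReal (hM r hr')

lemma ContinuousInH1.mono {u : ℝ → L2 d} {I J : Set ℝ} (h : ContinuousInH1 u J) (hIJ : I ⊆ J) :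
    ContinuousInH1 u I := by
  obtain ⟨w, hw, hwu⟩ := h
  exact ⟨w, hw.mono hIJ, fun t ht => hwu t (hIJ ht)⟩

theorem hasUniqueGlobalSolution_H1 (hd : 1 ≤ d) (hd' : d ≤ 4) {a p : ℝ} (ha : 0 < a)
    (hp : p = 4 / (d : ℝ)) {u₀ : L2 d} (h₀ : MemH1 u₀) :
    HasUniqueGlobalSolution (IsH1Solution d a p u₀) := by
  obtain ⟨w₀, hw₀⟩ := h₀
  obtain ⟨u, h0, hu⟩ := exists_global_mild (one_le_four_div hd hd') (dispersive hd) (c := coeff a)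
    (by rw [coeff_re]; linarith) u₀
  refine ⟨u, ⟨EReal.coe_lt_top 0, continuousInH1_of_isMild (one_le_four_div hd hd') (dispersive hd) hu
    (w₀ := w₀) ?_ ⊤, solvesEquation_of_isMild hd hd' hp h0 hu ⊤⟩, fun v T hv => ?_⟩
  · rw [h0]; exact (besselPotential_toDistr_iff _ _).1 hw₀
  · exact hv.equation.eqOn hd hd' hp h0 hu hv.continuous.continuousOn fun t ht =>
      (hv.continuous.mono (Icc_subset_timeInterval ht)).sigmaNorm_lt_top hd

/-- The blow-up statement does not assume H¹ data; membership comes from continuity in H¹ at time 0.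
-/
lemma IsH1Solution.memH1 {a p : ℝ} {u₀ : L2 d} {u : ℝ → L2 d} {T : EReal}
    (h : IsH1Solution d a p u₀ u T) : MemH1 u₀ := by
  obtain ⟨w, -, hw⟩ := h.continuous
  refine ⟨w 0, ?_⟩
  rw [← h.equation.1]
  exact hw 0 ⟨le_rfl, h.pos⟩

end DampedNLS

end

/-! ### The theorem -/

theorem proposition3p3 (d : ℕ) (hd : 1 ≤ d) (hd' : d ≤ 4) (a p : ℝ) (ha : 0 < a)
    (hp : p = 4 / (d : ℝ)) :
    -- blow-up alternative, for `H¹` solutions and for `L²` solutions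
    (∀ (u₀ : DampedNLS.L2 d) (u : ℝ → DampedNLS.L2 d) (T : EReal),
      DampedNLS.IsMaximal (DampedNLS.IsH1Solution d a p u₀) u T → T < ⊤ →
        DampedNLS.sigmaNorm u (DampedNLS.timeInterval T) = ∞) ∧
    (∀ (u₀ : DampedNLS.L2 d) (u : ℝ → DampedNLS.L2 d) (T : EReal),
      DampedNLS.IsMaximal (DampedNLS.IsL2Solution d a p u₀) u T → T < ⊤ →
        DampedNLS.sigmaNorm u (DampedNLS.timeInterval T) = ∞) ∧
    -- global existence, for `H¹` data and for `L²` data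
    (∀ u₀ : DampedNLS.L2 d, DampedNLS.MemH1 u₀ →
      DampedNLS.HasUniqueGlobalSolution (DampedNLS.IsH1Solution d a p u₀)) ∧
    (∀ u₀ : DampedNLS.L2 d,
      DampedNLS.HasUniqueGlobalSolution (DampedNLS.IsL2Solution d a p u₀)) := by
  -- The alternatives hold by contradiction: maximal solutions have T = ⊤, so T < ⊤ is impossible.
  refine ⟨fun u₀ u T hu hT => absurd ?_ hT.ne, fun u₀ u T hu hT => absurd ?_ hT.ne,
    fun u₀ h₀ => DampedNLS.hasUniqueGlobalSolution_H1 hd hd' ha hp h₀,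
    fun u₀ => DampedNLS.hasUniqueGlobalSolution_L2 hd hd' ha hp u₀⟩
  · exact (DampedNLS.hasUniqueGlobalSolution_H1 hd hd' ha hp hu.1.memH1).eq_top hu
  · exact (DampedNLS.hasUniqueGlobalSolution_L2 hd hd' ha hp u₀).eq_top hu
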